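/- Let $W$ be a complex vector space of dimension $m+1\ge 2$, and let indices $\alpha,\beta$ run over $1,\dots,m-1$. Let $S\subset\mathbb PW$ be a smooth ($C^\infty$) real hypersurface, possibly only immersed ($\iota:S\to\mathbb PW$, with $z\in S$ identified with $\iota(z)$). Let $\widehat S\subset W\setminus\{0\}$ be the cone over $S$, let $\widehat T$ be the real linear subspace tangent to $\widehat S$ at a given point, and let $\widehat H_z=\widehat T\cap \mathrm i\widehat T$ be its maximal complex subspace, which depends only on $z\in S$. Let $\mathcal F_S$ be the set of bases $f=(f_0,\dots,f_m)$ of $W$ with $[f_0]=z\in S$ such that the real span of $f_0,\mathrm if_0,\dots,f_{m-1},\mathrm if_{m-1},f_m$ is the tangent space $\widehat T$ to $\widehat S$ at $f_0$. Let $\Omega^b_a$ be the Maurer–Cartan forms, $\mathrm df_a=\Omega^b_af_b$. On $\mathcal F_S$ the second-order coefficients $P_{\alpha\beta}=P_{\beta\alpha}$, $P_{\alpha\bar\beta}=-\overline{P_{\beta\bar\alpha}}$, $P_{\alpha m}$ and $P_{mm}\in\mathrm i\mathbb R$ are defined by $$\Omega^m_\alpha=P_{\alpha\beta}\Omega^\beta_0+P_{\alpha\bar\beta}\overline{\Omega^\beta_0}+P_{\alpha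 m}\Omega^m_0,$$ $$\Omega^0_0+\overline{\Omega^m_m}-\overline{\Omega^0_0}-\Omega^m_m=-P_{\alpha m}\Omega^\alpha_0+\overline{P_{\alpha m}}\,\overline{\Omega^\alpha_0}+P_{mm}\Omega^m_0 .$$ Put $P=(P_{\alpha\beta})$ and $L=(P_{\alpha\bar\beta})$ (the second fundamental form of $S$), and let $\mathcal P_S\subset\mathcal F_S$ be the set of frames at which $P_{\alpha m}=0$ and $P_{mm}=0$. $S$ is strongly $\mathbb C$-linearly convex if the hermitian form $\mathrm i P_{\alpha\bar\beta}\mathsf z^\alpha\bar{\mathsf z}^\beta$ is definite at every frame of $\mathcal F_S$ and, for every $w\in\widehat S$ over $z \in S$ and every $u\in\widehat H_z\setminus\mathbb Cw$, the real line $t\mapsto w+tu$ does not make second-order contact with $\widehat S$ at $w$. For a basis $f$ of $W$ with dual basis $(f^0,\dots,f^m)$ of $W^*$ put $\Gamma(f)=(f^m,f^1,\dots,f^{m-1},f^0)$. The Gauss map $\gamma:S\to\mathbb PW^*$ sends $z=[f_0]$ to $[f^m]$ for $f\in\mathcal F_S$ over $z$ (equivalently, to the annihilator of $\widehat H_z$).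 The dual of $S$ is $S^*=\gamma(S)$, regarded as the hypersurface immersed by $\gamma$. Suppose that $S$ is strongly $\mathbb C$-linearly convex. Then: 1. $\gamma$ immerses $S$ as a smooth real hypersurface $S^*$ in $\mathbb PW^*$, and $S^*$ is again strongly $\mathbb C$-linearly convex. 2. $\Gamma(\mathcal P_S)=\mathcal P_{S^*}$, where frames over $z\in S$ correspond to frames over $\gamma(z)$ (regarded as the image of that same point $z$). 3. For every $f\in\mathcal F_S$ (in particular every $f\in\mathcal P_S$), $\Gamma(f)\in\mathcal F_{S^*}$, and there are matrices $Q,M$ with $$\begin{pmatrix}P&L\\L^t&-\bar P\end{pmatrix}^{-1}=\begin{pmatrix}Q&M\\M^t&-\bar Q\end{pmatrix}$$ at $f$ such that the second fundamental form of $S^*$ at $\Gamma(f)$ is given by $P^*=Q$ and $L^*=-M$. 4. If moreover $\gamma$ is a homeomorphism onto its image (for instance if $S$ is compact and $\gamma$ is injective), then the subset $S^*=\gamma(S)\subset\mathbb PW^*$ is an embedded strongly $\mathbb C$-linearly convex hypersurface, and $\Gamma(\mathcal P_S)=\mathcal P_{S^*}$ as sets of bases of $W^*$. -/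

import Mathlib

open Set Topology
open scoped LinearAlgebra.Projectivization ContDiff ComplexConjugate Matrix

namespace CRHypersurface

section Basic

variable {V : Type*} [NormedAddCommGroup V] [NormedSpace ℂ V]
variable {M : Type*} [TopologicalSpace M]

/-- The quotient topology on projective space: `U ⊆ ℙ V` is open iff its preimage in
`V \ {0}` is open. -/
noncomputable instance projTopology : TopologicalSpace (ℙ ℂ V) :=
  TopologicalSpace.coinduced (Projectivization.mk' ℂ : {v : V // v ≠ 0} → ℙ ℂ V) inferInstance

/-- The cone `Ŝ = {v ≠ 0 | [v] ∈ S}` over a subset `S` of projective space. -/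
def coneOver (S : Set (ℙ ℂ V)) : Set V :=
  {v | ∃ hv : v ≠ 0, Projectivization.mk ℂ v hv ∈ S}

/-- `S ⊆ ℙ V` is an embedded smooth real hypersurface: near each of its points the cone over `S`
is the zero set of a smooth real function with nonvanishing differential. -/
def IsHypersurface (S : Set (ℙ ℂ V)) : Prop :=
  ∀ v ∈ coneOver S, ∃ (U : Set V) (ρ : V → ℝ), IsOpen U ∧ v ∈ U ∧
    ContDiffOn ℝ ∞ ρ U ∧ fderiv ℝ ρ v ≠ 0 ∧ ∀ w ∈ U, (w ∈ coneOver S ↔ w ≠ 0 ∧ ρ w = 0)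

/-- `ι : M → ℙ V` is an immersed smooth real hypersurface: each point of `M` has an open
neighbourhood that `ι` maps homeomorphically onto an embedded smooth hypersurface
(and `M` carries the smooth structure for which these maps are diffeomorphisms).
An embedded hypersurface `S ⊆ ℙ V` is the case of the inclusion `ι : S → ℙ V`. -/
def IsImmersedHypersurface (ι : M → ℙ ℂ V) : Prop :=
  ∀ x : M, ∃ U : Set M, IsOpen U ∧ x ∈ U ∧
    IsEmbedding (U.domRestrict ι) ∧ IsHypersurface (ι '' U)

/-- The cone over an immersed hypersurface: pairs `(x, v)` with `v ≠ 0` and `[v] = ι x`. -/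
def cone (ι : M → ℙ ℂ V) : Set (M × V) :=
  {p | p.2 ≠ 0 ∧ p.2 ∈ (ι p.1).submodule}

/-- A smooth curve `t ↦ (x t, c t)`, `|t| < ε`, in a set `X ⊆ M × E` through the point `p` at
time `0`. It is used for sets `X` that immerse into `E`, so that the smooth structure is read
off in `E`. -/
def IsCurveThrough {E : Type*} [NormedAddCommGroup E] [NormedSpace ℝ E] (X : Set (M × E))
    (p : M × E) (ε : ℝ) (x : ℝ → M) (c : ℝ → E) : Prop :=
  0 < ε ∧ x 0 = p.1 ∧ c 0 = p.2 ∧ ContinuousOn x (Ioo (-ε) ε) ∧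
    ContDiffOn ℝ ∞ c (Ioo (-ε) ε) ∧ ∀ t ∈ Ioo (-ε) ε, (x t, c t) ∈ X

/-- The vectors tangent to `X ⊆ M × E` at `p`: velocities of smooth curves in `X`. -/
def tangentVectors {E : Type*} [NormedAddCommGroup E] [NormedSpace ℝ E] (X : Set (M × E))
    (p : M × E) : Set E :=
  {ξ | ∃ (ε : ℝ) (x : ℝ → M) (c : ℝ → E), IsCurveThrough X p ε x c ∧ HasDerivAt c ξ 0}

/-- The linear subspace `T̂ ⊆ V` tangent to the cone over the hypersurface at `(x, v)`. -/
def coneTangent (ι : M → ℙ ℂ V) (x : M) (v : V) : Set V :=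
  tangentVectors (cone ι) (x, v)

/-- The maximal complex subspace `Ĥ = T̂ ∩ i T̂`. -/
def coneHolTangent (ι : M → ℙ ℂ V) (x : M) (v : V) : Set V :=
  {u | u ∈ coneTangent ι x v ∧ Complex.I • u ∈ coneTangent ι x v}

/-- The real line `t ↦ w + t u` makes second order contact with the cone at `(x, w)`: some smooth
curve in the cone through `(x, w)` agrees with it to second order. -/
def SecondOrderContact (ι : M → ℙ ℂ V) (x : M) (w u : V) : Prop :=
  ∃ (ε : ℝ) (y : ℝ → M) (c : ℝ → V), IsCurveThrough (cone ι) (x, w) ε y c ∧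
    Asymptotics.IsLittleO (𝓝 0) (fun t : ℝ => c t - (w + t • u)) (fun t : ℝ => t ^ 2)

end Basic

section Frames

variable {V : Type*} [NormedAddCommGroup V] [NormedSpace ℂ V] {k : ℕ}
variable {M : Type*} [TopologicalSpace M]

/-- The indices `0 < α < m`, where `m = k + 1`. -/
def mid (α : Fin k) : Fin (k + 2) := α.castSucc.succ

/-- The adapted frame bundle `F_S`: frames `f = (f_0, …, f_m)` with `[f_0] = ι x` such that the
real span of `f_0, i f_0, …, f_{m-1}, i f_{m-1}, f_m` is the tangent space to the cone at
`f_0`. -/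
def frameBundle (ι : M → ℙ ℂ V) : Set (M × Module.Basis (Fin (k + 2)) ℂ V) :=
  {p | (p.1, p.2 0) ∈ cone ι ∧
    (Submodule.span ℝ (range p.2 ∪ range fun a : Fin (k + 1) => Complex.I • p.2 a.castSucc) :
      Set V) = coneTangent ι p.1 (p.2 0)}

/-- The tangent vectors `ξ = (ξ_0, …, ξ_m)`, `ξ_a = df_a(ξ)`, to the frame bundle at `(x, f)`. -/
def frameTangent (ι : M → ℙ ℂ V) (x : M) (f : Module.Basis (Fin (k + 2)) ℂ V) :
    Set (Fin (k + 2) → V) :=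
  tangentVectors ((fun p : M × Module.Basis (Fin (k + 2)) ℂ V =>
    ((p.1, ⇑p.2) : M × (Fin (k + 2) → V))) '' frameBundle ι) (x, ⇑f)

/-- The component `Ω^b_a` of the Maurer-Cartan form at the frame `f`, defined by
`df_a = Ω^b_a f_b`. -/
noncomputable def mc (f : Module.Basis (Fin (k + 2)) ℂ V) (b a : Fin (k + 2))
    (ξ : Fin (k + 2) → V) : ℂ :=
  f.repr (ξ a) b

/-- `P = (P_{αβ})`, `L = (P_{α β̄})`, `p = (P_{αm})` and `r = P_{mm}` are the second order
coefficients at the adapted frame `(x, f)`, that is, the coefficients in the expansions of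
`Ω^m_α` and of `Ω^0_0 + conj Ω^m_m - conj Ω^0_0 - Ω^m_m` on the frame bundle in terms of the
semi-basic forms `Ω^β_0`, `conj Ω^β_0`, `Ω^m_0`. -/
structure IsSecondOrderCoeffs (ι : M → ℙ ℂ V) (x : M) (f : Module.Basis (Fin (k + 2)) ℂ V)
    (P L : Matrix (Fin k) (Fin k) ℂ) (p : Fin k → ℂ) (r : ℂ) : Prop where
  mem : (x, f) ∈ frameBundle ι
  symm : Pᵀ = P
  skew : Lᴴ = -L
  imag : conj r = -r
  eq_alpha : ∀ ξ ∈ frameTangent ι x f, ∀ α : Fin k,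
    mc f (Fin.last (k + 1)) (mid α) ξ =
      ∑ β, P α β * mc f (mid β) 0 ξ + ∑ β, L α β * conj (mc f (mid β) 0 ξ)
        + p α * mc f (Fin.last (k + 1)) 0 ξ
  eq_m : ∀ ξ ∈ frameTangent ι x f,
    (mc f 0 0 ξ + conj (mc f (Fin.last (k + 1)) (Fin.last (k + 1)) ξ))
        - (conj (mc f 0 0 ξ) + mc f (Fin.last (k + 1)) (Fin.last (k + 1)) ξ) =
      -∑ α, p α * mc f (mid α) 0 ξ + ∑ α, conj (p α) * conj (mc f (mid α) 0 ξ)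
        + r * mc f (Fin.last (k + 1)) 0 ξ

/-- The sub-bundle `P_S ⊆ F_S` of frames at which `P_{αm}` and `P_{mm}` vanish. -/
def normalizedBundle (ι : M → ℙ ℂ V) : Set (M × Module.Basis (Fin (k + 2)) ℂ V) :=
  {p | ∃ P L : Matrix (Fin k) (Fin k) ℂ, IsSecondOrderCoeffs ι p.1 p.2 P L 0 0}

/-- The hermitian form `i L(z, z̄)`, `L(z, z̄) = L_{α β̄} z^α z̄^β`, of a skew-hermitian matrix `L`
is (positive or negative) definite. -/
def IsDefiniteForm (L : Matrix (Fin k) (Fin k) ℂ) : Prop :=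
  (∀ z : Fin k → ℂ, z ≠ 0 → 0 < (Complex.I * ∑ α, ∑ β, L α β * z α * conj (z β)).re) ∨
  (∀ z : Fin k → ℂ, z ≠ 0 → (Complex.I * ∑ α, ∑ β, L α β * z α * conj (z β)).re < 0)

/-- Strong pseudoconvexity: the coefficients `P_{α β̄}` define a definite form on every adapted
frame. -/
def IsStronglyPseudoconvex (k : ℕ) (ι : M → ℙ ℂ V) : Prop :=
  ∀ (x : M) (f : Module.Basis (Fin (k + 2)) ℂ V) (P L : Matrix (Fin k) (Fin k) ℂ)
    (p : Fin k → ℂ) (r : ℂ), IsSecondOrderCoeffs ι x f P L p r → IsDefiniteForm L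

/-- `ι : M → ℙ V`, `dim V = k + 2`, is a strongly `ℂ`-linearly convex (immersed) hypersurface:
it is strongly pseudoconvex, and no real line through `w` with direction in `Ĥ` (and not
in the complex line of `w`, which lies in the cone) makes second order contact with the cone at
`w`. -/
structure IsSCLC (k : ℕ) (ι : M → ℙ ℂ V) : Prop where
  hypersurface : IsImmersedHypersurface ι
  pseudoconvex : IsStronglyPseudoconvex k ι
  noContact : ∀ (x : M) (w : V), (x, w) ∈ cone ι → ∀ u ∈ coneHolTangent ι x w,
    u ∉ (ι x).submodule → ¬ SecondOrderContact ι x w u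

end Frames

section Dual

variable {W : Type*} [NormedAddCommGroup W] [NormedSpace ℂ W] [FiniteDimensional ℂ W] {k : ℕ}
variable {M : Type*} [TopologicalSpace M]

/-- The map `Γ(f) = (f^m, f^1, …, f^{m-1}, f^0)` from frames of `W` to frames of `W*`, where
`(f^0, …, f^m)` is the basis dual to `f`. -/
noncomputable def Gam (f : Module.Basis (Fin (k + 2)) ℂ W) :
    Module.Basis (Fin (k + 2)) ℂ (StrongDual ℂ W) :=
  (f.dualBasis.map LinearMap.toContinuousLinearMap).reindex (Equiv.swap 0 (Fin.last (k + 1)))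

open Classical in
/-- The Gauss map `γ : M → ℙ W*`, `γ(x) = [f^m]` for an adapted frame `f` over `x` (the class does
not depend on the frame; it is the annihilator of `Ĥ`). The second branch is never used for a
hypersurface. -/
noncomputable def gaussMap (hW : Module.finrank ℂ W = k + 2) (ι : M → ℙ ℂ W) (x : M) :
    ℙ ℂ (StrongDual ℂ W) :=
  let f : Module.Basis (Fin (k + 2)) ℂ W :=
    if h : ∃ f, (x, f) ∈ frameBundle ι then h.choose else Module.finBasisOfFinrankEq ℂ W hW
  Projectivization.mk ℂ (Gam f 0) ((Gam f).ne_zero 0)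

end Dual

/-- The block matrix `[[P, L], [Lᵀ, -P̄]]`. -/
def block {k : ℕ} (P L : Matrix (Fin k) (Fin k) ℂ) : Matrix (Fin k ⊕ Fin k) (Fin k ⊕ Fin k) ℂ :=
  Matrix.fromBlocks P L Lᵀ (-P.map conj)

end CRHypersurface

open CRHypersurface

/-! Near a point of `S` the cone has a defining function `ρ` that is homogeneous of degree `(1, 1)`.
Its complex gradient `D`, given by `dρ_w(v) = Re B(v, D w)`, satisfies `D (c w) = c̄ D w` and `B(w,
D w) = 2 ρ w`. On the cone the kernel of `B(·, D w)` is `Ĥ`, so the Gauss map is `[w] ↦ [D w]`.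

A line in a direction `u` of `Ĥ` makes second order contact exactly when `Re B(u, dD u) = 0`
(`secondOrderContact_iff`). Convexity therefore makes `dD` injective on the cone
(`fderiv_grad_injective`). So `D` has a local inverse `E`, and `ρ ∘ E` is a defining function of
`S*` with complex gradient `E`: a Legendre transform (`IsChart.isDualPair`, `exists_isDualPair`).
The roles of `S` and `S*` are then symmetric. The substitution `u = dD v` identifies the two Hessian
forms, so the absence of contact passes to `S*`.

In an adapted frame this absence reads `Im (z · (P z + L z̄)) ≠ 0` for `z ≠ 0` (`form_ne_zero`). A
complex rescaling of `z` makes the `P` term real, so `Im (z · L z̄)` has no nontrivial zero, and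
connectedness makes `L` definite. The same inequality makes the block matrix of `P` and `L`
invertible (`isUnit_det_block`).

In terms of `D`, adapted frames and the tangent vectors of their bundle are described by explicit
equations (`mem_frameBundle_iff`, `mem_frameTangent_iff`). If `σ` exchanges `0` and `m`, then
`Ω^b_a` at `Γ(f)` is `-Ω^{σ a}_{σ b}` at `f` (`exists_frameTangent`). Hence `Ω^m_α` and `Ω^α_0`
change places up to sign. The coefficients of `S*` come from solving `Ω = P η + L η̄ + θ p` for `η`
with the inverse block matrix (`secondOrderCoeffs`). The new `p` and `r` vanish when the old ones
do. -/

namespace CRHypersurface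

/-! ### Cones over subsets of projective space and conic open sets -/

section Cone

variable {V : Type*} [NormedAddCommGroup V] [NormedSpace ℂ V]
variable {M : Type*} {ι : M → ℙ ℂ V} {x y : M} {v w : V}

lemma mem_cone_iff : (x, w) ∈ cone ι ↔ ∃ h : w ≠ 0, Projectivization.mk ℂ w h = ι x := by
  constructor
  · rintro ⟨h0, h⟩
    refine ⟨h0, ?_⟩
    rw [← (ι x).mk_rep] at h ⊢
    rw [Projectivization.submodule_mk, Submodule.mem_span_singleton] at h
    obtain ⟨a, ha⟩ := h
    rw [Projectivization.mk_eq_mk_iff']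
    exact ⟨a, ha⟩
  · rintro ⟨h0, h⟩
    refine ⟨h0, ?_⟩
    show w ∈ (ι x).submodule
    rw [← h, Projectivization.submodule_mk]
    exact Submodule.mem_span_singleton_self w

lemma exists_mem_cone (ι : M → ℙ ℂ V) (x : M) : ∃ w, (x, w) ∈ cone ι :=
  ⟨(ι x).rep, mem_cone_iff.2 ⟨(ι x).rep_nonzero, (ι x).mk_rep⟩⟩

lemma smul_mem_cone (h : (x, w) ∈ cone ι) {c : ℂ} (hc : c ≠ 0) : (x, c • w) ∈ cone ι :=
  ⟨smul_ne_zero hc h.1, Submodule.smul_mem _ c h.2⟩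

lemma mem_submodule_iff (h : (x, w) ∈ cone ι) : v ∈ (ι x).submodule ↔ ∃ c : ℂ, c • w = v := by
  obtain ⟨h0, h1⟩ := mem_cone_iff.1 h
  rw [← h1, Projectivization.submodule_mk, Submodule.mem_span_singleton]

lemma exists_smul_eq_of_mem_cone (h : (x, w) ∈ cone ι) (h' : (x, v) ∈ cone ι) :
    ∃ c : ℂ, c ≠ 0 ∧ c • w = v := by
  obtain ⟨c, hc⟩ := (mem_submodule_iff h).1 h'.2
  refine ⟨c, ?_, hc⟩
  rintro rfl
  exact h'.1 (by rw [← hc, zero_smul])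

lemma eq_of_mem_cone {y : M} (h : (x, w) ∈ cone ι) (h' : (y, w) ∈ cone ι) : ι x = ι y := by
  obtain ⟨_, h1⟩ := mem_cone_iff.1 h
  obtain ⟨_, h2⟩ := mem_cone_iff.1 h'
  rw [← h1, h2]

lemma mem_coneOver_image {U : Set M} : w ∈ coneOver (ι '' U) ↔ ∃ x ∈ U, (x, w) ∈ cone ι := by
  constructor
  · rintro ⟨h0, x, hx, h⟩
    exact ⟨x, hx, mem_cone_iff.2 ⟨h0, h.symm⟩⟩
  · rintro ⟨x, hx, h⟩
    obtain ⟨h0, h1⟩ := mem_cone_iff.1 h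
    exact ⟨h0, x, hx, h1.symm⟩

/-- An open subset of `V \ {0}` that is invariant under nonzero complex scalars. -/
structure IsConicOpen (O : Set V) : Prop where
  isOpen : IsOpen O
  ne_zero : ∀ w ∈ O, w ≠ 0
  smul_mem : ∀ w ∈ O, ∀ c : ℂ, c ≠ 0 → c • w ∈ O

/-- Openness in the quotient is tested on the preimage in `V \ {0}`, and invariance under scalars
makes the choice of `rep` immaterial. Conic open sets thus stand for open sets of projective space.
-/
lemma IsConicOpen.isOpen_mk {C : Set V} (hC : IsConicOpen C) :
    IsOpen {p : ℙ ℂ V | p.rep ∈ C} := by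
  change IsOpen ((Projectivization.mk' ℂ : {v : V // v ≠ 0} → ℙ ℂ V) ⁻¹' _)
  have : (Projectivization.mk' ℂ : {v : V // v ≠ 0} → ℙ ℂ V) ⁻¹' {p : ℙ ℂ V | p.rep ∈ C}
      = Subtype.val ⁻¹' C := by
    ext ⟨v, hv⟩
    obtain ⟨a, ha⟩ := Projectivization.exists_smul_eq_mk_rep ℂ v hv
    simp only [mem_preimage, Set.mem_ofPred_eq, Projectivization.mk'_eq_mk]
    rw [← ha]
    constructor
    · intro h
      have := hC.smul_mem _ h (a⁻¹ : ℂˣ) (Units.ne_zero _)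
      rwa [Units.smul_def, smul_smul, ← Units.val_mul, inv_mul_cancel, Units.val_one,
        one_smul] at this
    · intro h
      exact hC.smul_mem _ h a (Units.ne_zero _)
  rw [this]
  exact hC.isOpen.preimage continuous_subtype_val

lemma isConicOpen_of_isOpen {N : Set (ℙ ℂ V)} (hN : IsOpen N) : IsConicOpen (coneOver N) := by
  have hN' : IsOpen ((Projectivization.mk' ℂ : {v : V // v ≠ 0} → ℙ ℂ V) ⁻¹' N) := hN
  refine ⟨?_, fun w hw => hw.1, fun w ⟨h0, h⟩ c hc => ⟨smul_ne_zero hc h0, ?_⟩⟩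
  · have := (isOpen_compl_singleton (x := (0 : V))).isOpenMap_subtype_val _ hN'
    convert this using 1
    ext v
    constructor
    · rintro ⟨h0, h⟩
      exact ⟨⟨v, h0⟩, h, rfl⟩
    · rintro ⟨⟨v, h0⟩, h, rfl⟩
      exact ⟨h0, h⟩
  · convert h using 1
    rw [Projectivization.mk_eq_mk_iff']
    exact ⟨c, rfl⟩

lemma IsConicOpen.rep_mem_iff {C : Set V} (hC : IsConicOpen C) (h : (x, w) ∈ cone ι) :
    (ι x).rep ∈ C ↔ w ∈ C := by
  have hr : (x, (ι x).rep) ∈ cone ι := mem_cone_iff.2 ⟨(ι x).rep_nonzero, (ι x).mk_rep⟩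
  obtain ⟨c, hc, h1⟩ := exists_smul_eq_of_mem_cone h hr
  obtain ⟨d, hd, h2⟩ := exists_smul_eq_of_mem_cone hr h
  exact ⟨fun hm => h2 ▸ hC.smul_mem _ hm d hd, fun hm => h1 ▸ hC.smul_mem _ hm c hc⟩

end Cone

/-! ### Complex duality pairings and complex gradients -/

section Pairing

variable {V : Type*} [NormedAddCommGroup V] [NormedSpace ℂ V]
variable {V' : Type*} [NormedAddCommGroup V'] [NormedSpace ℂ V']

/-- A pairing of two complex vector spaces is a duality if it is nondegenerate on both sides. -/
structure IsDuality (B : V →L[ℂ] V' →L[ℂ] ℂ) : Prop where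
  left : ∀ v, (∀ l, B v l = 0) → v = 0
  right : ∀ l, (∀ v, B v l = 0) → l = 0

lemma IsDuality.flip {B : V →L[ℂ] V' →L[ℂ] ℂ} (hB : IsDuality B) : IsDuality B.flip :=
  ⟨hB.right, hB.left⟩

/-- The real part of the pairing, as a real bilinear map. -/
noncomputable def rePair (B : V →L[ℂ] V' →L[ℂ] ℂ) : V →L[ℝ] V' →L[ℝ] ℝ :=
  (ContinuousLinearMap.compL ℝ V' ℂ ℝ Complex.reCLM).comp (B.bilinearRestrictScalars ℝ)

@[simp]
lemma rePair_apply (B : V →L[ℂ] V' →L[ℂ] ℂ) (v : V) (l : V') : rePair B v l = (B v l).re := rfl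

/-- Test with `z = ā`. This upgrades identities between real parts, which is what real derivatives
supply, to complex ones. -/
lemma eq_zero_of_re_mul_eq_zero {a : ℂ} (h : ∀ z : ℂ, (z * a).re = 0) : a = 0 := by
  have := h (conj a)
  rw [← Complex.normSq_eq_conj_mul_self, Complex.ofReal_re] at this
  exact Complex.normSq_eq_zero.1 this

lemma IsDuality.eq_zero_of_re_left {B : V →L[ℂ] V' →L[ℂ] ℂ} (hB : IsDuality B) {v : V}
    (h : ∀ l, (B v l).re = 0) : v = 0 :=
  hB.left v fun l => eq_zero_of_re_mul_eq_zero fun z => by simpa using h (z • l)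

lemma IsDuality.eq_zero_of_re_right {B : V →L[ℂ] V' →L[ℂ] ℂ} (hB : IsDuality B) {l : V'}
    (h : ∀ v, (B v l).re = 0) : l = 0 :=
  hB.flip.eq_zero_of_re_left h

lemma IsDuality.isPerfPair [FiniteDimensional ℂ V] {B : V →L[ℂ] V' →L[ℂ] ℂ}
    (hB : IsDuality B) : (ContinuousLinearMap.toLinearMap₁₂ B).IsPerfPair := by
  apply LinearMap.IsPerfPair.of_injective
  · rw [injective_iff_map_eq_zero]
    exact fun v hv => hB.left v fun l => LinearMap.congr_fun hv l
  · rw [injective_iff_map_eq_zero]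
    exact fun v hv => hB.right v fun l => LinearMap.congr_fun hv l

/-- A real functional `λ` on `V` is the real part of pairing with a unique vector, its complex
gradient; the complex gradient depends linearly on `λ`. -/
lemma IsDuality.exists_gradient [FiniteDimensional ℂ V]
    {B : V →L[ℂ] V' →L[ℂ] ℂ} (hB : IsDuality B) :
    ∃ C : (V →L[ℝ] ℝ) →L[ℝ] V', ∀ l v, rePair B v (C l) = l v := by
  have := hB.isPerfPair
  let T : V' →ₗ[ℝ] (V →L[ℝ] ℝ) := (rePair B).flip.toLinearMap
  have hinj : Function.Injective T := by
    rw [injective_iff_map_eq_zero]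
    intro l hl
    exact hB.eq_zero_of_re_right fun v => DFunLike.congr_fun hl v
  have hsurj : Function.Surjective T := by
    intro l
    -- The vector representing the complex-linear functional whose real part is `l`.
    refine ⟨(ContinuousLinearMap.toLinearMap₁₂ B).flip.toPerfPair.symm
      (StrongDual.extendRCLike (𝕜 := ℂ) l : StrongDual ℂ V).toLinearMap, ?_⟩
    ext v
    refine (congrArg Complex.re (LinearMap.apply_toPerfPair_flip
      (ContinuousLinearMap.toLinearMap₁₂ B)
      (StrongDual.extendRCLike (𝕜 := ℂ) l : StrongDual ℂ V).toLinearMap v)).trans ?_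
    exact StrongDual.re_extendRCLike_apply (𝕜 := ℂ) l v
  refine ⟨LinearMap.toContinuousLinearMap (LinearEquiv.ofBijective T ⟨hinj, hsurj⟩).symm.toLinearMap,
    fun l v => ?_⟩
  have := (LinearEquiv.ofBijective T ⟨hinj, hsurj⟩).apply_symm_apply l
  exact DFunLike.congr_fun this v

end Pairing

/-! ### Homogeneous defining functions -/

section Chart

variable {V : Type*} [NormedAddCommGroup V] [NormedSpace ℂ V]
variable {V' : Type*} [NormedAddCommGroup V'] [NormedSpace ℂ V']
variable {M : Type*} [TopologicalSpace M]

/-- A chart of an immersed hypersurface `ι : M → ℙ V`: on the open set `U ⊆ M` the map `ι` is an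
embedding, and the cone over `ι '' U` is the zero set of a function `ρ` with nonvanishing complex
gradient `D : V → V'` on a conic open set `O`, homogeneous of degree `(1, 1)`. -/
structure IsChart (B : V →L[ℂ] V' →L[ℂ] ℂ) (ι : M → ℙ ℂ V) (U : Set M) (O : Set V)
    (ρ : V → ℝ) (D : V → V') : Prop where
  isOpen_dom : IsOpen U
  conic : IsConicOpen O
  isEmbedding : IsEmbedding (U.domRestrict ι)
  mem_of_cone : ∀ x ∈ U, ∀ w, (x, w) ∈ cone ι → w ∈ O
  eq_zero_iff : ∀ w ∈ O, ρ w = 0 ↔ ∃ x ∈ U, (x, w) ∈ cone ι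
  contDiffOn : ContDiffOn ℝ ∞ ρ O
  contDiffOn_grad : ContDiffOn ℝ ∞ D O
  grad_smul : ∀ w ∈ O, ∀ c : ℂ, c ≠ 0 → D (c • w) = conj c • D w
  grad_ne_zero : ∀ w ∈ O, D w ≠ 0
  hasFDerivAt : ∀ w ∈ O, HasFDerivAt ρ ((rePair B).flip (D w)) w
  euler : ∀ w ∈ O, B w (D w) = 2 * ρ w

lemma isOpen_dom_of_conic {ι : M → ℙ ℂ V} {U : Set M} (hU : IsOpen U)
    (h : Continuous (U.domRestrict ι)) {C : Set V} (hC : IsConicOpen C) :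
    IsOpen {x ∈ U | (ι x).rep ∈ C} := by
  have h1 : IsOpen ((U.domRestrict ι) ⁻¹' {p : ℙ ℂ V | p.rep ∈ C}) := hC.isOpen_mk.preimage h
  convert hU.isOpenMap_subtype_val _ h1 using 1
  ext x
  constructor
  · rintro ⟨hx, h2⟩
    exact ⟨⟨x, hx⟩, h2, rfl⟩
  · rintro ⟨⟨x, hx⟩, h2, rfl⟩
    exact ⟨hx, h2⟩

namespace IsChart

variable {B : V →L[ℂ] V' →L[ℂ] ℂ} {ι : M → ℙ ℂ V} {U : Set M} {O : Set V} {ρ : V → ℝ}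
  {D : V → V'}

lemma restrict (h : IsChart B ι U O ρ D) {O' : Set V} (hO' : IsConicOpen O') (hsub : O' ⊆ O) :
    IsChart B ι {x ∈ U | (ι x).rep ∈ O'} O' ρ D where
  isOpen_dom := isOpen_dom_of_conic h.isOpen_dom h.isEmbedding.continuous hO'
  conic := hO'
  isEmbedding := by
    have h1 : {x ∈ U | (ι x).rep ∈ O'} ⊆ U := fun x hx => hx.1
    exact h.isEmbedding.comp (IsEmbedding.inclusion h1)
  mem_of_cone := fun x hx w hw => (hO'.rep_mem_iff hw).1 hx.2
  eq_zero_iff := by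
    intro w hw
    rw [h.eq_zero_iff w (hsub hw)]
    constructor
    · rintro ⟨x, hx, hc⟩
      exact ⟨x, ⟨hx, (hO'.rep_mem_iff hc).2 hw⟩, hc⟩
    · rintro ⟨x, hx, hc⟩
      exact ⟨x, hx.1, hc⟩
  contDiffOn := h.contDiffOn.mono hsub
  contDiffOn_grad := h.contDiffOn_grad.mono hsub
  grad_smul := fun w hw => h.grad_smul w (hsub hw)
  grad_ne_zero := fun w hw => h.grad_ne_zero w (hsub hw)
  hasFDerivAt := fun w hw => h.hasFDerivAt w (hsub hw)
  euler := fun w hw => h.euler w (hsub hw)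

lemma eq_zero (h : IsChart B ι U O ρ D) {x : M} {w : V} (hx : x ∈ U) (hw : (x, w) ∈ cone ι) :
    ρ w = 0 :=
  (h.eq_zero_iff w (h.mem_of_cone x hx w hw)).2 ⟨x, hx, hw⟩

lemma injOn (h : IsChart B ι U O ρ D) : InjOn ι U :=
  injOn_iff_injective.2 h.isEmbedding.injective

lemma isHypersurface (hB : IsDuality B) (h : IsChart B ι U O ρ D) : IsHypersurface (ι '' U) := by
  intro v hv
  obtain ⟨x, hx, hc⟩ := mem_coneOver_image.1 hv
  have hvO := h.mem_of_cone x hx v hc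
  refine ⟨O, ρ, h.conic.isOpen, hvO, h.contDiffOn, ?_, fun w hw => ?_⟩
  · rw [(h.hasFDerivAt v hvO).fderiv]
    intro h0
    exact h.grad_ne_zero v hvO (hB.eq_zero_of_re_right fun u => DFunLike.congr_fun h0 u)
  · rw [mem_coneOver_image, h.eq_zero_iff w hw]
    exact ⟨fun h1 => ⟨h.conic.ne_zero w hw, h1⟩, fun h1 => h1.2⟩

end IsChart

lemma isImmersedHypersurface_of_charts {B : V →L[ℂ] V' →L[ℂ] ℂ} (hB : IsDuality B)
    {ι : M → ℙ ℂ V} (h : ∀ x, ∃ U O ρ D, x ∈ U ∧ IsChart B ι U O ρ D) :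
    IsImmersedHypersurface ι := by
  intro x
  obtain ⟨U, O, ρ, D, hx, hc⟩ := h x
  exact ⟨U, hc.isOpen_dom, hx, hc.isEmbedding, hc.isHypersurface hB⟩

/-- The bihomogeneous extension of a function from the affine hyperplane `e = 1`. -/
noncomputable def homogenize (e : V →L[ℂ] ℂ) (ρ : V → ℝ) (w : V) : ℝ :=
  Complex.normSq (e w) * ρ ((e w)⁻¹ • w)

lemma homogenize_smul (e : V →L[ℂ] ℂ) (ρ : V → ℝ) (w : V) {c : ℂ} (hc : c ≠ 0) :
    homogenize e ρ (c • w) = Complex.normSq c * homogenize e ρ w := by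
  simp only [homogenize, map_smul, smul_eq_mul, map_mul, smul_smul, mul_inv]
  rw [mul_assoc, mul_right_comm, inv_mul_cancel₀ hc, one_mul]

/-- The cone over the open subset `G ∩ {e = 1}` of an affine hyperplane. -/
def affineCone (e : V →L[ℂ] ℂ) (G : Set V) : Set V := {w | e w ≠ 0 ∧ (e w)⁻¹ • w ∈ G}

lemma continuousOn_normalize (e : V →L[ℂ] ℂ) :
    ContinuousOn (fun w => (e w)⁻¹ • w) {w | e w ≠ 0} :=
  (e.continuous.continuousOn.inv₀ fun _ h => h).smul continuousOn_id

lemma isConicOpen_affineCone (e : V →L[ℂ] ℂ) {G : Set V} (hG : IsOpen G) :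
    IsConicOpen (affineCone e G) where
  isOpen := (continuousOn_normalize e).isOpen_inter_preimage
    (isOpen_ne.preimage e.continuous) hG
  ne_zero := by
    rintro w ⟨h, -⟩ rfl
    simp at h
  smul_mem := by
    rintro w ⟨h, h'⟩ c hc
    refine ⟨by simpa using ⟨hc, h⟩, ?_⟩
    simp only [map_smul, smul_eq_mul, smul_smul, mul_inv]
    rwa [mul_right_comm, inv_mul_cancel₀ hc, one_mul]

lemma contDiffOn_normalize (e : V →L[ℂ] ℂ) :
    ContDiffOn ℝ ∞ (fun w => (e w)⁻¹ • w) {w | e w ≠ 0} :=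
  ((e.restrictScalars ℝ).contDiff.contDiffOn.inv fun _ h => h).smul contDiffOn_id

lemma contDiffOn_homogenize (e : V →L[ℂ] ℂ) {ρ : V → ℝ} {G : Set V}
    (h : ContDiffOn ℝ ∞ ρ G) : ContDiffOn ℝ ∞ (homogenize e ρ) (affineCone e G) := by
  have h1 : ContDiff ℝ ∞ fun w => Complex.normSq (e w) := by
    have he : ContDiff ℝ ∞ e := (e.restrictScalars ℝ).contDiff
    simp only [Complex.normSq_apply]
    have h2 : ContDiff ℝ ∞ fun w => (e w).re := Complex.reCLM.contDiff.comp he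
    have h3 : ContDiff ℝ ∞ fun w => (e w).im := Complex.imCLM.contDiff.comp he
    exact (h2.mul h2).add (h3.mul h3)
  exact h1.contDiffOn.mul (h.comp ((contDiffOn_normalize e).mono fun w hw => hw.1) fun w hw => hw.2)

end Chart

/-! ### Existence of homogeneous charts -/

section ExistsChart

variable {V : Type*} [NormedAddCommGroup V] [NormedSpace ℂ V]
variable {V' : Type*} [NormedAddCommGroup V'] [NormedSpace ℂ V']

/-- Differentiate `ρ (c u) = |c|² ρ u` in `u` in two ways and evaluate at `c⁻¹ v`; the factor is
`|c|² c⁻¹ = c̄`. -/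
lemma gradient_smul {B : V →L[ℂ] V' →L[ℂ] ℂ} (hB : IsDuality B) {O : Set V} (hO : IsConicOpen O)
    {ρ : V → ℝ} {D : V → V'} (hD : ∀ w ∈ O, HasFDerivAt ρ ((rePair B).flip (D w)) w)
    (hρ : ∀ w, ∀ c : ℂ, c ≠ 0 → ρ (c • w) = Complex.normSq c * ρ w)
    {w : V} (hw : w ∈ O) {c : ℂ} (hc : c ≠ 0) : D (c • w) = conj c • D w := by
  rw [← sub_eq_zero]
  refine hB.eq_zero_of_re_right fun v => ?_
  have h1 : HasFDerivAt (fun u => ρ (c • u))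
      (((rePair B).flip (D (c • w))).comp (c • ContinuousLinearMap.id ℝ V)) w :=
    (hD _ (hO.smul_mem w hw c hc)).comp w ((hasFDerivAt_id w).const_smul c)
  have h2 : HasFDerivAt (fun u => ρ (c • u))
      (Complex.normSq c • (rePair B).flip (D w)) w := by
    simp only [fun u => hρ u c hc]
    exact (hD w hw).const_mul _
  have h3 := DFunLike.congr_fun (h1.unique h2) (c⁻¹ • v)
  simp only [ContinuousLinearMap.comp_apply, smul_apply,
    ContinuousLinearMap.id_apply, ContinuousLinearMap.flip_apply, rePair_apply, smul_smul,
    mul_inv_cancel₀ hc, one_smul, smul_eq_mul, map_smul] at h3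
  simp only [map_sub, map_smul, smul_eq_mul, Complex.sub_re, h3]
  rw [← Complex.re_ofReal_mul, ← mul_assoc, Complex.normSq_eq_conj_mul_self,
    mul_assoc (conj c), mul_inv_cancel₀ hc, mul_one, sub_self]

/-- Euler's identity: differentiate along `(1 + t z) w`, where `|1 + t z|²` has derivative `2 Re z`.
The choices `z = 1` and `z = i` give the real and imaginary parts. -/
lemma gradient_euler {B : V →L[ℂ] V' →L[ℂ] ℂ} {ρ : V → ℝ} {D : V → V'} {w : V}
    (hD : HasFDerivAt ρ ((rePair B).flip (D w)) w)
    (hρ : ∀ w, ∀ c : ℂ, c ≠ 0 → ρ (c • w) = Complex.normSq c * ρ w) :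
    B w (D w) = 2 * ρ w := by
  have key : ∀ z : ℂ, (z * B w (D w)).re = 2 * z.re * ρ w := by
    intro z
    have hc : HasDerivAt (fun t : ℝ => w + t • (z • w)) (z • w) 0 := by
      simpa using ((hasDerivAt_id (0 : ℝ)).smul_const (z • w)).const_add w
    have h1 : HasDerivAt (fun t : ℝ => ρ (w + t • (z • w))) ((rePair B).flip (D w) (z • w)) 0 := by
      refine HasFDerivAt.comp_hasDerivAt_of_eq (f := fun t : ℝ => w + t • (z • w)) (0 : ℝ) hD hc ?_
      simp
    have h2 : HasDerivAt (fun t : ℝ => Complex.normSq (1 + t * z) * ρ w) (2 * z.re * ρ w) 0 := by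
      have h3 : (fun t : ℝ => Complex.normSq (1 + t * z)) =
          fun t : ℝ => 1 + t * (2 * z.re) + t ^ 2 * Complex.normSq z := by
        ext t
        simp only [Complex.normSq_apply, Complex.add_re, Complex.one_re, Complex.re_ofReal_mul,
          Complex.add_im, Complex.one_im, Complex.im_ofReal_mul]
        ring
      refine HasDerivAt.mul_const ?_ _
      rw [h3]
      have := (((hasDerivAt_id (0 : ℝ)).mul_const (2 * z.re)).const_add 1).add
        ((hasDerivAt_pow 2 (0 : ℝ)).mul_const (Complex.normSq z))
      exact this.congr_deriv (by simp)
    have h4 : (fun t : ℝ => ρ (w + t • (z • w))) =ᶠ[𝓝 0]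
        fun t : ℝ => Complex.normSq (1 + t * z) * ρ w := by
      have : ContinuousAt (fun t : ℝ => 1 + (t : ℂ) * z) 0 := by fun_prop
      have h5 : ∀ᶠ t : ℝ in 𝓝 0, 1 + (t : ℂ) * z ≠ 0 :=
        this.eventually_ne (by simp)
      filter_upwards [h5] with t ht
      rw [← hρ w _ ht, add_smul, one_smul, mul_smul]
      rfl
    have h6 := h1.unique (h2.congr_of_eventuallyEq h4)
    simpa using h6
  have h1 := key 1
  have h2 := key Complex.I
  apply Complex.ext
  · simpa using h1
  · simpa using h2

variable {M : Type*} [TopologicalSpace M]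

/-- A given defining function is restricted to an affine hyperplane `e = 1` through a point of the
cone and extended bihomogeneously; its zero set is unchanged because the cone is invariant under
scalars. -/
lemma exists_chart [FiniteDimensional ℂ V]
    {B : V →L[ℂ] V' →L[ℂ] ℂ} (hB : IsDuality B) {ι : M → ℙ ℂ V}
    (hι : IsImmersedHypersurface ι) (x : M) :
    ∃ U O ρ D, x ∈ U ∧ IsChart B ι U O ρ D := by
  obtain ⟨C, hC⟩ := hB.exists_gradient
  obtain ⟨U, hU, hx, hemb, hS⟩ := hι x
  obtain ⟨w₀, hw₀⟩ := exists_mem_cone ι x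
  obtain ⟨G, ρ₀, hG, hwG, hρ₀, hd, hz⟩ := hS w₀ (mem_coneOver_image.2 ⟨x, hx, hw₀⟩)
  obtain ⟨e, he⟩ : ∃ e : V →L[ℂ] ℂ, e w₀ = 1 := by
    obtain ⟨e, he⟩ := SeparatingDual.exists_eq_one (R := ℂ) hw₀.1
    exact ⟨e, he⟩
  set ρ := homogenize e ρ₀ with hρdef
  set D : V → V' := fun w => C (fderiv ℝ ρ w) with hDdef
  set O₁ := affineCone e G with hO₁def
  have hO₁ : IsConicOpen O₁ := isConicOpen_affineCone e hG
  have hρ : ContDiffOn ℝ ∞ ρ O₁ := contDiffOn_homogenize e hρ₀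
  have hhom : ∀ w, ∀ c : ℂ, c ≠ 0 → ρ (c • w) = Complex.normSq c * ρ w :=
    fun w c hc => homogenize_smul e ρ₀ w hc
  have hD : ∀ w ∈ O₁, HasFDerivAt ρ ((rePair B).flip (D w)) w := by
    intro w hw
    have h1 := ((hρ.contDiffAt (hO₁.isOpen.mem_nhds hw)).differentiableAt (by simp)).hasFDerivAt
    exact h1.congr_fderiv (ContinuousLinearMap.ext fun v => (hC (fderiv ℝ ρ w) v).symm)
  have hDs : ContDiffOn ℝ ∞ D O₁ :=
    C.contDiff.comp_contDiffOn (hρ.fderiv_of_isOpen hO₁.isOpen (by simp))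
  have hsm : ∀ w ∈ O₁, ∀ c : ℂ, c ≠ 0 → D (c • w) = conj c • D w :=
    fun w hw c hc => gradient_smul hB hO₁ hD hhom hw hc
  have hzero : ∀ w ∈ O₁, ρ w = 0 ↔ ∃ x ∈ U, (x, w) ∈ cone ι := by
    rintro w ⟨hw, hw'⟩
    have h1 : ρ w = 0 ↔ ρ₀ ((e w)⁻¹ • w) = 0 := by
      rw [hρdef, homogenize, mul_eq_zero, Complex.normSq_eq_zero]
      tauto
    have h2 := hz _ hw'
    have h3 : (e w)⁻¹ • w ≠ 0 :=
      smul_ne_zero (inv_ne_zero hw) (hO₁.ne_zero w ⟨hw, hw'⟩)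
    rw [h1, ← and_iff_right (a := (e w)⁻¹ • w ≠ 0) (b := ρ₀ _ = 0) h3, ← h2, mem_coneOver_image]
    refine exists_congr fun y => and_congr_right fun _ => ⟨fun h => ?_, fun h => ?_⟩
    · simpa [smul_smul, hw] using smul_mem_cone h hw
    · exact smul_mem_cone h (inv_ne_zero hw)
  have hw₁ : w₀ ∈ O₁ := ⟨by simp [he], by simpa [he] using hwG⟩
  -- Only the values of `ρ₀` on `e = 1` enter `ρ`, so if `D w₀ = 0` then `dρ₀` vanishes on `ker e`.
  -- It also vanishes on `ℂ w₀`, along which `ρ₀` is zero. These span `V`, against `dρ₀ ≠ 0`.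
  have hD0 : D w₀ ≠ 0 := by
    intro h0
    apply hd
    have hdiff : HasFDerivAt ρ₀ (fderiv ℝ ρ₀ w₀) w₀ :=
      ((hρ₀.contDiffAt (hG.mem_nhds hwG)).differentiableAt (by simp)).hasFDerivAt
    have hline : ∀ v : V, HasDerivAt (fun t : ℝ => ρ₀ (w₀ + t • v)) (fderiv ℝ ρ₀ w₀ v) 0 := by
      intro v
      have hc : HasDerivAt (fun t : ℝ => w₀ + t • v) v 0 := by
        simpa using ((hasDerivAt_id (0 : ℝ)).smul_const v).const_add w₀
      exact HasFDerivAt.comp_hasDerivAt_of_eq (f := fun t : ℝ => w₀ + t • v) (0 : ℝ) hdiff hc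
        (by simp)
    have hker : ∀ v, e v = 0 → fderiv ℝ ρ₀ w₀ v = 0 := by
      intro v hv
      have hc : HasDerivAt (fun t : ℝ => w₀ + t • v) v 0 := by
        simpa using ((hasDerivAt_id (0 : ℝ)).smul_const v).const_add w₀
      have h1 : HasDerivAt (fun t : ℝ => ρ (w₀ + t • v)) ((rePair B).flip (D w₀) v) 0 :=
        HasFDerivAt.comp_hasDerivAt_of_eq (f := fun t : ℝ => w₀ + t • v) (0 : ℝ) (hD w₀ hw₁) hc
          (by simp)
      have h2 : (fun t : ℝ => ρ (w₀ + t • v)) = fun t : ℝ => ρ₀ (w₀ + t • v) := by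
        ext t
        have : e (w₀ + t • v) = 1 := by
          rw [map_add, he, ← Complex.coe_smul, map_smul, hv, smul_zero, add_zero]
        simp [hρdef, homogenize, this]
      rw [h2] at h1
      rw [(hline v).unique h1, h0]
      simp
    have hcone : ∀ z : ℂ, fderiv ℝ ρ₀ w₀ (z • w₀) = 0 := by
      intro z
      refine (hline (z • w₀)).unique ((hasDerivAt_const (0 : ℝ) (0 : ℝ)).congr_of_eventuallyEq ?_)
      have h1 : ContinuousAt (fun t : ℝ => 1 + (t : ℂ) * z) 0 := by fun_prop
      have h2 : ContinuousAt (fun t : ℝ => w₀ + t • (z • w₀)) 0 := by fun_prop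
      filter_upwards [h1.eventually_ne (by simp : 1 + ((0 : ℝ) : ℂ) * z ≠ 0),
        h2.preimage_mem_nhds (by simpa using hG.mem_nhds hwG)] with t ht ht'
      have h3 : w₀ + t • (z • w₀) = (1 + (t : ℂ) * z) • w₀ := by
        rw [add_smul, one_smul, mul_smul]; rfl
      refine (((hz _ ht').1 (mem_coneOver_image.2 ⟨x, hx, ?_⟩))).2
      simpa only [h3] using smul_mem_cone hw₀ ht
    ext v
    have h1 : v = (v - e v • w₀) + e v • w₀ := by abel
    rw [h1, map_add, hcone, hker _ (by simp [he])]
    simp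
  set O := O₁ ∩ D ⁻¹' {0}ᶜ with hOdef
  have hO : IsConicOpen O := by
    refine ⟨hDs.continuousOn.isOpen_inter_preimage hO₁.isOpen isOpen_compl_singleton,
      fun w hw => hO₁.ne_zero w hw.1, fun w hw c hc => ⟨hO₁.smul_mem w hw.1 c hc, ?_⟩⟩
    show D (c • w) ≠ 0
    rw [hsm w hw.1 c hc]
    exact smul_ne_zero (by simpa using hc) hw.2
  have hsub : {x ∈ U | (ι x).rep ∈ O} ⊆ U := fun x hx => hx.1
  refine ⟨{x ∈ U | (ι x).rep ∈ O}, O, ρ, D, ⟨hx, (hO.rep_mem_iff hw₀).2 ⟨hw₁, hD0⟩⟩, ?_⟩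
  exact
    { isOpen_dom := isOpen_dom_of_conic hU hemb.continuous hO
      conic := hO
      isEmbedding := hemb.comp (IsEmbedding.inclusion hsub)
      mem_of_cone := fun x hx w hw => (hO.rep_mem_iff hw).1 hx.2
      eq_zero_iff := by
        intro w hw
        rw [hzero w hw.1]
        exact ⟨fun ⟨y, hy, hc⟩ => ⟨y, ⟨hy, (hO.rep_mem_iff hc).2 hw⟩, hc⟩,
          fun ⟨y, hy, hc⟩ => ⟨y, hy.1, hc⟩⟩
      contDiffOn := hρ.mono inter_subset_left
      contDiffOn_grad := hDs.mono inter_subset_left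
      grad_smul := fun w hw => hsm w hw.1
      grad_ne_zero := fun w hw => hw.2
      hasFDerivAt := fun w hw => hD w hw.1
      euler := fun w hw => gradient_euler (hD w hw.1) hhom }

end ExistsChart

/-! ### Curves in the cone and second order contact -/

section Contact

/-- The inverse function theorem for functions smooth on an open set. -/
lemma exists_smooth_local_inverse {E F : Type*} [NormedAddCommGroup E] [NormedSpace ℝ E]
    [CompleteSpace E] [NormedAddCommGroup F] [NormedSpace ℝ F] {f : E → F} {s : Set E} {a : E}
    (hs : IsOpen s) (hf : ContDiffOn ℝ ∞ f s) (ha : a ∈ s) {f' : E ≃L[ℝ] F}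
    (hf' : HasFDerivAt f (f' : E →L[ℝ] F) a) :
    ∃ (g : F → E) (u : Set E) (v : Set F), IsOpen u ∧ IsOpen v ∧ a ∈ u ∧ u ⊆ s ∧
      (∀ y ∈ v, g y ∈ u ∧ f (g y) = y) ∧ (∀ x ∈ u, f x ∈ v ∧ g (f x) = x) ∧
      ContDiffOn ℝ ∞ g v ∧ HasFDerivAt g (f'.symm : F →L[ℝ] E) (f a) := by
  have hfa : ContDiffAt ℝ ∞ f a := hf.contDiffAt (hs.mem_nhds ha)
  -- Restricting to the open set where the derivative is invertible makes the inverse smooth on its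
  -- whole domain, not only at `f a`.
  set W := s ∩ fderiv ℝ f ⁻¹' (range ((↑) : (E ≃L[ℝ] F) → E →L[ℝ] F)) with hW
  have hWo : IsOpen W := by
    refine (hf.continuousOn_fderiv_of_isOpen hs (by simp)).isOpen_inter_preimage hs ?_
    exact ContinuousLinearEquiv.isOpen
  have haW : a ∈ W := ⟨ha, f', hf'.fderiv.symm⟩
  set e := (hfa.toOpenPartialHomeomorph f hf' (by simp)).restrOpen W hWo with he
  have hef : ∀ x, e x = f x := fun x => rfl
  have hsrc : e.source ⊆ W := fun x hx => hx.2
  have hae : a ∈ e.source := ⟨hfa.mem_toOpenPartialHomeomorph_source hf' (by simp), haW⟩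
  refine ⟨e.symm, e.source, e.target, e.open_source, e.open_target, hae,
    fun x hx => (hsrc hx).1, fun y hy => ⟨e.map_target hy, e.right_inv hy⟩,
    fun x hx => ⟨e.map_source hx, e.left_inv hx⟩, fun y hy => ?_, ?_⟩
  · have h1 := hsrc (e.map_target hy)
    obtain ⟨f₁, hf₁⟩ := h1.2
    have h2 : ContDiffAt ℝ ∞ f (e.symm y) := hf.contDiffAt (hs.mem_nhds h1.1)
    have h3 : HasFDerivAt f (f₁ : E →L[ℝ] F) (e.symm y) := by
      rw [hf₁]
      exact (h2.differentiableAt (by simp)).hasFDerivAt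
    exact (e.contDiffAt_symm hy h3 h2).contDiffWithinAt
  · refine e.hasFDerivAt_symm (e.map_source hae) ?_
    have : e.symm (f a) = a := e.left_inv hae
    rw [this]
    exact hf'

/-- The second order Taylor expansion of a real function at a critical zero. -/
lemma tendsto_div_sq_of_hasDerivAt {g g' : ℝ → ℝ} {a : ℝ} (hg : ∀ᶠ t in 𝓝 0, HasDerivAt g (g' t) t)
    (h0 : g 0 = 0) (h : Filter.Tendsto (fun t => g' t / t) (𝓝[≠] 0) (𝓝 a)) :
    Filter.Tendsto (fun t => g t / t ^ 2) (𝓝[≠] 0) (𝓝 (a / 2)) := by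
  refine HasDerivAt.lhopital_zero_nhdsNE (f' := g') (g' := fun t => 2 * t)
    (eventually_nhdsWithin_of_eventually_nhds hg) ?_ ?_ ?_ ?_ ?_
  · exact Filter.Eventually.of_forall fun t => by simpa using hasDerivAt_pow 2 t
  · filter_upwards [self_mem_nhdsWithin] with t ht
    simpa using ht
  · have := hg.self_of_nhds.continuousAt.tendsto
    rw [h0] at this
    exact this.mono_left nhdsWithin_le_nhds
  · have : ContinuousAt (fun t : ℝ => t ^ 2) 0 := by fun_prop
    have := this.tendsto
    simp only [ne_eq, OfNat.ofNat_ne_zero, not_false_eq_true, zero_pow] at this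
    exact this.mono_left nhdsWithin_le_nhds
  · convert! h.div_const 2 using 2 with t
    rw [div_div, mul_comm]

lemma Ioo_mem_nhds_zero {ε : ℝ} (h : 0 < ε) : Ioo (-ε) ε ∈ 𝓝 (0 : ℝ) :=
  Ioo_mem_nhds (by linarith) h

lemma exists_Ioo_of_eventually {p : ℝ → Prop} (h : ∀ᶠ t in 𝓝 0, p t) :
    ∃ ε > 0, ∀ t ∈ Ioo (-ε) ε, p t := by
  obtain ⟨ε, hε, h⟩ := Metric.eventually_nhds_iff.1 h
  refine ⟨ε, hε, fun t ht => h ?_⟩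
  rw [Real.dist_eq, sub_zero, abs_lt]
  exact ht

namespace IsChart

variable {V : Type*} [NormedAddCommGroup V] [NormedSpace ℂ V]
variable {V' : Type*} [NormedAddCommGroup V'] [NormedSpace ℂ V']
variable {M : Type*} [TopologicalSpace M]
variable {B : V →L[ℂ] V' →L[ℂ] ℂ} {ι : M → ℙ ℂ V} {U : Set M} {O : Set V} {ρ : V → ℝ}
  {D : V → V'} {x : M} {w : V}

section Gradient

lemma hasFDerivAt_grad (h : IsChart B ι U O ρ D) (hw : w ∈ O) :
    HasFDerivAt D (fderiv ℝ D w) w :=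
  ((h.contDiffOn_grad.contDiffAt (h.conic.isOpen.mem_nhds hw)).differentiableAt
    (by simp)).hasFDerivAt

/-- The form `Re B(u, dD v)` is the second derivative of `ρ`. -/
lemma hess_symm (h : IsChart B ι U O ρ D) (hw : w ∈ O) (u v : V) :
    (B u (fderiv ℝ D w v)).re = (B v (fderiv ℝ D w u)).re := by
  have h1 : ∀ᶠ y in 𝓝 w, HasFDerivAt ρ ((rePair B).flip (D y)) y :=
    (h.conic.isOpen.eventually_mem hw).mono fun y hy => h.hasFDerivAt y hy
  have h2 : HasFDerivAt (fun y => (rePair B).flip (D y))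
      (((rePair B).flip).comp (fderiv ℝ D w)) w :=
    ((rePair B).flip.hasFDerivAt).comp w (h.hasFDerivAt_grad hw)
  exact second_derivative_symmetric_of_eventually_of_real h1 h2 v u

/-- Differentiate `D (c w) = c̄ D w` along `c = 1 + t z`. -/
lemma fderiv_grad_smul_self (h : IsChart B ι U O ρ D) (hw : w ∈ O) (z : ℂ) :
    fderiv ℝ D w (z • w) = conj z • D w := by
  have hc : HasDerivAt (fun t : ℝ => w + t • (z • w)) (z • w) 0 := by
    simpa using ((hasDerivAt_id (0 : ℝ)).smul_const (z • w)).const_add w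
  have h1 : HasDerivAt (fun t : ℝ => D (w + t • (z • w))) (fderiv ℝ D w (z • w)) 0 :=
    HasFDerivAt.comp_hasDerivAt_of_eq (f := fun t : ℝ => w + t • (z • w)) (0 : ℝ)
      (h.hasFDerivAt_grad hw) hc (by simp)
  have h2 : HasDerivAt (fun t : ℝ => D w + t • (conj z • D w)) (conj z • D w) 0 := by
    simpa using ((hasDerivAt_id (0 : ℝ)).smul_const (conj z • D w)).const_add (D w)
  refine h1.unique (h2.congr_of_eventuallyEq ?_)
  have h3 : ContinuousAt (fun t : ℝ => 1 + (t : ℂ) * z) 0 := by fun_prop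
  filter_upwards [h3.eventually_ne (by simp : 1 + ((0 : ℝ) : ℂ) * z ≠ 0)] with t ht
  have h4 : w + t • (z • w) = (1 + (t : ℂ) * z) • w := by
    rw [add_smul, one_smul, mul_smul]; rfl
  rw [h4, h.grad_smul w hw _ ht, map_add, map_one, map_mul, Complex.conj_ofReal, add_smul,
    one_smul, mul_smul]
  rfl

lemma fderiv_grad_smul_smul (h : IsChart B ι U O ρ D) (hw : w ∈ O) {c : ℂ} (hc : c ≠ 0) (v : V) :
    fderiv ℝ D (c • w) (c • v) = conj c • fderiv ℝ D w v := by
  have h1 : HasFDerivAt (fun u => D (c • u))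
      ((fderiv ℝ D (c • w)).comp (c • ContinuousLinearMap.id ℝ V)) w :=
    (h.hasFDerivAt_grad (h.conic.smul_mem w hw c hc)).comp w ((hasFDerivAt_id w).const_smul c)
  have h2 : HasFDerivAt (fun u => D (c • u)) (conj c • fderiv ℝ D w) w := by
    refine ((h.hasFDerivAt_grad hw).const_smul (conj c)).congr_of_eventuallyEq ?_
    filter_upwards [h.conic.isOpen.mem_nhds hw] with u hu
    exact h.grad_smul u hu c hc
  exact DFunLike.congr_fun (h1.unique h2) v

lemma apply_grad_self (h : IsChart B ι U O ρ D) (hx : x ∈ U) (hw : (x, w) ∈ cone ι) :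
    B w (D w) = 0 := by
  rw [h.euler w (h.mem_of_cone x hx w hw), h.eq_zero hx hw]
  simp

end Gradient

section Curves

/-- Since `ι` embeds `U`, a curve in the cone over `ι '' U` determines its base point in `U`, and
does so continuously. -/
lemma exists_lift (h : IsChart B ι U O ρ D) (x : M) {s : Set ℝ} {c : ℝ → V}
    (hc : ContinuousOn c s) (hcO : ∀ t ∈ s, c t ∈ O) (hρ : ∀ t ∈ s, ρ (c t) = 0) :
    ∃ y : ℝ → M, ContinuousOn y s ∧ ∀ t ∈ s, y t ∈ U ∧ (y t, c t) ∈ cone ι := by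
  have hex : ∀ t, ∃ y : M, t ∈ s → y ∈ U ∧ (y, c t) ∈ cone ι := by
    intro t
    by_cases ht : t ∈ s
    · obtain ⟨y, hy, hy'⟩ := (h.eq_zero_iff (c t) (hcO t ht)).1 (hρ t ht)
      exact ⟨y, fun _ => ⟨hy, hy'⟩⟩
    · exact ⟨x, fun h => absurd h ht⟩
  choose y hy using hex
  refine ⟨y, ?_, hy⟩
  rw [continuousOn_iff_continuous_domRestrict]
  let y' : s → U := fun t => ⟨y t, (hy t t.2).1⟩
  have h1 : Continuous (U.domRestrict ι ∘ y') := by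
    have h2 : U.domRestrict ι ∘ y' = (Projectivization.mk' ℂ : {v : V // v ≠ 0} → ℙ ℂ V) ∘
        fun t : s => ⟨c t, h.conic.ne_zero _ (hcO t t.2)⟩ := by
      ext1 t
      obtain ⟨_, h3⟩ := mem_cone_iff.1 (hy t t.2).2
      exact h3.symm
    rw [h2]
    refine continuous_coinduced_rng.comp (Continuous.subtype_mk ?_ _)
    exact continuousOn_iff_continuous_domRestrict.1 hc
  exact continuous_subtype_val.comp (h.isEmbedding.isInducing.continuous_iff.2 h1)

lemma eventually_mem_dom (h : IsChart B ι U O ρ D) (hx : x ∈ U) {ε : ℝ} {y : ℝ → M} (hε : 0 < ε)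
    (hy : ContinuousOn y (Ioo (-ε) ε)) (h0 : y 0 = x) : ∀ᶠ t in 𝓝 0, y t ∈ U := by
  have h1 : ContinuousAt y 0 := hy.continuousAt (Ioo_mem_nhds_zero hε)
  exact h1.eventually_mem (h.isOpen_dom.mem_nhds (by rwa [h0]))

lemma eventually_eq_zero (h : IsChart B ι U O ρ D) (hx : x ∈ U) {ε : ℝ} {y : ℝ → M} {c : ℝ → V}
    (hc : IsCurveThrough (cone ι) (x, w) ε y c) : ∀ᶠ t in 𝓝 0, c t ∈ O ∧ ρ (c t) = 0 := by
  obtain ⟨hε, hy0, hc0, hyc, hcs, hX⟩ := hc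
  filter_upwards [h.eventually_mem_dom hx hε hyc hy0, Ioo_mem_nhds_zero hε] with t ht ht'
  exact ⟨h.mem_of_cone _ ht _ (hX t ht'), h.eq_zero ht (hX t ht')⟩

lemma apply_grad_deriv_eq_zero (h : IsChart B ι U O ρ D) {c : ℝ → V} {t : ℝ} {ξ : V}
    (hO : ∀ᶠ t in 𝓝 t, c t ∈ O ∧ ρ (c t) = 0) (hξ : HasDerivAt c ξ t) :
    (B ξ (D (c t))).re = 0 := by
  have h1 : HasDerivAt (fun s => ρ (c s)) ((rePair B).flip (D (c t)) ξ) t :=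
    (h.hasFDerivAt _ hO.self_of_nhds.1).comp_hasDerivAt t hξ
  exact h1.unique ((hasDerivAt_const t (0 : ℝ)).congr_of_eventuallyEq
    (hO.mono fun s hs => hs.2))

/-- Straighten the cone by `Φ v = v + (ρ v - l (v - w)) n`, where `l = dρ_w` and `l n = 1`. Then
`dΦ_w = id` and `l (Φ v - w) = ρ v`, so the inverse of `Φ` carries the line `w + t ξ` into `ρ = 0`.
It moves points only along `n`, which is what the last clause records for the study of contact. -/
lemma exists_curve [FiniteDimensional ℂ V] (hB : IsDuality B) (h : IsChart B ι U O ρ D)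
    (hx : x ∈ U) (hw : (x, w) ∈ cone ι) {ξ : V} (hξ : (B ξ (D w)).re = 0) :
    ∃ (ε : ℝ) (y : ℝ → M) (c : ℝ → V) (n : V), IsCurveThrough (cone ι) (x, w) ε y c ∧
      HasDerivAt c ξ 0 ∧ (∀ t ∈ Ioo (-ε) ε, y t ∈ U) ∧
      ∀ t ∈ Ioo (-ε) ε, c t = w + t • ξ + (B (c t - w) (D w)).re • n := by
  have hwO := h.mem_of_cone x hx w hw
  obtain ⟨n, hn⟩ : ∃ n, (B n (D w)).re = 1 := by
    by_contra! hcon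
    refine h.grad_ne_zero w hwO (hB.eq_zero_of_re_right fun v => ?_)
    by_contra h0
    apply hcon ((B v (D w)).re⁻¹ • v)
    rw [← Complex.coe_smul, map_smul, smul_apply, smul_eq_mul, Complex.re_ofReal_mul,
      inv_mul_cancel₀ h0]
  set l : V →L[ℝ] ℝ := (rePair B).flip (D w) with hl
  have hln : l n = 1 := hn
  set Φ : V → V := fun v => v + (ρ v - l (v - w)) • n with hΦ
  have hΦs : ContDiffOn ℝ ∞ Φ O := by
    have h1 : ContDiffOn ℝ ∞ (fun v => ρ v - l (v - w)) O :=
      h.contDiffOn.sub (l.contDiff.comp (contDiff_id.sub contDiff_const)).contDiffOn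
    exact contDiffOn_id.add (h1.smul contDiffOn_const)
  have hΦ' : HasFDerivAt Φ ((ContinuousLinearEquiv.refl ℝ V : V ≃L[ℝ] V) : V →L[ℝ] V) w := by
    have h1 : HasFDerivAt (fun v => ρ v - l (v - w)) (l - l) w :=
      (h.hasFDerivAt w hwO).sub (l.hasFDerivAt.comp w ((hasFDerivAt_id w).sub_const w))
    have h2 := (hasFDerivAt_id (𝕜 := ℝ) w).add (h1.smul_const n)
    refine h2.congr_fderiv ?_
    ext v
    simp
  obtain ⟨g, u, v, hu, hv, hwu, huO, hgv, hgu, hgs, hg'⟩ :=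
    exists_smooth_local_inverse h.conic.isOpen hΦs hwO hΦ'
  have hΦw : Φ w = w := by simp [hΦ, h.eq_zero hx hw]
  rw [hΦw] at hg'
  have hwv : w ∈ v := by
    have := (hgu w hwu).1
    rwa [hΦw] at this
  have hgw : g w = w := by
    have := (hgu w hwu).2
    rwa [hΦw] at this
  have hlin : HasDerivAt (fun t : ℝ => w + t • ξ) ξ 0 := by
    simpa using ((hasDerivAt_id (0 : ℝ)).smul_const ξ).const_add w
  have hev : ∀ᶠ t : ℝ in 𝓝 0, w + t • ξ ∈ v :=
    hlin.continuousAt.eventually_mem (hv.mem_nhds (by simpa using hwv))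
  obtain ⟨ε, hε, hεv⟩ := exists_Ioo_of_eventually hev
  set c : ℝ → V := fun t => g (w + t • ξ) with hc
  have hcO : ∀ t ∈ Ioo (-ε) ε, c t ∈ O := fun t ht => huO (hgv _ (hεv t ht)).1
  have hcs : ContDiffOn ℝ ∞ c (Ioo (-ε) ε) := by
    refine hgs.comp (ContDiff.contDiffOn ?_) hεv
    exact contDiff_const.add (contDiff_id.smul contDiff_const)
  have hceq : ∀ t ∈ Ioo (-ε) ε, c t + (ρ (c t) - l (c t - w)) • n = w + t • ξ :=
    fun t ht => (hgv _ (hεv t ht)).2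
  have hcρ : ∀ t ∈ Ioo (-ε) ε, ρ (c t) = 0 := by
    intro t ht
    have h1 := congrArg (fun v => l (v - w)) (hceq t ht)
    have h2 : l ξ = 0 := hξ
    simp only [map_sub, map_add, map_smul, hln, h2, smul_eq_mul, mul_one, mul_zero] at h1
    linarith
  obtain ⟨y, hy, hyU⟩ := h.exists_lift x hcs.continuousOn hcO hcρ
  have h0 : (0 : ℝ) ∈ Ioo (-ε) ε := ⟨by linarith, hε⟩
  have hc0 : c 0 = w := by simp [hc, hgw]
  refine ⟨ε, y, c, n, ⟨hε, ?_, hc0, hy, hcs, fun t ht => (hyU t ht).2⟩, ?_,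
    fun t ht => (hyU t ht).1, ?_⟩
  · refine h.injOn (hyU 0 h0).1 hx (eq_of_mem_cone (w := w) ?_ hw)
    have := (hyU 0 h0).2
    rwa [hc0] at this
  · exact HasFDerivAt.comp_hasDerivAt_of_eq (f := fun t : ℝ => w + t • ξ) (0 : ℝ) hg' hlin
      (by simp)
  · intro t ht
    have h1 := hceq t ht
    rw [hcρ t ht, zero_sub, neg_smul, ← sub_eq_add_neg, sub_eq_iff_eq_add] at h1
    exact h1

lemma coneTangent_eq [FiniteDimensional ℂ V] (hB : IsDuality B) (h : IsChart B ι U O ρ D)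
    (hx : x ∈ U) (hw : (x, w) ∈ cone ι) :
    coneTangent ι x w = {ξ | (B ξ (D w)).re = 0} := by
  ext ξ
  constructor
  · rintro ⟨ε, y, c, hc, hξ⟩
    have := h.apply_grad_deriv_eq_zero (h.eventually_eq_zero hx hc) hξ
    rwa [hc.2.2.1] at this
  · intro hξ
    obtain ⟨ε, y, c, n, hc, h1, -, -⟩ := h.exists_curve hB hx hw hξ
    exact ⟨ε, y, c, hc, h1⟩

lemma coneHolTangent_eq [FiniteDimensional ℂ V] (hB : IsDuality B) (h : IsChart B ι U O ρ D)
    (hx : x ∈ U) (hw : (x, w) ∈ cone ι) :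
    coneHolTangent ι x w = {u | B u (D w) = 0} := by
  ext u
  simp only [coneHolTangent, h.coneTangent_eq hB hx hw, Set.mem_ofPred_eq, map_smul,
    smul_apply, smul_eq_mul, Complex.I_mul_re, neg_eq_zero]
  exact ⟨fun h => Complex.ext h.1 h.2, fun h => by simp [h]⟩

/-- Along the curve `Re B(c', D c) = 0`, so the derivative of `Re B(c - w, D w)` is `-Re B(c', D c -
D w)`, which is asymptotic to `-t Re B(u, dD u)`. L'Hôpital supplies the factor `1/2`. -/
lemma tendsto_contact (h : IsChart B ι U O ρ D) (hx : x ∈ U) {ε : ℝ} {y : ℝ → M} {c : ℝ → V}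
    (hc : IsCurveThrough (cone ι) (x, w) ε y c) {u : V} (hu : HasDerivAt c u 0) :
    Filter.Tendsto (fun t => (B (c t - w) (D w)).re / t ^ 2) (𝓝[≠] 0)
      (𝓝 (-(B u (fderiv ℝ D w u)).re / 2)) := by
  have hev := h.eventually_eq_zero hx hc
  obtain ⟨hε, -, hc0, -, hcs, -⟩ := hc
  simp only at hc0
  have hcd : ∀ t ∈ Ioo (-ε) ε, HasDerivAt c (deriv c t) t := fun t ht =>
    ((hcs.contDiffAt (isOpen_Ioo.mem_nhds ht)).differentiableAt (by simp)).hasDerivAt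
  have h0 : (0 : ℝ) ∈ Ioo (-ε) ε := ⟨by linarith, hε⟩
  have hcd0 : Filter.Tendsto (deriv c) (𝓝[≠] 0) (𝓝 u) := by
    have h1 : ContinuousAt (deriv c) 0 :=
      (hcs.continuousOn_deriv_of_isOpen isOpen_Ioo (by simp)).continuousAt (Ioo_mem_nhds_zero hε)
    rw [← hu.deriv]
    exact h1.tendsto.mono_left nhdsWithin_le_nhds
  have hwO : w ∈ O := hc0 ▸ hev.self_of_nhds.1
  have hDc : HasDerivAt (fun t => D (c t)) (fderiv ℝ D w u) 0 :=
    HasFDerivAt.comp_hasDerivAt_of_eq (f := c) (0 : ℝ) (h.hasFDerivAt_grad hwO) hu hc0.symm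
  have hslope := hasDerivAt_iff_tendsto_slope_zero.1 hDc
  refine tendsto_div_sq_of_hasDerivAt (g' := fun t => (B (deriv c t) (D w)).re) ?_ ?_ ?_
  · filter_upwards [Ioo_mem_nhds_zero hε] with t ht
    exact ((rePair B).flip (D w)).hasFDerivAt.comp_hasDerivAt t ((hcd t ht).sub_const w)
  · simp [hc0]
  · have h1 : Filter.Tendsto (fun t => -(rePair B (deriv c t) (t⁻¹ • (D (c (0 + t)) - D (c 0)))))
        (𝓝[≠] 0) (𝓝 (-(rePair B u (fderiv ℝ D w u)))) := by
      have h2 : Continuous fun p : V × V' => rePair B p.1 p.2 :=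
        (rePair B).isBoundedBilinearMap.continuous
      exact (((h2.tendsto (u, fderiv ℝ D w u)).comp (hcd0.prodMk_nhds hslope))).neg
    refine h1.congr' ?_
    filter_upwards [eventually_nhdsWithin_of_eventually_nhds hev.eventually_nhds,
      eventually_nhdsWithin_of_eventually_nhds (Ioo_mem_nhds_zero hε)] with t ht ht'
    have h3 := h.apply_grad_deriv_eq_zero ht (hcd t ht')
    simp only [map_smul, map_sub, rePair_apply, zero_add, h3, hc0, smul_eq_mul]
    ring

/-- Because `B u (D w) = 0`, the normal part of `c t - (w + t u)` is `Re B(c t - w, D w)`, whose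
second order term is given by `tendsto_contact`. Conversely the curve of `exists_curve` deviates
from the line by this part alone. -/
lemma secondOrderContact_iff [FiniteDimensional ℂ V] (hB : IsDuality B) (h : IsChart B ι U O ρ D)
    (hx : x ∈ U) (hw : (x, w) ∈ cone ι) {u : V} (hu : B u (D w) = 0) :
    SecondOrderContact ι x w u ↔ (B u (fderiv ℝ D w u)).re = 0 := by
  constructor
  · rintro ⟨ε, y, c, hc, ho⟩
    have hd : HasDerivAt c u 0 := by
      rw [hasDerivAt_iff_isLittleO_nhds_zero]
      have h1 := ho.trans (Asymptotics.isLittleO_pow_id one_lt_two)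
      refine h1.congr_left fun t => ?_
      rw [zero_add, hc.2.2.1]
      simp only
      abel
    have h1 := h.tendsto_contact hx hc hd
    have h2 : (fun t => (B (c t - w) (D w)).re) =o[𝓝 0] fun t : ℝ => t ^ 2 := by
      have h3 := (((rePair B).flip (D w)).isBigO_comp (fun t : ℝ => c t - (w + t • u))
        (𝓝 0)).trans_isLittleO ho
      refine h3.congr_left fun t => ?_
      have h4 : (rePair B).flip (D w) u = 0 := by simp [hu]
      rw [← sub_sub, map_sub, map_smul, h4, smul_zero, sub_zero]
      rfl
    have h3 := (h2.tendsto_div_nhds_zero).mono_left (nhdsWithin_le_nhds (s := {0}ᶜ))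
    have h4 := tendsto_nhds_unique h1 h3
    linarith
  · intro h0
    obtain ⟨ε, y, c, n, hc, hd, -, hn⟩ := h.exists_curve hB hx hw (ξ := u) (by rw [hu]; rfl)
    refine ⟨ε, y, c, hc, ?_⟩
    have h1 := h.tendsto_contact hx hc hd
    rw [h0, neg_zero, zero_div] at h1
    have h2 : (fun t => (B (c t - w) (D w)).re) =o[𝓝 0] fun t : ℝ => t ^ 2 := by
      refine Asymptotics.isLittleO_of_tendsto' ?_ ?_
      · filter_upwards with t ht
        have : t = 0 := by simpa using ht
        rw [this, hc.2.2.1]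
        simp
      -- At `t = 0` the quotient is a division by zero, with value `0`, so the punctured limit
      -- extends to the full neighbourhood.
      · have h2 : Filter.Tendsto (fun t => (B (c t - w) (D w)).re / t ^ 2) (pure 0) (𝓝 0) := by
          rw [Filter.tendsto_pure_left]
          intro s hs
          simpa using mem_of_mem_nhds hs
        have h3 := h1.sup h2
        rwa [nhdsNE_sup_pure] at h3
    have h3 : (fun t => (B (c t - w) (D w)).re • n) =o[𝓝 0] fun t : ℝ => t ^ 2 := by
      have := h2.smul_isBigO (Asymptotics.isBigO_refl (fun _ : ℝ => n) (𝓝 0))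
      refine this.trans_isBigO ?_
      refine Asymptotics.IsBigO.of_bound ‖n‖ (Filter.Eventually.of_forall fun t => ?_)
      rw [norm_smul, mul_comm]
    refine h3.congr' ?_ Filter.EventuallyEq.rfl
    filter_upwards [Ioo_mem_nhds_zero hc.1] with t ht
    rw [eq_comm, sub_eq_iff_eq_add, add_comm]
    exact hn t ht

end Curves

end IsChart

end Contact

/-! ### The Legendre transform and the dual hypersurface -/

section DualPair

variable {V : Type*} [NormedAddCommGroup V] [NormedSpace ℂ V]
variable {V' : Type*} [NormedAddCommGroup V'] [NormedSpace ℂ V']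
variable {M : Type*} [TopologicalSpace M]
variable {B : V →L[ℂ] V' →L[ℂ] ℂ} {ι : M → ℙ ℂ V} {γ : M → ℙ ℂ V'} {U : Set M}
  {O : Set V} {O' : Set V'} {ρ : V → ℝ} {ρ' : V' → ℝ} {D : V → V'} {E : V' → V} {x : M} {w : V}

/-- No real line in a complex tangent direction makes second order contact with the cone. -/
def NoContact (ι : M → ℙ ℂ V) : Prop :=
  ∀ (x : M) (w : V), (x, w) ∈ cone ι → ∀ u ∈ coneHolTangent ι x w,
    u ∉ (ι x).submodule → ¬ SecondOrderContact ι x w u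

/-- Open sets of projective space are handled through their cones: `hcont` is continuity, and `hind`
says that every open set of `U` is cut out by a conic open set. -/
lemma isEmbedding_domRestrict_of_conic (hinj : InjOn ι U)
    (hcont : ∀ C : Set V, IsConicOpen C → IsOpen {x ∈ U | (ι x).rep ∈ C})
    (hind : ∀ N : Set M, IsOpen N → ∃ C : Set V, IsConicOpen C ∧
      ∀ x ∈ U, ((ι x).rep ∈ C ↔ x ∈ N)) : IsEmbedding (U.domRestrict ι) := by
  have hmem : ∀ (N : Set (ℙ ℂ V)) (p : ℙ ℂ V), p.rep ∈ coneOver N ↔ p ∈ N := fun N p =>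
    ⟨fun ⟨_, h⟩ => by rwa [p.mk_rep] at h, fun h => ⟨p.rep_nonzero, by rwa [p.mk_rep]⟩⟩
  refine ⟨⟨?_⟩, injOn_iff_injective.1 hinj⟩
  refine le_antisymm ?_ ?_
  · refine continuous_iff_le_induced.1 (continuous_def.2 fun N hN => ?_)
    have h1 := (hcont _ (isConicOpen_of_isOpen hN)).preimage (continuous_subtype_val (p := (· ∈ U)))
    convert h1 using 1
    ext ⟨x, hx⟩
    have := hmem N (ι x)
    simp only [mem_preimage, Set.domRestrict_apply, Set.mem_ofPred_eq, this, hx, true_and]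
  · intro N hN
    obtain ⟨N₁, hN₁, rfl⟩ := isOpen_induced_iff.1 hN
    obtain ⟨C, hC, hCN⟩ := hind N₁ hN₁
    refine isOpen_induced_iff.2 ⟨_, hC.isOpen_mk, ?_⟩
    ext ⟨x, hx⟩
    exact hCN x hx

lemma IsChart.exists_conic_of_isOpen (h : IsChart B ι U O ρ D) {N : Set M} (hN : IsOpen N) :
    ∃ C : Set V, IsConicOpen C ∧ ∀ x ∈ U, ((ι x).rep ∈ C ↔ x ∈ N) := by
  have h1 : IsOpen (Subtype.val ⁻¹' N : Set U) := hN.preimage continuous_subtype_val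
  obtain ⟨N', hN', h2⟩ := h.isEmbedding.isInducing.isOpen_iff.1 h1
  refine ⟨coneOver N', isConicOpen_of_isOpen hN', fun x hx => ?_⟩
  have h3 : (⟨x, hx⟩ : U) ∈ U.domRestrict ι ⁻¹' N' ↔ (⟨x, hx⟩ : U) ∈ Subtype.val ⁻¹' N := by
    rw [h2]
  refine Iff.trans ?_ h3
  exact ⟨fun ⟨_, h⟩ => by rwa [(ι x).mk_rep] at h,
    fun h => ⟨(ι x).rep_nonzero, by rw [(ι x).mk_rep]; exact h⟩⟩

/-- Two charts of hypersurfaces in dual spaces whose complex gradients are mutually inverse. -/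
structure IsDualPair (B : V →L[ℂ] V' →L[ℂ] ℂ) (ι : M → ℙ ℂ V) (γ : M → ℙ ℂ V') (U : Set M)
    (O : Set V) (O' : Set V') (ρ : V → ℝ) (ρ' : V' → ℝ) (D : V → V') (E : V' → V) : Prop where
  chart : IsChart B ι U O ρ D
  dual : IsChart B.flip γ U O' ρ' E
  grad_mem : ∀ w ∈ O, D w ∈ O'
  dual_grad_mem : ∀ l ∈ O', E l ∈ O
  left_inv : ∀ w ∈ O, E (D w) = w
  right_inv : ∀ l ∈ O', D (E l) = l
  cone_grad : ∀ x ∈ U, ∀ w, (x, w) ∈ cone ι → (x, D w) ∈ cone γ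
  cone_dual_grad : ∀ x ∈ U, ∀ l, (x, l) ∈ cone γ → (x, E l) ∈ cone ι

lemma IsDualPair.symm (h : IsDualPair B ι γ U O O' ρ ρ' D E) :
    IsDualPair B.flip γ ι U O' O ρ' ρ E D :=
  ⟨h.dual, by rw [ContinuousLinearMap.flip_flip]; exact h.chart, h.dual_grad_mem, h.grad_mem,
    h.right_inv, h.left_inv, h.cone_dual_grad, h.cone_grad⟩

lemma IsConicOpen.preimage (hO : IsConicOpen O) (hO' : IsConicOpen O') (hD : ContinuousOn D O)
    (hs : ∀ w ∈ O, ∀ c : ℂ, c ≠ 0 → D (c • w) = conj c • D w) :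
    IsConicOpen (O ∩ D ⁻¹' O') where
  isOpen := hD.isOpen_inter_preimage hO.isOpen hO'.isOpen
  ne_zero := fun w hw => hO.ne_zero w hw.1
  smul_mem := by
    rintro w ⟨hw, hw'⟩ c hc
    refine ⟨hO.smul_mem w hw c hc, ?_⟩
    show D (c • w) ∈ O'
    rw [hs w hw c hc]
    exact hO'.smul_mem _ hw' _ (by simpa using hc)

/-- The Legendre transform of a chart. -/
lemma IsChart.isDualPair (h : IsChart B ι U O ρ D) (hO' : IsConicOpen O')
    (hE : ContDiffOn ℝ ∞ E O') (hEs : ∀ l ∈ O', ∀ c : ℂ, c ≠ 0 → E (c • l) = conj c • E l)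
    (hDm : ∀ w ∈ O, D w ∈ O') (hEm : ∀ l ∈ O', E l ∈ O) (hED : ∀ w ∈ O, E (D w) = w)
    (hDE : ∀ l ∈ O', D (E l) = l)
    (hγ : ∀ x ∈ U, ∀ w, (x, w) ∈ cone ι → (x, D w) ∈ cone γ) :
    IsDualPair B ι γ U O O' ρ (ρ ∘ E) D E := by
  have hγ' : ∀ x ∈ U, ∀ l, (x, l) ∈ cone γ → l ∈ O' ∧ (x, E l) ∈ cone ι := by
    intro x hx l hl
    obtain ⟨w, hw⟩ := exists_mem_cone ι x
    obtain ⟨c, hc, rfl⟩ := exists_smul_eq_of_mem_cone (hγ x hx w hw) hl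
    have hwO := h.mem_of_cone x hx w hw
    refine ⟨hO'.smul_mem _ (hDm w hwO) c hc, ?_⟩
    rw [hEs _ (hDm w hwO) c hc, hED w hwO]
    exact smul_mem_cone hw (by simpa using hc)
  have hrep : ∀ x, (x, (γ x).rep) ∈ cone γ := fun x =>
    mem_cone_iff.2 ⟨(γ x).rep_nonzero, (γ x).mk_rep⟩
  refine ⟨h, ?_, hDm, hEm, hED, hDE, hγ, fun x hx l hl => (hγ' x hx l hl).2⟩
  refine
    { isOpen_dom := h.isOpen_dom
      conic := hO'
      isEmbedding := isEmbedding_domRestrict_of_conic ?_ ?_ ?_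
      mem_of_cone := fun x hx l hl => (hγ' x hx l hl).1
      eq_zero_iff := ?_
      contDiffOn := h.contDiffOn.comp hE hEm
      contDiffOn_grad := hE
      grad_smul := hEs
      grad_ne_zero := fun l hl => h.conic.ne_zero _ (hEm l hl)
      hasFDerivAt := ?_
      euler := ?_ }
  · intro x hx y hy hxy
    obtain ⟨l, hl⟩ := exists_mem_cone γ x
    have hl' : (y, l) ∈ cone γ := by
      obtain ⟨h0, h1⟩ := mem_cone_iff.1 hl
      exact mem_cone_iff.2 ⟨h0, h1.trans hxy⟩
    exact h.injOn hx hy (eq_of_mem_cone (hγ' x hx l hl).2 (hγ' y hy l hl').2)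
  · intro C hC
    have h1 := isOpen_dom_of_conic h.isOpen_dom h.isEmbedding.continuous
      (h.conic.preimage hC h.contDiffOn_grad.continuousOn h.grad_smul)
    convert h1 using 1
    ext x
    refine and_congr_right fun hx => ?_
    obtain ⟨w, hw⟩ := exists_mem_cone ι x
    rw [hC.rep_mem_iff (hγ x hx w hw),
      (h.conic.preimage hC h.contDiffOn_grad.continuousOn h.grad_smul).rep_mem_iff hw]
    exact ⟨fun h2 => ⟨h.mem_of_cone x hx w hw, h2⟩, fun h2 => h2.2⟩
  · intro N hN
    obtain ⟨C, hC, hCN⟩ := h.exists_conic_of_isOpen hN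
    refine ⟨_, hO'.preimage hC hE.continuousOn hEs, fun x hx => ?_⟩
    have h1 := hγ' x hx _ (hrep x)
    rw [← hCN x hx, hC.rep_mem_iff h1.2]
    exact ⟨fun h2 => h2.2, fun h2 => ⟨h1.1, h2⟩⟩
  · intro l hl
    rw [Function.comp_apply, h.eq_zero_iff _ (hEm l hl)]
    refine exists_congr fun x => and_congr_right fun hx => ⟨fun h1 => ?_, fun h1 => ?_⟩
    · have := hγ x hx _ h1
      rwa [hDE l hl] at this
    · exact (hγ' x hx l h1).2
  · intro l hl
    have hE' : HasFDerivAt E (fderiv ℝ E l) l :=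
      ((hE.contDiffAt (hO'.isOpen.mem_nhds hl)).differentiableAt (by simp)).hasFDerivAt
    have h1 : HasFDerivAt (ρ ∘ E) (((rePair B).flip l).comp (fderiv ℝ E l)) l := by
      have := h.hasFDerivAt (E l) (hEm l hl)
      rw [hDE l hl] at this
      exact this.comp l hE'
    -- Differentiate Euler's identity `Re B(E l, l) = 2 ρ (E l)`. By the product rule and `h1`, the
    -- left side gives `d(ρ ∘ E) + Re B(E l, ·)` and the right side `2 d(ρ ∘ E)`; hence `E` is the
    -- complex gradient of `ρ ∘ E`.
    have h2 : HasFDerivAt (fun l => rePair B (E l) l)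
        (((rePair B).flip l).comp (fderiv ℝ E l) + rePair B (E l)) l := by
      have := (rePair B).hasFDerivAt_of_bilinear hE' (hasFDerivAt_id l)
      refine this.congr_fderiv (ContinuousLinearMap.ext fun v => ?_)
      simp [ContinuousLinearMap.precompR, ContinuousLinearMap.precompL]
      ring
    have h3 : HasFDerivAt (fun l => rePair B (E l) l)
        ((2 : ℝ) • ((rePair B).flip l).comp (fderiv ℝ E l)) l := by
      refine (h1.const_smul (2 : ℝ)).congr_of_eventuallyEq ?_
      filter_upwards [hO'.isOpen.mem_nhds hl] with l' hl'
      have := congrArg Complex.re (h.euler (E l') (hEm l' hl'))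
      rw [hDE l' hl'] at this
      simpa using this
    refine h1.congr_fderiv ?_
    have h4 := h2.unique h3
    rw [two_smul] at h4
    exact (add_left_cancel h4).symm
  · intro l hl
    have := h.euler (E l) (hEm l hl)
    rwa [hDE l hl] at this

lemma IsChart.exists_smul_eq_of_hess_eq_zero [FiniteDimensional ℂ V] (hB : IsDuality B)
    (h : IsChart B ι U O ρ D) (hN : NoContact ι) (hx : x ∈ U) (hw : (x, w) ∈ cone ι) {u : V}
    (hu : B u (D w) = 0) (hu' : (B u (fderiv ℝ D w u)).re = 0) : ∃ c : ℂ, c • w = u := by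
  by_contra hcon
  refine hN x w hw u ?_ ?_ ((h.secondOrderContact_iff hB hx hw hu).2 hu')
  · rw [h.coneHolTangent_eq hB hx hw]
    exact hu
  · rwa [mem_submodule_iff hw]

/-- If `dD v = 0`, symmetry of the Hessian against the multiples of `w` gives `B v (D w) = 0`. The
Hessian form vanishes at `v`, so `v = c w` by the absence of contact. Then `dD v = c̄ D w` forces `c
= 0`. -/
lemma IsChart.fderiv_grad_injective [FiniteDimensional ℂ V] (hB : IsDuality B)
    (h : IsChart B ι U O ρ D) (hN : NoContact ι) (hx : x ∈ U) (hw : (x, w) ∈ cone ι) :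
    Function.Injective (fderiv ℝ D w) := by
  rw [injective_iff_map_eq_zero]
  intro v hv
  have hwO := h.mem_of_cone x hx w hw
  have h1 : B v (D w) = 0 := by
    refine eq_zero_of_re_mul_eq_zero fun z => ?_
    have h2 := h.hess_symm hwO v (conj z • w)
    rw [hv, h.fderiv_grad_smul_self hwO] at h2
    simpa using h2
  obtain ⟨c, rfl⟩ := h.exists_smul_eq_of_hess_eq_zero hB hN hx hw h1 (by simp [hv])
  rw [h.fderiv_grad_smul_self hwO, smul_eq_zero] at hv
  rcases hv with hv | hv
  · simp [(map_eq_zero _).1 hv]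
  · exact absurd hv (h.grad_ne_zero w hwO)

lemma IsDuality.finrank_eq [FiniteDimensional ℂ V] (hB : IsDuality B) :
    Module.finrank ℂ V = Module.finrank ℂ V' := by
  have := hB.isPerfPair
  exact Module.finrank_of_isPerfPair (ContinuousLinearMap.toLinearMap₁₂ B)

/-- The inverse function theorem gives a local inverse `g` of `D` without homogeneity. Its
restriction to a hyperplane `e = 1` is extended conjugate-homogeneously, and the extension still
inverts `D` because `D` has the same homogeneity. -/
lemma exists_isDualPair [FiniteDimensional ℂ V] [FiniteDimensional ℂ V'] (hB : IsDuality B)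
    (h : IsChart B ι U O ρ D) (hN : NoContact ι) (hx : x ∈ U)
    (hγ : ∀ x ∈ U, ∀ w, (x, w) ∈ cone ι → (x, D w) ∈ cone γ) :
    ∃ U₁ O₁ O' ρ' E, x ∈ U₁ ∧ IsDualPair B ι γ U₁ O₁ O' ρ ρ' D E := by
  obtain ⟨w₀, hw₀⟩ := exists_mem_cone ι x
  have hwO := h.mem_of_cone x hx w₀ hw₀
  have hfr : Module.finrank ℝ V = Module.finrank ℝ V' := by
    rw [finrank_real_of_complex, finrank_real_of_complex, hB.finrank_eq]
  let f' : V ≃L[ℝ] V' := (LinearEquiv.ofInjectiveOfFinrankEq (fderiv ℝ D w₀).toLinearMap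
    (h.fderiv_grad_injective hB hN hx hw₀) hfr).toContinuousLinearEquiv
  have hf' : HasFDerivAt D (f' : V →L[ℝ] V') w₀ := h.hasFDerivAt_grad hwO
  obtain ⟨g, u, v, hu, hv, hwu, huO, hgv, hgu, hgs, -⟩ :=
    exists_smooth_local_inverse h.conic.isOpen h.contDiffOn_grad hwO hf'
  obtain ⟨p, hp⟩ : ∃ p, B p (D w₀) = 1 := by
    by_contra! hcon
    refine h.grad_ne_zero w₀ hwO (hB.right _ fun q => ?_)
    by_contra h0
    apply hcon ((B q (D w₀))⁻¹ • q)
    rw [map_smul, smul_apply, smul_eq_mul, inv_mul_cancel₀ h0]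
  set e : V' →L[ℂ] ℂ := B p with he
  set O' := affineCone e v with hO'def
  have hO' : IsConicOpen O' := isConicOpen_affineCone e hv
  set E : V' → V := fun l => conj (e l) • g ((e l)⁻¹ • l) with hEdef
  set O₁ : Set V := {w ∈ O | e (D w) ≠ 0 ∧ (conj (e (D w)))⁻¹ • w ∈ u} with hO₁def
  have hcj : ∀ {c : ℂ}, c ≠ 0 → conj c ≠ 0 := fun hc => by simpa using hc
  have hO₁ : IsConicOpen O₁ := by
    refine ⟨?_, fun w hw => h.conic.ne_zero w hw.1, ?_⟩
    · have hc1 : ContinuousOn (fun w => e (D w)) O :=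
        e.continuous.comp_continuousOn h.contDiffOn_grad.continuousOn
      have hO2 : IsOpen (O ∩ (fun w => e (D w)) ⁻¹' {0}ᶜ) :=
        hc1.isOpen_inter_preimage h.conic.isOpen isOpen_compl_singleton
      have hc2 : ContinuousOn (fun w => (conj (e (D w)))⁻¹ • w)
          (O ∩ (fun w => e (D w)) ⁻¹' {0}ᶜ) :=
        ((Complex.continuous_conj.comp_continuousOn (hc1.mono inter_subset_left)).inv₀
          fun w hw => hcj hw.2).smul continuousOn_id
      convert hc2.isOpen_inter_preimage hO2 hu using 1
      ext w
      simp only [hO₁def, Set.mem_ofPred_eq, mem_inter_iff, mem_preimage, mem_compl_iff,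
        mem_singleton_iff, and_assoc, ne_eq]
    · rintro w ⟨hw, hw1, hw2⟩ c hc
      refine ⟨h.conic.smul_mem w hw c hc, ?_, ?_⟩
      · rw [h.grad_smul w hw c hc, map_smul]
        exact mul_ne_zero (hcj hc) hw1
      · rw [h.grad_smul w hw c hc, map_smul, smul_eq_mul, map_mul, Complex.conj_conj, smul_smul,
          mul_inv, mul_right_comm, inv_mul_cancel₀ hc, one_mul]
        exact hw2
  have hsub : O₁ ⊆ O := fun w hw => hw.1
  have hEs : ∀ l ∈ O', ∀ c : ℂ, c ≠ 0 → E (c • l) = conj c • E l := by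
    intro l hl c hc
    simp only [hEdef, map_smul, smul_eq_mul, map_mul, smul_smul, mul_inv]
    rw [mul_right_comm, inv_mul_cancel₀ hc, one_mul]
  have hE : ContDiffOn ℝ ∞ E O' := by
    have h1 : ContDiff ℝ ∞ fun l => conj (e l) :=
      Complex.conjCLE.contDiff.comp (e.restrictScalars ℝ).contDiff
    exact h1.contDiffOn.smul
      (hgs.comp ((contDiffOn_normalize e).mono fun l hl => hl.1) fun l hl => hl.2)
  have hDE : ∀ l ∈ O', D (E l) = l := by
    rintro l ⟨hl, hl'⟩
    simp only [hEdef]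
    rw [h.grad_smul _ (huO (hgv _ hl').1) _ (hcj hl), (hgv _ hl').2, Complex.conj_conj, smul_smul,
      mul_inv_cancel₀ hl, one_smul]
  have hEm : ∀ l ∈ O', E l ∈ O₁ := by
    intro l hl
    refine ⟨h.conic.smul_mem _ (huO (hgv _ hl.2).1) _ (hcj hl.1), ?_, ?_⟩
    · rw [hDE l hl]
      exact hl.1
    · rw [hDE l hl]
      simp only [hEdef]
      rw [smul_smul, inv_mul_cancel₀ (hcj hl.1), one_smul]
      exact (hgv _ hl.2).1
  have hnorm : ∀ w ∈ O₁, (e (D w))⁻¹ • D w = D ((conj (e (D w)))⁻¹ • w) := by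
    intro w hw
    rw [h.grad_smul w hw.1 _ (inv_ne_zero (hcj hw.2.1)), map_inv₀, Complex.conj_conj]
  have hDm : ∀ w ∈ O₁, D w ∈ O' := by
    intro w hw
    refine ⟨hw.2.1, ?_⟩
    rw [hnorm w hw]
    exact (hgu _ hw.2.2).1
  have hED : ∀ w ∈ O₁, E (D w) = w := by
    intro w hw
    simp only [hEdef]
    rw [hnorm w hw, (hgu _ hw.2.2).2, smul_smul, mul_inv_cancel₀ (hcj hw.2.1), one_smul]
  have hw₁ : w₀ ∈ O₁ := ⟨hwO, by simp [hp], by simpa [hp] using hwu⟩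
  exact ⟨{x ∈ U | (ι x).rep ∈ O₁}, O₁, O', ρ ∘ E, E, ⟨hx, (hO₁.rep_mem_iff hw₀).2 hw₁⟩,
    (h.restrict hO₁ hsub).isDualPair hO' hE hEs hDm hEm hED hDE fun x hx => hγ x hx.1⟩

namespace IsDualPair

lemma fderiv_dual_grad (h : IsDualPair B ι γ U O O' ρ ρ' D E) (hw : w ∈ O) (v : V) :
    fderiv ℝ E (D w) (fderiv ℝ D w v) = v := by
  have h1 : HasFDerivAt (E ∘ D) ((fderiv ℝ E (D w)).comp (fderiv ℝ D w)) w :=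
    (h.dual.hasFDerivAt_grad (h.grad_mem w hw)).comp w (h.chart.hasFDerivAt_grad hw)
  have h2 : HasFDerivAt (E ∘ D) (ContinuousLinearMap.id ℝ V) w := by
    refine (hasFDerivAt_id w).congr_of_eventuallyEq ?_
    filter_upwards [h.chart.conic.isOpen.mem_nhds hw] with y hy
    exact h.left_inv y hy
  exact DFunLike.congr_fun (h1.unique h2) v

lemma fderiv_grad (h : IsDualPair B ι γ U O O' ρ ρ' D E) (hw : w ∈ O) (l : V') :
    fderiv ℝ D w (fderiv ℝ E (D w) l) = l := by
  have := h.symm.fderiv_dual_grad (h.grad_mem w hw) l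
  rwa [h.left_inv w hw] at this

/-- The absence of second order contact is inherited by the dual. -/
lemma exists_smul_eq [FiniteDimensional ℂ V] (hB : IsDuality B)
    (h : IsDualPair B ι γ U O O' ρ ρ' D E) (hN : NoContact ι) (hx : x ∈ U)
    (hw : (x, w) ∈ cone ι) {u : V'} (hu : B w u = 0)
    (hu' : (B (fderiv ℝ E (D w) u) u).re = 0) : ∃ c : ℂ, c • D w = u := by
  have hwO := h.chart.mem_of_cone x hx w hw
  -- Under `u = dD v` the dual Hessian form at `u` becomes the original one at `v`, and symmetry
  -- turns `B w u = 0` into `B v (D w) = 0`.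
  obtain ⟨v, rfl⟩ : ∃ v, fderiv ℝ D w v = u := ⟨_, h.fderiv_grad hwO u⟩
  rw [h.fderiv_dual_grad hwO] at hu'
  have h1 : B v (D w) = 0 := by
    refine eq_zero_of_re_mul_eq_zero fun z => ?_
    have h2 := h.chart.hess_symm hwO v (conj z • w)
    rw [h.chart.fderiv_grad_smul_self hwO, map_smul, map_smul, smul_apply, hu] at h2
    simpa using h2
  obtain ⟨c, rfl⟩ := h.chart.exists_smul_eq_of_hess_eq_zero hB hN hx hw h1 hu'
  exact ⟨conj c, (h.chart.fderiv_grad_smul_self hwO c).symm⟩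

end IsDualPair

lemma noContact_of_dualPairs [FiniteDimensional ℂ V] [FiniteDimensional ℂ V'] (hB : IsDuality B)
    (hN : NoContact ι)
    (h : ∀ x, ∃ U O O' ρ ρ' D E, x ∈ U ∧ IsDualPair B ι γ U O O' ρ ρ' D E) : NoContact γ := by
  intro x l hl u hu hul hcon
  obtain ⟨U, O, O', ρ, ρ', D, E, hx, hp⟩ := h x
  have hlO := hp.dual.mem_of_cone x hx l hl
  have hw := hp.cone_dual_grad x hx l hl
  have hDE := hp.right_inv l hlO
  rw [hp.dual.coneHolTangent_eq hB.flip hx hl] at hu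
  have h1 := (hp.dual.secondOrderContact_iff hB.flip hx hl hu).1 hcon
  rw [← hDE] at h1
  obtain ⟨c, hc⟩ := hp.exists_smul_eq hB hN hx hw hu h1
  rw [hDE] at hc
  exact hul ((mem_submodule_iff hl).2 ⟨c, hc⟩)

end DualPair

/-! ### Adapted frames and the tangent vectors of the frame bundle -/

section Frames

variable {V : Type*} [NormedAddCommGroup V] [NormedSpace ℂ V]
variable {V' : Type*} [NormedAddCommGroup V'] [NormedSpace ℂ V']
variable {M : Type*} [TopologicalSpace M] {k : ℕ}
variable {B : V →L[ℂ] V' →L[ℂ] ℂ} {ι : M → ℙ ℂ V} {U : Set M}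
  {O : Set V} {ρ : V → ℝ} {D : V → V'} {x : M} {f : Module.Basis (Fin (k + 2)) ℂ V}

lemma complex_smul_eq (z : ℂ) (v : V) : z • v = z.re • v + z.im • (Complex.I • v) := by
  conv_lhs => rw [← Complex.re_add_im z, add_smul, mul_smul]
  rfl

lemma ContDiffOn.pairing {c : ℝ → V} {d : ℝ → V'} {s : Set ℝ} (hc : ContDiffOn ℝ ∞ c s)
    (hd : ContDiffOn ℝ ∞ d s) : ContDiffOn ℝ ∞ (fun t => B (c t) (d t)) s :=
  (B.bilinearRestrictScalars ℝ).isBoundedBilinearMap.contDiff.comp_contDiffOn (hc.prodMk hd)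

lemma HasDerivAt.pairing {c : ℝ → V} {d : ℝ → V'} {c' : V} {d' : V'} {t : ℝ}
    (hc : HasDerivAt c c' t) (hd : HasDerivAt d d' t) :
    HasDerivAt (fun t => B (c t) (d t)) (B (c t) d' + B c' (d t)) t :=
  (B.bilinearRestrictScalars ℝ).hasDerivAt_of_bilinear (fun _ => hc) fun _ => hd

namespace IsChart

lemma apply_grad_eq (hf : ∀ a : Fin (k + 1), B (f a.castSucc) (D (f 0)) = 0) (v : V) :
    B v (D (f 0)) = f.repr v (Fin.last _) * B (f (Fin.last _)) (D (f 0)) := by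
  conv_lhs => rw [← f.sum_repr v]
  rw [map_sum, sum_apply, Fin.sum_univ_castSucc,
    Finset.sum_eq_zero fun a _ => by rw [map_smul, smul_apply, hf, smul_zero], zero_add, map_smul,
    smul_apply, smul_eq_mul]

lemma apply_grad_last_ne_zero (hB : IsDuality B) (h : IsChart B ι U O ρ D) (hx : x ∈ U)
    (hc : (x, f 0) ∈ cone ι) (hf : ∀ a : Fin (k + 1), B (f a.castSucc) (D (f 0)) = 0) :
    B (f (Fin.last _)) (D (f 0)) ≠ 0 := by
  intro h0
  refine h.grad_ne_zero _ (h.mem_of_cone x hx _ hc) (hB.right _ fun v => ?_)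
  rw [apply_grad_eq hf, h0, mul_zero]

/-- The cone tangent is the real hyperplane `Re B(·, D f_0) = 0`. It contains both `f_a` and `i f_a`
for `a < m` exactly when these pair to zero; `f_m` then pairs to a nonzero imaginary number, so
tangent vectors are those with real last coordinate. -/
lemma mem_frameBundle_iff [FiniteDimensional ℂ V] (hB : IsDuality B) (h : IsChart B ι U O ρ D)
    (hx : x ∈ U) : (x, f) ∈ frameBundle ι ↔ (x, f 0) ∈ cone ι ∧
      (∀ a : Fin (k + 1), B (f a.castSucc) (D (f 0)) = 0) ∧
      (B (f (Fin.last _)) (D (f 0))).re = 0 := by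
  refine and_congr_right fun (hc : (x, f 0) ∈ cone ι) => ?_
  simp only [h.coneTangent_eq hB hx hc]
  constructor
  · intro hs
    have key : ∀ v ∈ (range f ∪ range fun a : Fin (k + 1) => Complex.I • f a.castSucc),
        (B v (D (f 0))).re = 0 := by
      intro v hv
      have : v ∈ {ξ | (B ξ (D (f 0))).re = 0} := by
        rw [← hs]
        exact Submodule.subset_span hv
      exact this
    refine ⟨fun a => Complex.ext (key _ (Or.inl ⟨_, rfl⟩)) ?_, key _ (Or.inl ⟨_, rfl⟩)⟩
    have := key _ (Or.inr ⟨a, rfl⟩)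
    simpa using this
  · rintro ⟨hf, hl⟩
    apply subset_antisymm
    · intro v hv
      have hv' : v ∈ Submodule.span ℝ
        (range f ∪ range fun a : Fin (k + 1) => Complex.I • f a.castSucc) := hv
      refine Submodule.span_induction (p := fun v _ => (B v (D (f 0))).re = 0) ?_ ?_ ?_ ?_ hv'
      · rintro _ (⟨a, rfl⟩ | ⟨a, rfl⟩)
        · induction a using Fin.lastCases with
          | last => exact hl
          | cast a => rw [hf]; rfl
        · simp [hf]
      · simp
      · intro u v _ _ hu hv
        simp [hu, hv]
      · intro a v _ hv
        rw [← Complex.coe_smul, map_smul, smul_apply, smul_eq_mul, Complex.re_ofReal_mul, hv,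
          mul_zero]
    · intro v hv
      have h0 := h.apply_grad_last_ne_zero hB hx hc hf
      have h1 : (f.repr v (Fin.last _)).im = 0 := by
        have h2 : (B v (D (f 0))).re = 0 := hv
        rw [apply_grad_eq hf, Complex.mul_re, hl, mul_zero, zero_sub, neg_eq_zero,
          mul_eq_zero] at h2
        refine h2.resolve_right fun h3 => h0 (Complex.ext hl h3)
      show v ∈ Submodule.span ℝ _
      rw [← f.sum_repr v, Fin.sum_univ_castSucc]
      refine Submodule.add_mem _ (Submodule.sum_mem _ fun a _ => ?_) ?_
      · rw [complex_smul_eq]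
        exact Submodule.add_mem _
          (Submodule.smul_mem _ _ (Submodule.subset_span (Or.inl ⟨_, rfl⟩)))
          (Submodule.smul_mem _ _ (Submodule.subset_span (Or.inr ⟨_, rfl⟩)))
      · rw [complex_smul_eq, h1, zero_smul, add_zero]
        exact Submodule.smul_mem _ _ (Submodule.subset_span (Or.inl ⟨_, rfl⟩))

/-- The linear equations satisfied by the tangent vectors of the frame bundle. -/
def IsFrameTangent (B : V →L[ℂ] V' →L[ℂ] ℂ) (D : V → V') (f : Module.Basis (Fin (k + 2)) ℂ V)
    (ξ : Fin (k + 2) → V) : Prop :=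
  (∀ a : Fin (k + 1), B (f a.castSucc) (fderiv ℝ D (f 0) (ξ 0)) + B (ξ a.castSucc) (D (f 0)) = 0) ∧
    (B (f (Fin.last _)) (fderiv ℝ D (f 0) (ξ 0)) + B (ξ (Fin.last _)) (D (f 0))).re = 0

lemma isFrameTangent_of_mem [FiniteDimensional ℂ V] (hB : IsDuality B) (h : IsChart B ι U O ρ D)
    (hx : x ∈ U) (hf : (x, f) ∈ frameBundle ι) {ξ : Fin (k + 2) → V}
    (hξ : ξ ∈ frameTangent ι x f) : IsFrameTangent B D f ξ := by
  obtain ⟨ε, y, c, ⟨hε, hy0, hc0, hy, hcs, hX⟩, hd⟩ := hξ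
  simp only at hy0 hc0
  have hfO := h.mem_of_cone x hx _ hf.1
  have hev : ∀ᶠ t in 𝓝 0, (∀ a : Fin (k + 1), B (c t a.castSucc) (D (c t 0)) = 0) ∧
      (B (c t (Fin.last _)) (D (c t 0))).re = 0 := by
    filter_upwards [h.eventually_mem_dom hx hε hy hy0, Ioo_mem_nhds_zero hε] with t ht ht'
    obtain ⟨⟨x', f'⟩, hf', he⟩ := hX t ht'
    simp only [Prod.mk.injEq] at he
    obtain ⟨rfl, he⟩ := he
    rw [← he]
    exact ((h.mem_frameBundle_iff hB ht).1 hf').2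
  have hca : ∀ a, HasDerivAt (fun t => c t a) (ξ a) 0 := hasDerivAt_pi.1 hd
  have hD : HasDerivAt (fun t => D (c t 0)) (fderiv ℝ D (f 0) (ξ 0)) 0 :=
    HasFDerivAt.comp_hasDerivAt_of_eq (f := fun t => c t 0) (0 : ℝ) (h.hasFDerivAt_grad hfO)
      (hca 0) (by rw [hc0])
  have hN : ∀ a, HasDerivAt (fun t => B (c t a) (D (c t 0)))
      (B (f a) (fderiv ℝ D (f 0) (ξ 0)) + B (ξ a) (D (f 0))) 0 := by
    intro a
    have := HasDerivAt.pairing (B := B) (hca a) hD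
    rwa [hc0] at this
  constructor
  · intro a
    exact (hN _).unique ((hasDerivAt_const (0 : ℝ) (0 : ℂ)).congr_of_eventuallyEq
      (hev.mono fun t ht => ht.1 a))
  · exact (Complex.reCLM.hasFDerivAt.comp_hasDerivAt (0 : ℝ) (hN _)).unique
      ((hasDerivAt_const (0 : ℝ) (0 : ℝ)).congr_of_eventuallyEq (hev.mono fun t ht => ht.2))

/-- Let `f_0` move along a curve in the cone with velocity `ξ_0`, and let the other vectors be `f_a
+ t ξ_a - r_a(t) f_m`, with `r_a` chosen so that the frame stays adapted. The linear equations on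
`ξ` make `r_a` vanish to first order, so the velocity is `ξ`. -/
lemma mem_frameTangent_of [FiniteDimensional ℂ V] (hB : IsDuality B) (h : IsChart B ι U O ρ D)
    (hx : x ∈ U) (hf : (x, f) ∈ frameBundle ι) {ξ : Fin (k + 2) → V}
    (hξ : IsFrameTangent B D f ξ) : ξ ∈ frameTangent ι x f := by
  obtain ⟨hfc, hf1, hf2⟩ := (h.mem_frameBundle_iff hB hx).1 hf
  have hfO := h.mem_of_cone x hx _ hfc
  have hq0 : (B (f (Fin.last _)) (D (f 0))).im ≠ 0 := fun h0 =>
    h.apply_grad_last_ne_zero hB hx hfc hf1 (Complex.ext hf2 h0)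
  -- By Hessian symmetry and `dD f_0 = D f_0`, both terms of the equation for `a = 0` have the same
  -- real part.
  have hξ0 : (B (ξ 0) (D (f 0))).re = 0 := by
    have h1 := congrArg Complex.re (hξ.1 0)
    have h2 := h.fderiv_grad_smul_self hfO 1
    rw [one_smul, map_one, one_smul] at h2
    rw [Fin.castSucc_zero, Complex.add_re, h.hess_symm hfO, h2, Complex.zero_re] at h1
    linarith
  obtain ⟨ε₀, y, c₀, -, ⟨hε₀, hy0, hc0, hy, hcs, hX⟩, hd0, hyU, -⟩ := h.exists_curve hB hx hfc hξ0
  simp only at hy0 hc0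
  set d : ℝ → V' := fun t => D (c₀ t) with hddef
  have hds : ContDiffOn ℝ ∞ d (Ioo (-ε₀) ε₀) :=
    h.contDiffOn_grad.comp hcs fun t ht => h.mem_of_cone _ (hyU t ht) _ (hX t ht)
  have hd' : HasDerivAt d (fderiv ℝ D (f 0) (ξ 0)) 0 :=
    HasFDerivAt.comp_hasDerivAt_of_eq (f := c₀) (0 : ℝ) (h.hasFDerivAt_grad hfO) hd0 hc0.symm
  have hd00 : d 0 = D (f 0) := by rw [hddef]; simp only [hc0]
  set q : ℝ → ℂ := fun t => B (f (Fin.last _)) (d t) with hqdef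
  have hqs : ContDiffOn ℝ ∞ q (Ioo (-ε₀) ε₀) := ContDiffOn.pairing contDiffOn_const hds
  have hq' : HasDerivAt q (B (f (Fin.last _)) (fderiv ℝ D (f 0) (ξ 0))) 0 := by
    simpa using HasDerivAt.pairing (B := B) (hasDerivAt_const (0 : ℝ) (f (Fin.last _))) hd'
  have hq00 : q 0 = B (f (Fin.last _)) (D (f 0)) := by rw [hqdef]; simp only [hd00]
  set N : Fin (k + 2) → ℝ → ℂ := fun a t => B (f a + t • ξ a) (d t) with hNdef
  have hlin : ∀ a, HasDerivAt (fun t : ℝ => f a + t • ξ a) (ξ a) 0 := fun a => by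
    simpa using ((hasDerivAt_id (0 : ℝ)).smul_const (ξ a)).const_add (f a)
  have hlins : ∀ a, ContDiff ℝ ∞ (fun t : ℝ => f a + t • ξ a) := fun a =>
    contDiff_const.add (contDiff_id.smul contDiff_const)
  have hNs : ∀ a, ContDiffOn ℝ ∞ (N a) (Ioo (-ε₀) ε₀) := fun a =>
    ContDiffOn.pairing (hlins a).contDiffOn hds
  have hN0 : ∀ a, N a 0 = B (f a) (D (f 0)) := fun a => by simp [hNdef, hd00]
  have hN' : ∀ a, HasDerivAt (N a) (B (f a) (fderiv ℝ D (f 0) (ξ 0)) + B (ξ a) (D (f 0))) 0 := by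
    intro a
    have := HasDerivAt.pairing (B := B) (hlin a) hd'
    rw [hd00] at this
    exact this.congr_deriv (by simp)
  -- For `a < m` the whole pairing is cancelled; for `a = m` only its real part, by an imaginary
  -- multiple of `f_m`, since `Re (i q) = -Im q`.
  set r : Fin (k + 2) → ℝ → ℂ := fun a t =>
    if a = Fin.last _ then ((-((N a t).re / (q t).im) : ℝ) : ℂ) * Complex.I else N a t / q t
    with hrdef
  set c : ℝ → Fin (k + 2) → V := fun t a =>
    if a = 0 then c₀ t else f a + t • ξ a - r a t • f (Fin.last _) with hcdef
  have hr0 : ∀ a, r a 0 = 0 := by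
    intro a
    induction a using Fin.lastCases with
    | last => simp [hrdef, hN0, hf2]
    | cast a => simp [hrdef, hN0, hf1, (Fin.castSucc_lt_last a).ne]
  have hr' : ∀ a, HasDerivAt (r a) 0 0 := by
    intro a
    induction a using Fin.lastCases with
    | last =>
      have h1 : HasDerivAt (fun t => (N (Fin.last _) t).re) 0 0 := by
        have := Complex.reCLM.hasFDerivAt.comp_hasDerivAt (0 : ℝ) (hN' (Fin.last (k + 1)))
        exact this.congr_deriv hξ.2
      have h2 := Complex.imCLM.hasFDerivAt.comp_hasDerivAt (0 : ℝ) hq'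
      have h3 := (h1.div h2 (by simpa [hq00] using hq0)).neg.ofReal_comp.mul_const Complex.I
      have h4 : r (Fin.last (k + 1)) = fun t =>
          ((-((N (Fin.last _) t).re / (q t).im) : ℝ) : ℂ) * Complex.I := by
        ext1 t
        simp [hrdef]
      rw [h4]
      refine h3.congr_deriv ?_
      simp [hN0, hf2]
    | cast a =>
      have h1 : HasDerivAt (N a.castSucc) 0 0 := (hN' a.castSucc).congr_deriv (hξ.1 a)
      have h2 := h1.div hq' (by rw [hq00]; intro h0; exact hq0 (by rw [h0]; rfl))
      have h4 : r a.castSucc = fun t => N a.castSucc t / q t := by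
        ext1 t
        simp [hrdef, (Fin.castSucc_lt_last a).ne]
      rw [h4]
      refine h2.congr_deriv ?_
      simp [hN0, hf1]
  have hc00 : c 0 = f := by
    ext a
    by_cases ha : a = 0
    · simp [hcdef, ha, hc0]
    · simp [hcdef, ha, hr0]
  have hc' : HasDerivAt c ξ 0 := by
    refine hasDerivAt_pi.2 fun a => ?_
    by_cases ha : a = 0
    · subst ha
      simpa [hcdef] using hd0
    · have h1 := (hlin a).sub ((hr' a).smul_const (f (Fin.last _)))
      simp only [zero_smul, sub_zero] at h1
      simp only [hcdef, ha, if_false]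
      exact h1
  have hli : ∀ᶠ t in 𝓝 (0 : ℝ), LinearIndependent ℂ (c t) := by
    refine hc'.continuousAt.eventually_mem
      ((isOpen_setOfPred_linearIndependent (𝕜 := ℂ) (E := V) (ι := Fin (k + 2))).mem_nhds ?_)
    show LinearIndependent ℂ (c 0)
    rw [hc00]
    exact f.linearIndependent
  have hqne : ∀ᶠ t in 𝓝 (0 : ℝ), (q t).im ≠ 0 := by
    have := (Complex.continuous_im.continuousAt.comp hq'.continuousAt).eventually_ne
      (show (q 0).im ≠ 0 by rwa [hq00])
    exact this
  obtain ⟨ε, hε, hall⟩ := exists_Ioo_of_eventually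
    ((hli.and hqne).and (Filter.eventually_mem_set.2 (Ioo_mem_nhds_zero hε₀)))
  have hsub : Ioo (-ε) ε ⊆ Ioo (-ε₀) ε₀ := fun t ht => (hall t ht).2
  refine ⟨ε, y, c, ⟨hε, hy0, hc00, hy.mono hsub, ?_, fun t ht => ?_⟩, hc'⟩
  · refine contDiffOn_pi.2 fun a => ?_
    by_cases ha : a = 0
    · simp only [hcdef, ha, if_true]
      exact hcs.mono hsub
    · simp only [hcdef, ha, if_false]
      have hrs : ContDiffOn ℝ ∞ (r a) (Ioo (-ε) ε) := by
        by_cases hal : a = Fin.last _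
        · simp only [hrdef, hal, if_true]
          have h1 : ContDiffOn ℝ ∞ (fun t => (N (Fin.last _) t).re) (Ioo (-ε) ε) :=
            Complex.reCLM.contDiff.comp_contDiffOn ((hNs _).mono hsub)
          have h2 : ContDiffOn ℝ ∞ (fun t => (q t).im) (Ioo (-ε) ε) :=
            Complex.imCLM.contDiff.comp_contDiffOn (hqs.mono hsub)
          exact (Complex.ofRealCLM.contDiff.comp_contDiffOn
            (h1.div h2 fun t ht => (hall t ht).1.2).neg).mul contDiffOn_const
        · simp only [hrdef, hal, if_false, div_eq_mul_inv]
          refine ((hNs a).mono hsub).mul ((hqs.mono hsub).inv fun t ht h0 => ?_)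
          exact (hall t ht).1.2 (by rw [h0]; rfl)
      exact (hlins a).contDiffOn.sub (hrs.smul contDiffOn_const)
  · have hcard : Fintype.card (Fin (k + 2)) = Module.finrank ℂ V :=
      (Module.finrank_eq_card_basis f).symm
    set f' := basisOfLinearIndependentOfCardEqFinrank (hall t ht).1.1 hcard with hf'def
    have hf' : (f' : Fin (k + 2) → V) = c t := coe_basisOfLinearIndependentOfCardEqFinrank _ _
    refine ⟨(y t, f'), ?_, by simp [hf']⟩
    have hct0 : c t 0 = c₀ t := by simp [hcdef]
    have hyt := hyU t (hsub ht)
    have hqt := (hall t ht).1.2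
    rw [h.mem_frameBundle_iff hB hyt, hf', hct0]
    have hcone := hX t (hsub ht)
    refine ⟨hcone, fun a => ?_, ?_⟩
    · by_cases ha : a = 0
      · subst ha
        rw [Fin.castSucc_zero, hct0]
        exact h.apply_grad_self hyt hcone
      · have ha' : a.castSucc ≠ 0 := by simpa using ha
        have hq : q t ≠ 0 := fun h0 => hqt (by rw [h0]; rfl)
        simp only [hcdef, hrdef, ha', (Fin.castSucc_lt_last a).ne, if_false, map_sub, map_smul,
          sub_apply, smul_apply, smul_eq_mul]
        show N _ t - N _ t / q t * q t = 0
        rw [div_mul_cancel₀ _ hq, sub_self]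
    · have hl0 : (Fin.last (k + 1)) ≠ 0 := Fin.last_pos.ne'
      simp only [hcdef, hrdef, hl0, if_false, if_true, map_sub, map_smul, sub_apply, smul_apply,
        smul_eq_mul]
      show (N _ t - _ * _ * q t).re = 0
      rw [mul_assoc, Complex.sub_re, Complex.re_ofReal_mul, Complex.I_mul_re]
      field_simp
      ring

lemma mem_frameTangent_iff [FiniteDimensional ℂ V] (hB : IsDuality B) (h : IsChart B ι U O ρ D)
    (hx : x ∈ U) (hf : (x, f) ∈ frameBundle ι) {ξ : Fin (k + 2) → V} :
    ξ ∈ frameTangent ι x f ↔ IsFrameTangent B D f ξ :=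
  ⟨h.isFrameTangent_of_mem hB hx hf, h.mem_frameTangent_of hB hx hf⟩

end IsChart

end Frames

/-! ### Linear algebra of the block matrix -/

section Algebra

variable {k : ℕ} {P L Q N : Matrix (Fin k) (Fin k) ℂ}

lemma map_conj_of_skew (h : Lᴴ = -L) : L.map conj = -Lᵀ := by
  rw [← Matrix.transpose_neg, ← h]
  rfl

lemma star_mulVec_eq (A : Matrix (Fin k) (Fin k) ℂ) (v : Fin k → ℂ) :
    star (A *ᵥ v) = A.map conj *ᵥ star v := by
  ext i
  exact RingHom.map_mulVec (starRingEnd ℂ) A v i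

lemma form_smul (w : ℂ) (z : Fin k → ℂ) :
    (w • z) ⬝ᵥ (P *ᵥ (w • z) + L *ᵥ star (w • z)) =
      w * w * (z ⬝ᵥ P *ᵥ z) + (Complex.normSq w : ℂ) * (z ⬝ᵥ L *ᵥ star z) := by
  rw [star_smul, Matrix.mulVec_smul, Matrix.mulVec_smul, dotProduct_add, smul_dotProduct,
    smul_dotProduct, dotProduct_smul, dotProduct_smul, Complex.normSq_eq_conj_mul_self]
  simp only [smul_eq_mul, Complex.star_def]
  ring

/-- Replacing `z` by `w z` multiplies the `P` term by `w²` and the `L` term by `|w|²`. Choosing `w²`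
conjugate to `z · P z` makes the `P` term real. -/
lemma im_form_ne_zero (h : ∀ z ≠ 0, (z ⬝ᵥ (P *ᵥ z + L *ᵥ star z)).im ≠ 0) {z : Fin k → ℂ}
    (hz : z ≠ 0) : (z ⬝ᵥ L *ᵥ star z).im ≠ 0 := by
  intro h0
  obtain ⟨w, hw, hw'⟩ : ∃ w : ℂ, w ≠ 0 ∧ (w * w * (z ⬝ᵥ P *ᵥ z)).im = 0 := by
    by_cases ha : z ⬝ᵥ P *ᵥ z = 0
    · exact ⟨1, one_ne_zero, by simp [ha]⟩
    · obtain ⟨w, hw⟩ := IsAlgClosed.exists_eq_mul_self (conj (z ⬝ᵥ P *ᵥ z))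
      refine ⟨w, ?_, ?_⟩
      · rintro rfl
        rw [mul_zero, map_eq_zero] at hw
        exact ha hw
      · rw [← hw, ← Complex.normSq_eq_conj_mul_self, Complex.ofReal_im]
  apply h (w • z) (smul_ne_zero hw hz)
  rw [form_smul, Complex.add_im, hw', Complex.im_ofReal_mul, h0, mul_zero, add_zero]

/-- The hermitian form has no zero on `ℂ^k \ {0}`, which is connected for `k ≥ 1` because its real
dimension is at least `2`; so it has constant sign. -/
lemma isDefiniteForm_of_form_ne_zero
    (h : ∀ z ≠ 0, (z ⬝ᵥ (P *ᵥ z + L *ᵥ star z)).im ≠ 0) : IsDefiniteForm L := by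
  have hF : ∀ z : Fin k → ℂ, (Complex.I * ∑ α, ∑ β, L α β * z α * conj (z β)).re =
      -(z ⬝ᵥ L *ᵥ star z).im := by
    intro z
    rw [Complex.I_mul_re]
    congr 2
    simp only [dotProduct, Matrix.mulVec, Finset.mul_sum]
    refine Finset.sum_congr rfl fun α _ => Finset.sum_congr rfl fun β _ => ?_
    rw [Pi.star_apply, Complex.star_def]
    ring
  simp only [IsDefiniteForm, hF]
  rcases Nat.eq_zero_or_pos k with rfl | hk
  · exact Or.inl fun z hz => absurd (Subsingleton.elim z 0) hz
  have hcont : Continuous fun z : Fin k → ℂ => -(z ⬝ᵥ L *ᵥ star z).im := by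
    refine (Complex.continuous_im.comp ?_).neg
    exact Continuous.dotProduct continuous_id (Continuous.matrix_mulVec continuous_const
      continuous_star)
  have hrank : 1 < Module.rank ℝ (Fin k → ℂ) := by
    have h1 : Module.finrank ℝ (Fin k → ℂ) = 2 * k := by
      rw [finrank_real_of_complex, Module.finrank_fin_fun]
    have := Module.lt_rank_of_lt_finrank (R := ℝ) (M := Fin k → ℂ) (n := 1) (by omega)
    exact_mod_cast this
  have hconn := (isConnected_compl_singleton_of_one_lt_rank hrank (0 : Fin k → ℂ)).isPreconnected
  by_contra! hcon
  obtain ⟨⟨z₁, h1, h1'⟩, z₂, h2, h2'⟩ := hcon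
  obtain ⟨z, hz, hz'⟩ := hconn.intermediate_value (f := fun z : Fin k → ℂ => -(z ⬝ᵥ L *ᵥ star z).im)
    (show z₁ ∈ ({0}ᶜ : Set _) from h1) (show z₂ ∈ ({0}ᶜ : Set _) from h2) hcont.continuousOn
    ⟨h1', h2'⟩
  exact im_form_ne_zero h hz (neg_eq_zero.1 hz')

/-- If `(a, b)` is in the kernel, conjugating the second row shows that `(b̄, ā)` also satisfies the
first. So `a + b̄` and `i (a - b̄)` both solve `P c + L c̄ = 0`, which has only the zero solution.
-/
lemma isUnit_det_block (hL : Lᴴ = -L)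
    (h : ∀ z ≠ 0, (z ⬝ᵥ (P *ᵥ z + L *ᵥ star z)).im ≠ 0) : IsUnit (block P L).det := by
  rw [isUnit_iff_ne_zero]
  intro h0
  obtain ⟨v, hv, hv'⟩ := Matrix.exists_mulVec_eq_zero_iff.2 h0
  obtain ⟨a, b, rfl⟩ : ∃ a b : Fin k → ℂ, v = Sum.elim a b :=
    ⟨v ∘ Sum.inl, v ∘ Sum.inr, (Sum.elim_comp_inl_inr v).symm⟩
  rw [block, Matrix.fromBlocks_mulVec, Sum.elim_comp_inl, Sum.elim_comp_inr] at hv'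
  have h1 : P *ᵥ a + L *ᵥ b = 0 := by
    have := congrArg (fun u => u ∘ Sum.inl) hv'
    simpa using this
  have h2 : Lᵀ *ᵥ a + (-P.map conj) *ᵥ b = 0 := by
    have := congrArg (fun u => u ∘ Sum.inr) hv'
    simpa using this
  have h3 : P *ᵥ star b + L *ᵥ star a = 0 := by
    have h4 := congrArg star h2
    rw [star_add, Matrix.neg_mulVec, star_neg, star_mulVec_eq, star_mulVec_eq, star_zero] at h4
    have h5 : Lᵀ.map conj = -L := hL
    have h6 : (P.map conj).map conj = P := by ext; simp
    rw [h5, h6, Matrix.neg_mulVec] at h4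
    rw [← neg_eq_zero, neg_add, add_comm]
    exact h4
  have hzero : ∀ c : Fin k → ℂ, P *ᵥ c + L *ᵥ star c = 0 → c = 0 := by
    intro c hc
    by_contra hne
    exact h c hne (by rw [hc]; simp)
  have h4 := hzero (a + star b) (by
    rw [star_add, star_star, Matrix.mulVec_add, Matrix.mulVec_add]
    calc _ = (P *ᵥ a + L *ᵥ b) + (P *ᵥ star b + L *ᵥ star a) := by abel
      _ = 0 := by rw [h1, h3, add_zero])
  have h5 := hzero (Complex.I • (a - star b)) (by
    rw [star_smul, star_sub, star_star, Matrix.mulVec_smul, Matrix.mulVec_smul, Matrix.mulVec_sub,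
      Matrix.mulVec_sub, Complex.star_def, Complex.conj_I]
    calc _ = Complex.I • (P *ᵥ a + L *ᵥ b) - Complex.I • (P *ᵥ star b + L *ᵥ star a) := by module
      _ = 0 := by rw [h1, h3, smul_zero, sub_zero])
  rw [smul_eq_zero, or_iff_right Complex.I_ne_zero, sub_eq_zero] at h5
  rw [← h5, ← two_smul ℂ, smul_eq_zero, or_iff_right two_ne_zero] at h4
  subst h4
  rw [eq_comm, star_eq_zero] at h5
  subst h5
  exact hv (by ext (i | i) <;> rfl)

lemma block_transpose (hP : Pᵀ = P) : (block P L)ᵀ = block P L := by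
  rw [block, Matrix.fromBlocks_transpose, hP, Matrix.transpose_transpose, Matrix.transpose_neg,
    ← Matrix.transpose_map, hP]

/-- The inverse of a block matrix of the type `[[P, L], [Lᵀ, -P̄]]` is of the same type. -/
lemma exists_block_inverse (hP : Pᵀ = P) (hL : Lᴴ = -L) (h : IsUnit (block P L).det) :
    ∃ Q N : Matrix (Fin k) (Fin k) ℂ, Qᵀ = Q ∧ Nᴴ = -N ∧ block P L * block Q N = 1 := by
  set X := (block P L)⁻¹ with hX
  have hBX : block P L * X = 1 := Matrix.mul_nonsing_inv _ h
  have hXt : Xᵀ = X := by rw [hX, Matrix.transpose_nonsing_inv, block_transpose hP]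
  set J : Matrix (Fin k ⊕ Fin k) (Fin k ⊕ Fin k) ℂ := Matrix.fromBlocks 0 1 1 0 with hJ
  have hJJ : J * J = 1 := by
    rw [hJ, Matrix.fromBlocks_multiply]
    simp
  -- Conjugating the entries and exchanging the two blocks changes the sign of the matrix. This
  -- property and symmetry express the block type, and the inverse inherits both.
  have hconj : block P L * J = -(J * (block P L).map conj) := by
    have h5 : Lᵀ.map conj = -L := hL
    have h6 : (-P.map conj).map conj = -P := by ext; simp
    rw [block, hJ, Matrix.fromBlocks_map, Matrix.fromBlocks_multiply, Matrix.fromBlocks_multiply,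
      Matrix.fromBlocks_neg, h5, h6, map_conj_of_skew hL]
    simp
  have hY : block P L * -(J * X.map conj * J) = 1 := by
    have h1 : (block P L).map conj * X.map conj = 1 := by
      rw [← Matrix.map_mul, hBX, Matrix.map_one _ (map_zero _) (map_one _)]
    calc block P L * -(J * X.map conj * J) = -(block P L * J) * X.map conj * J := by
          simp only [Matrix.mul_neg, Matrix.neg_mul, Matrix.mul_assoc]
      _ = J * ((block P L).map conj * X.map conj) * J := by
          rw [hconj, neg_neg]
          simp only [Matrix.mul_assoc]
      _ = 1 := by rw [h1, Matrix.mul_one, hJJ]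
  have hXY : X = -(J * X.map conj * J) := Matrix.inv_eq_right_inv hY
  obtain ⟨X₁, X₂, X₃, X₄, hXb⟩ : ∃ X₁ X₂ X₃ X₄, X = Matrix.fromBlocks X₁ X₂ X₃ X₄ :=
    ⟨_, _, _, _, (Matrix.fromBlocks_toBlocks X).symm⟩
  rw [hXb, Matrix.fromBlocks_transpose, Matrix.fromBlocks_inj] at hXt
  rw [hXb, hJ, Matrix.fromBlocks_map, Matrix.fromBlocks_multiply, Matrix.fromBlocks_multiply,
    Matrix.fromBlocks_neg, Matrix.fromBlocks_inj] at hXY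
  simp only [zero_mul, one_mul, mul_zero, mul_one, zero_add, add_zero] at hXY
  refine ⟨X₁, X₂, hXt.1, ?_, ?_⟩
  · have h1 : X₂ = -(X₂ᵀ).map conj := by rw [hXt.2.2.1]; exact hXY.2.1
    exact neg_eq_iff_eq_neg.1 h1.symm
  · rw [← hBX, hXb, block, block, ← hXt.2.2.1, ← hXY.2.2.2]

/-- The structure equation `Ω = P η + L η̄ + θ p` solved for `η`. -/
lemma dual_structure_eq (hL : Lᴴ = -L) (hX : block P L * block Q N = 1)
    {η Ω p : Fin k → ℂ} {θ : ℂ} (h : Ω = P *ᵥ η + L *ᵥ star η + θ • p) :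
    η = Q *ᵥ (Ω - θ • p) - N *ᵥ star (Ω - θ • p) := by
  have hX' := mul_eq_one_comm.1 hX
  rw [block, block, Matrix.fromBlocks_multiply, ← Matrix.fromBlocks_one,
    Matrix.fromBlocks_inj] at hX'
  obtain ⟨h1, h2, -, -⟩ := hX'
  have h3 : Ω - θ • p = P *ᵥ η + L *ᵥ star η := by rw [h]; abel
  rw [h3, star_add, star_mulVec_eq, star_mulVec_eq, star_star, map_conj_of_skew hL]
  simp only [Matrix.mulVec_add, Matrix.mulVec_mulVec, Matrix.neg_mulVec, Matrix.mulVec_neg]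
  calc η = (Q * P + N * Lᵀ) *ᵥ η + (Q * L + N * -P.map conj) *ᵥ star η := by
        rw [h1, h2, Matrix.one_mulVec, Matrix.zero_mulVec, add_zero]
    _ = _ := by
        simp only [Matrix.add_mulVec, Matrix.mul_neg, Matrix.neg_mulVec]
        abel

/-- Symmetry of `Q` and skewness of `N` move them across the dot product: `(Q p) · Ω = p · Q Ω` and
`(N p̄) · Ω = -conj (p · N Ω̄)`. This makes `N p̄ - Q p` fit the second structure equation of the
dual. -/
lemma dual_structure_dot (hQ : Qᵀ = Q) (hN : Nᴴ = -N) {η Ω p : Fin k → ℂ}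
    (h : η = Q *ᵥ Ω - N *ᵥ star Ω) :
    (N *ᵥ star p - Q *ᵥ p) ⬝ᵥ Ω - conj ((N *ᵥ star p - Q *ᵥ p) ⬝ᵥ Ω) =
      -(p ⬝ᵥ η) + conj (p ⬝ᵥ η) := by
  have h1 : (Q *ᵥ p) ⬝ᵥ Ω = p ⬝ᵥ Q *ᵥ Ω := by
    rw [dotProduct_comm, Matrix.dotProduct_mulVec, ← Matrix.mulVec_transpose, hQ, dotProduct_comm]
  have h2 : (N *ᵥ star p) ⬝ᵥ Ω = -conj (p ⬝ᵥ N *ᵥ star Ω) := by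
    have h3 : conj (p ⬝ᵥ N *ᵥ star Ω) = star p ⬝ᵥ star (N *ᵥ star Ω) := by
      simp only [dotProduct, map_sum, map_mul]
      rfl
    rw [h3, star_mulVec_eq, star_star, map_conj_of_skew hN, Matrix.neg_mulVec, dotProduct_neg,
      neg_neg, dotProduct_comm, Matrix.dotProduct_mulVec, ← Matrix.mulVec_transpose,
      dotProduct_comm]
  rw [sub_dotProduct, h1, h2, h, dotProduct_sub]
  simp only [map_sub, map_neg, Complex.conj_conj]
  ring

end Algebra

/-! ### Second order coefficients and their behaviour under duality -/

section SecondOrder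

variable {V : Type*} [NormedAddCommGroup V] [NormedSpace ℂ V]
variable {V' : Type*} [NormedAddCommGroup V'] [NormedSpace ℂ V']
variable {M : Type*} [TopologicalSpace M] {k : ℕ}
variable {B : V →L[ℂ] V' →L[ℂ] ℂ} {ι : M → ℙ ℂ V} {γ : M → ℙ ℂ V'} {U : Set M}
  {O : Set V} {O' : Set V'} {ρ : V → ℝ} {ρ' : V' → ℝ} {D : V → V'} {E : V' → V} {x : M} {w : V}
  {f : Module.Basis (Fin (k + 2)) ℂ V} {g : Module.Basis (Fin (k + 2)) ℂ V'}

lemma sum_univ_mid {A : Type*} [AddCommMonoid A] (F : Fin (k + 2) → A) :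
    ∑ a, F a = F 0 + (∑ α, F (mid α) + F (Fin.last (k + 1))) := by
  rw [Fin.sum_univ_succ, Fin.sum_univ_castSucc]
  rfl

lemma mid_eq_castSucc (α : Fin k) : mid α = α.succ.castSucc := rfl

lemma mid_ne_zero (α : Fin k) : mid α ≠ 0 := Fin.succ_ne_zero _

lemma mid_ne_last (α : Fin k) : mid α ≠ Fin.last (k + 1) := (Fin.castSucc_lt_last α.succ).ne

lemma mid_injective : Function.Injective (mid : Fin k → Fin (k + 2)) :=
  (Fin.succ_injective _).comp (Fin.castSucc_injective _)

lemma im_apply_eq (u : V) (l : V') : (B u l).im = -(B (Complex.I • u) l).re := by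
  simp

/-- The splitting of `T` into complex-linear and conjugate-linear parts; applied to the Hessian
these give `P` and `L`. -/
lemma realLinear_smul (T : V →L[ℝ] ℂ) (z : ℂ) (v : V) :
    T (z • v) = (T v - Complex.I * T (Complex.I • v)) / 2 * z +
      (T v + Complex.I * T (Complex.I • v)) / 2 * conj z := by
  rw [complex_smul_eq, map_add, map_smul, map_smul, Complex.real_smul, Complex.real_smul,
    Complex.re_eq_add_conj, Complex.im_eq_sub_conj]
  field_simp
  linear_combination ((z - conj z) * T (Complex.I • v)) * Complex.I_sq

namespace IsChart

lemma exists_frame_scalar [FiniteDimensional ℂ V] (hB : IsDuality B) (h : IsChart B ι U O ρ D)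
    (hx : x ∈ U) (hf : (x, f) ∈ frameBundle ι) :
    ∃ s : ℝ, s ≠ 0 ∧ ∀ v, B v (D (f 0)) = f.repr v (Fin.last _) * (Complex.I * s) := by
  obtain ⟨hfc, hf1, hf2⟩ := (h.mem_frameBundle_iff hB hx).1 hf
  have h0 := h.apply_grad_last_ne_zero hB hx hfc hf1
  have h1 : B (f (Fin.last _)) (D (f 0)) =
      Complex.I * ((B (f (Fin.last _)) (D (f 0))).im : ℂ) := by
    apply Complex.ext <;> simp [hf2]
  refine ⟨(B (f (Fin.last _)) (D (f 0))).im, fun h2 => h0 (Complex.ext hf2 h2), fun v => ?_⟩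
  rw [← h1, apply_grad_eq hf1]

/-- Tangency at `a = 0` forces `Re B(ξ_0, D f_0) = 0`, and `B(·, D f_0)` is `i s` times the last
coordinate. -/
lemma mc_last_zero_im {s : ℝ} (hs : s ≠ 0) (h : IsChart B ι U O ρ D) (hO : f 0 ∈ O)
    (hsf : ∀ v, B v (D (f 0)) = f.repr v (Fin.last _) * (Complex.I * s))
    {ξ : Fin (k + 2) → V} (hξ : IsFrameTangent B D f ξ) : (mc f (Fin.last _) 0 ξ).im = 0 := by
  have h1 := congrArg Complex.re (hξ.1 0)
  have h2 := h.fderiv_grad_smul_self hO 1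
  rw [one_smul, map_one, one_smul] at h2
  rw [Fin.castSucc_zero, Complex.add_re, h.hess_symm hO, h2, Complex.zero_re, ← two_mul, hsf] at h1
  have h3 : (f.repr (ξ 0) (Fin.last _)).im = 0 := by simpa [hs] using h1
  exact h3

/-- The complex bilinear part of the real Hessian; its symmetry is that of `P`. -/
lemma fderiv_pairing_symm (h : IsChart B ι U O ρ D) (hw : w ∈ O) (u v : V) :
    B u (fderiv ℝ D w v) - Complex.I * B u (fderiv ℝ D w (Complex.I • v)) =
      B v (fderiv ℝ D w u) - Complex.I * B v (fderiv ℝ D w (Complex.I • u)) := by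
  apply Complex.ext
  · simp only [Complex.sub_re, Complex.I_mul_re, im_apply_eq, h.hess_symm hw u v,
      h.hess_symm hw (Complex.I • u) (Complex.I • v)]
  · simp only [Complex.sub_im, Complex.I_mul_im, im_apply_eq, h.hess_symm hw (Complex.I • u) v,
      h.hess_symm hw u (Complex.I • v)]
    ring

/-- The sesquilinear part of the Hessian is hermitian; the factor `i / s` turns this into skewness
of `L`. -/
lemma fderiv_pairing_conj (h : IsChart B ι U O ρ D) (hw : w ∈ O) (u v : V) :
    B u (fderiv ℝ D w v) + Complex.I * B u (fderiv ℝ D w (Complex.I • v)) =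
      conj (B v (fderiv ℝ D w u) + Complex.I * B v (fderiv ℝ D w (Complex.I • u))) := by
  apply Complex.ext
  · simp only [Complex.add_re, Complex.I_mul_re, im_apply_eq, Complex.conj_re, h.hess_symm hw u v,
      h.hess_symm hw (Complex.I • u) (Complex.I • v)]
  · simp only [Complex.add_im, Complex.I_mul_im, im_apply_eq, Complex.conj_im,
      h.hess_symm hw (Complex.I • u) v, h.hess_symm hw u (Complex.I • v)]
    ring

lemma exists_secondOrderCoeffs [FiniteDimensional ℂ V] (hB : IsDuality B)
    (h : IsChart B ι U O ρ D) (hx : x ∈ U) (hf : (x, f) ∈ frameBundle ι) :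
    ∃ P L p r, IsSecondOrderCoeffs ι x f P L p r := by
  obtain ⟨hfc, hf1, hf2⟩ := (h.mem_frameBundle_iff hB hx).1 hf
  have hO := h.mem_of_cone x hx _ hfc
  obtain ⟨s, hs, hsf⟩ := h.exists_frame_scalar hB hx hf
  have hsC : (s : ℂ) ≠ 0 := by exact_mod_cast hs
  set T : V → V →L[ℝ] ℂ := fun u => ((B u).restrictScalars ℝ).comp (fderiv ℝ D (f 0)) with hT
  have hTap : ∀ u v, T u v = B u (fderiv ℝ D (f 0) v) := fun u v => rfl
  have hT0 : ∀ u z, T u (z • f 0) = conj z * B u (D (f 0)) := fun u z => by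
    rw [hTap, h.fderiv_grad_smul_self hO, map_smul, smul_eq_mul]
  have hexp : ∀ ξ : Fin (k + 2) → V, ξ 0 = mc f 0 0 ξ • f 0 +
      (∑ β, mc f (mid β) 0 ξ • f (mid β) + mc f (Fin.last _) 0 ξ • f (Fin.last _)) := by
    intro ξ
    conv_lhs => rw [← f.sum_repr (ξ 0), sum_univ_mid]
    rfl
  have hreal : ∀ ξ, IsFrameTangent B D f ξ →
      mc f (Fin.last _) 0 ξ = ((mc f (Fin.last _) 0 ξ).re : ℂ) := fun ξ hξ =>
    Complex.ext rfl (h.mc_last_zero_im hs hO hsf hξ)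
  -- Tangency gives `Ω^m_α = (i / s) T(f_α)(ξ_0)`. Expanding `ξ_0` in the frame yields these
  -- coefficients; the `f_0` component drops out because `dD (z f_0) = z̄ D f_0` pairs to zero with
  -- `f_α`.
  refine ⟨Matrix.of fun α β => Complex.I / s * ((T (f (mid α)) (f (mid β)) -
      Complex.I * T (f (mid α)) (Complex.I • f (mid β))) / 2),
    Matrix.of fun α β => Complex.I / s * ((T (f (mid α)) (f (mid β)) +
      Complex.I * T (f (mid α)) (Complex.I • f (mid β))) / 2),
    fun α => Complex.I / s * T (f (mid α)) (f (Fin.last _)),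
    -2 * Complex.I * (((T (f (Fin.last _)) (f (Fin.last _))).re / s : ℝ) : ℂ), hf, ?_, ?_, ?_, ?_,
    ?_⟩
  · ext α β
    simp only [Matrix.transpose_apply, Matrix.of_apply, hTap]
    rw [h.fderiv_pairing_symm hO]
  · ext α β
    simp only [Matrix.conjTranspose_apply, Matrix.of_apply, hTap, Matrix.neg_apply]
    rw [h.fderiv_pairing_conj hO, star_mul', Complex.star_def]
    simp only [map_div₀, Complex.conj_conj, Complex.conj_I, Complex.conj_ofReal, map_ofNat]
    ring
  · simp only [map_mul, map_neg, Complex.conj_I, Complex.conj_ofReal, map_ofNat]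
    ring
  · intro ξ hξ α
    rw [h.mem_frameTangent_iff hB hx hf] at hξ
    have h1 := hξ.1 α.succ
    rw [← mid_eq_castSucc, hsf] at h1
    have h2 : T (f (mid α)) (ξ 0) = ∑ β, T (f (mid α)) (mc f (mid β) 0 ξ • f (mid β)) +
        mc f (Fin.last _) 0 ξ * T (f (mid α)) (f (Fin.last _)) := by
      conv_lhs => rw [hexp ξ]
      rw [map_add, hT0, mid_eq_castSucc, hf1, mul_zero, zero_add, map_add, map_sum]
      congr 1
      rw [hreal ξ hξ, Complex.coe_smul, map_smul]
      rfl
    have h3 : mc f (Fin.last _) (mid α) ξ = Complex.I / s * T (f (mid α)) (ξ 0) := by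
      have h4 : T (f (mid α)) (ξ 0) = -(mc f (Fin.last _) (mid α) ξ * (Complex.I * s)) :=
        eq_neg_of_add_eq_zero_left h1
      rw [h4]
      field_simp
      rw [Complex.I_sq]
      ring
    rw [h3, h2, mul_add, Finset.mul_sum, ← Finset.sum_add_distrib]
    congr 1
    · refine Finset.sum_congr rfl fun β _ => ?_
      rw [realLinear_smul]
      simp only [Matrix.of_apply]
      ring
    · ring
  · intro ξ hξ
    rw [h.mem_frameTangent_iff hB hx hf] at hξ
    set p : Fin k → ℂ := fun α => Complex.I / s * T (f (mid α)) (f (Fin.last _)) with hp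
    have hTp : ∀ α, T (f (mid α)) (f (Fin.last _)) = -(Complex.I * s) * p α := by
      intro α
      simp only [hp]
      field_simp
      rw [Complex.I_sq]
      ring
    set θ := mc f (Fin.last _) 0 ξ with hθ
    set H := (T (f (Fin.last _)) (f (Fin.last _))).re with hH
    -- The last tangency equation fixes only `Im Ω^m_m`. That suffices: the left side of the second
    -- structure equation is `2i (Im Ω^0_0 - Im Ω^m_m)`.
    have h1 : s * (mc f (Fin.last _) (Fin.last _) ξ).im = (B (ξ 0) (fderiv ℝ D (f 0)
        (f (Fin.last _)))).re := by
      have h2 := hξ.2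
      rw [hsf, Complex.add_re, h.hess_symm hO] at h2
      have h3 : (mc f (Fin.last _) (Fin.last _) ξ * (Complex.I * s)).re =
          -(s * (mc f (Fin.last _) (Fin.last _) ξ).im) := by
        simp
        ring
      have h4 : (B (ξ 0) (fderiv ℝ D (f 0) (f (Fin.last _)))).re +
        (mc f (Fin.last _) (Fin.last _) ξ * (Complex.I * s)).re = 0 := h2
      linarith
    have h2 : (B (mc f 0 0 ξ • f 0) (fderiv ℝ D (f 0) (f (Fin.last _)))).re =
        s * (mc f 0 0 ξ).im := by
      rw [h.hess_symm hO, h.fderiv_grad_smul_self hO, map_smul, hsf, f.repr_self]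
      simp
      ring
    have h3 : s * (mc f (Fin.last _) (Fin.last _) ξ).im =
        s * (mc f 0 0 ξ).im + (s * (∑ α, p α * mc f (mid α) 0 ξ).im + θ.re * H) := by
      rw [h1]
      conv_lhs => rw [hexp ξ]
      rw [map_add, add_apply, Complex.add_re, h2, map_add, add_apply, Complex.add_re, map_sum,
        sum_apply]
      congr 2
      · rw [← Complex.im_ofReal_mul, ← neg_inj, ← Complex.I_mul_re, ← Complex.neg_re,
          Finset.mul_sum, Finset.mul_sum, ← Finset.sum_neg_distrib, Complex.re_sum, Complex.re_sum]
        refine Finset.sum_congr rfl fun α _ => ?_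
        rw [map_smul, smul_apply, ← hTap, hTp, smul_eq_mul]
        congr 1
        ring
      · rw [hreal ξ hξ, map_smul, smul_apply, smul_eq_mul, Complex.re_ofReal_mul]
        rfl
    set S := ∑ α, p α * mc f (mid α) 0 ξ with hS
    have h4 : (mc f (Fin.last _) (Fin.last _) ξ).im =
        (mc f 0 0 ξ).im + (S.im + θ.re * (H / s)) := by
      field_simp
      linarith
    have h5 : ∑ α, conj (p α) * conj (mc f (mid α) 0 ξ) = conj S := by
      rw [hS, map_sum]
      simp only [map_mul]
    have h6 : θ.im = 0 := h.mc_last_zero_im hs hO hsf hξ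
    rw [h5]
    change mc f 0 0 ξ + conj (mc f (Fin.last _) (Fin.last _) ξ) -
      (conj (mc f 0 0 ξ) + mc f (Fin.last _) (Fin.last _) ξ) =
        -S + conj S + -2 * Complex.I * ((H / s : ℝ) : ℂ) * θ
    clear_value S θ H
    apply Complex.ext
    · simp [h6]
    · simp [h4]
      ring

/-- For `u = ∑ z^α f_α` one has `B(u, dD u) = -i s z · (P z + L z̄)`. If its real part vanishes, the
absence of contact puts `u` in `ℂ f_0`, so `z = 0`. -/
lemma form_ne_zero [FiniteDimensional ℂ V] (hB : IsDuality B)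
    (h : IsChart B ι U O ρ D) (hN : NoContact ι) (hx : x ∈ U) {P L : Matrix (Fin k) (Fin k) ℂ}
    {p : Fin k → ℂ} {r : ℂ} (hc : IsSecondOrderCoeffs ι x f P L p r) {z : Fin k → ℂ}
    (hz : z ≠ 0) : (z ⬝ᵥ (P *ᵥ z + L *ᵥ star z)).im ≠ 0 := by
  intro h0
  obtain ⟨hfc, hf1, hf2⟩ := (h.mem_frameBundle_iff hB hx).1 hc.mem
  have hO := h.mem_of_cone x hx _ hfc
  obtain ⟨s, hs, hsf⟩ := h.exists_frame_scalar hB hx hc.mem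
  have hsC : (s : ℂ) ≠ 0 := by exact_mod_cast hs
  have hIs : Complex.I * (s : ℂ) ≠ 0 := mul_ne_zero Complex.I_ne_zero hsC
  set u : V := ∑ α, z α • f (mid α) with hu
  have hmid : ∀ α, f.repr u (mid α) = z α := by
    intro α
    simp [hu, Finsupp.single_apply, mid_injective.eq_iff]
  have hlast : f.repr u (Fin.last _) = 0 := by
    simp [hu, mid_ne_last]
  have huD : B u (D (f 0)) = 0 := by rw [hsf, hlast, zero_mul]
  set q : Fin (k + 2) → ℂ := fun a => B (f a) (fderiv ℝ D (f 0) u) with hq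
  have hq0 : q 0 = 0 := by
    refine eq_zero_of_re_mul_eq_zero fun c => ?_
    have h1 := h.hess_symm hO (c • f 0) u
    rw [h.fderiv_grad_smul_self hO] at h1
    simp only [map_smul, smul_apply, huD, smul_zero, Complex.zero_re] at h1
    exact h1
  -- A tangent vector of the frame bundle over `u`: the multiples of `f_m` are chosen to cancel the
  -- Hessian terms.
  set ξ : Fin (k + 2) → V := fun a =>
    if a = 0 then u else -(q a / (Complex.I * s)) • f (Fin.last _) with hξ
  have hξ0 : ξ 0 = u := by simp [hξ]
  have hξa : ∀ a, a ≠ 0 → B (ξ a) (D (f 0)) = -q a := by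
    intro a ha
    rw [hsf]
    simp only [hξ, ha, if_false, map_smul, f.repr_self]
    simp only [Finsupp.smul_apply, Finsupp.single_eq_same, smul_eq_mul, mul_one]
    rw [neg_mul, div_mul_cancel₀ _ hIs]
  have hT : IsFrameTangent B D f ξ := by
    constructor
    · intro a
      rw [hξ0]
      by_cases ha : a = 0
      · subst ha
        rw [Fin.castSucc_zero, hξ0, huD, add_zero]
        exact hq0
      · rw [hξa _ (by simpa using ha)]
        exact add_neg_cancel (q a.castSucc)
    · rw [hξ0, hξa _ Fin.last_pos.ne']
      have : q (Fin.last _) + -q (Fin.last _) = 0 := add_neg_cancel _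
      exact congrArg Complex.re this
  have hmem := (h.mem_frameTangent_iff hB hx hc.mem).2 hT
  have hqm : ∀ α, q (mid α) = -(Complex.I * s) * (P *ᵥ z + L *ᵥ star z) α := by
    intro α
    have h1 := hc.eq_alpha ξ hmem α
    have h2 : mc f (Fin.last _) 0 ξ = 0 := by rw [mc, hξ0, hlast]
    have h3 : ∀ β, mc f (mid β) 0 ξ = z β := fun β => by rw [mc, hξ0, hmid]
    have h4 := hξa (mid α) (mid_ne_zero α)
    rw [hsf] at h4
    have h5 : mc f (Fin.last _) (mid α) ξ * (Complex.I * s) = -q (mid α) := h4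
    rw [h1, h2, mul_zero, add_zero] at h5
    simp only [h3] at h5
    have h6 : (P *ᵥ z + L *ᵥ star z) α = ∑ β, P α β * z β + ∑ β, L α β * conj (z β) := rfl
    rw [h6, neg_mul, mul_comm, h5, neg_neg]
  have hBu : (B u (fderiv ℝ D (f 0) u)).re = 0 := by
    have h1 : B u (fderiv ℝ D (f 0) u) =
        -(Complex.I * s) * (z ⬝ᵥ (P *ᵥ z + L *ᵥ star z)) := by
      conv_lhs => rw [hu, map_sum, sum_apply]
      rw [dotProduct, Finset.mul_sum]
      refine Finset.sum_congr rfl fun α _ => ?_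
      rw [map_smul, smul_apply, smul_eq_mul]
      have : B (f (mid α)) (fderiv ℝ D (f 0) u) = q (mid α) := rfl
      rw [← hu, this, hqm]
      ring
    rw [h1, neg_mul, mul_assoc, Complex.neg_re, Complex.I_mul_re, Complex.im_ofReal_mul, h0]
    simp
  obtain ⟨c, hcu⟩ := h.exists_smul_eq_of_hess_eq_zero hB hN hx hfc huD hBu
  apply hz
  ext α
  rw [← hmid α, ← hcu]
  simp [(mid_ne_zero α).symm]

end IsChart

/-- The frames `f` and `g` of dual spaces are related by `g = Γ(f)`. -/
def IsDualFrame (B : V →L[ℂ] V' →L[ℂ] ℂ) (f : Module.Basis (Fin (k + 2)) ℂ V)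
    (g : Module.Basis (Fin (k + 2)) ℂ V') : Prop :=
  ∀ a b, B (f a) (g b) = if a = Equiv.swap 0 (Fin.last (k + 1)) b then 1 else 0

lemma swap_swap_apply {A : Type*} [DecidableEq A] (a b c : A) :
    Equiv.swap a b (Equiv.swap a b c) = c :=
  DFunLike.congr_fun (Equiv.swap_swap a b) c

lemma IsDualFrame.symm (h : IsDualFrame B f g) : IsDualFrame B.flip g f := by
  intro a b
  rw [ContinuousLinearMap.flip_apply, h b a]
  congr 1
  rw [eq_iff_iff]
  constructor <;> rintro rfl <;> rw [swap_swap_apply]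

lemma IsDualFrame.apply_eq (h : IsDualFrame B f g) (v : V) (b : Fin (k + 2)) :
    B v (g b) = f.repr v (Equiv.swap 0 (Fin.last (k + 1)) b) := by
  conv_lhs => rw [← f.sum_repr v, map_sum, sum_apply]
  simp only [map_smul, smul_apply, h _ b]
  simp

lemma swap_mid (α : Fin k) : Equiv.swap 0 (Fin.last (k + 1)) (mid α) = mid α :=
  Equiv.swap_apply_of_ne_of_ne (mid_ne_zero α) (mid_ne_last α)

/-- In an adapted frame `f` the complex gradient at `f_0` is an imaginary multiple of `f^m`. -/
lemma IsChart.exists_grad_eq_smul [FiniteDimensional ℂ V] (hB : IsDuality B)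
    (h : IsChart B ι U O ρ D) (hx : x ∈ U) (hfg : IsDualFrame B f g)
    (hf : (x, f) ∈ frameBundle ι) : ∃ s : ℝ, s ≠ 0 ∧ D (f 0) = (Complex.I * s) • g 0 := by
  obtain ⟨s, hs, hsf⟩ := h.exists_frame_scalar hB hx hf
  refine ⟨s, hs, ?_⟩
  rw [← sub_eq_zero]
  refine hB.right _ fun v => ?_
  rw [map_sub, hsf, map_smul, hfg.apply_eq, Equiv.swap_apply_left, smul_eq_mul, mul_comm,
    sub_self]

namespace IsDualPair

/-- The base vectors of corresponding frames are related by the complex gradients. -/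
lemma exists_scalar [FiniteDimensional ℂ V] (hB : IsDuality B)
    (h : IsDualPair B ι γ U O O' ρ ρ' D E) (hx : x ∈ U) (hfg : IsDualFrame B f g)
    (hf : (x, f) ∈ frameBundle ι) :
    ∃ s : ℝ, s ≠ 0 ∧ D (f 0) = (Complex.I * s) • g 0 ∧ E (g 0) = (Complex.I * (s : ℂ)⁻¹) • f 0 := by
  obtain ⟨s, hs, hD⟩ := h.chart.exists_grad_eq_smul hB hx hfg hf
  have hIs : Complex.I * (s : ℂ) ≠ 0 := mul_ne_zero Complex.I_ne_zero (by exact_mod_cast hs)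
  have hO := h.chart.mem_of_cone x hx _ hf.1
  refine ⟨s, hs, hD, ?_⟩
  have h1 : g 0 = (Complex.I * s)⁻¹ • D (f 0) := by
    rw [hD, smul_smul, inv_mul_cancel₀ hIs, one_smul]
  rw [h1, h.dual.grad_smul _ (h.grad_mem _ hO) _ (inv_ne_zero hIs), h.left_inv _ hO]
  congr 1
  simp [mul_comm]

lemma mem_frameBundle [FiniteDimensional ℂ V] [FiniteDimensional ℂ V'] (hB : IsDuality B)
    (h : IsDualPair B ι γ U O O' ρ ρ' D E) (hx : x ∈ U) (hfg : IsDualFrame B f g)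
    (hf : (x, f) ∈ frameBundle ι) : (x, g) ∈ frameBundle γ := by
  obtain ⟨s, hs, hD, hE⟩ := h.exists_scalar hB hx hfg hf
  have hIs : Complex.I * (s : ℂ) ≠ 0 := mul_ne_zero Complex.I_ne_zero (by exact_mod_cast hs)
  refine (h.dual.mem_frameBundle_iff hB.flip hx).2 ⟨?_, fun a => ?_, ?_⟩
  · have h1 := smul_mem_cone (h.cone_grad x hx _ hf.1) (inv_ne_zero hIs)
    rwa [hD, smul_smul, inv_mul_cancel₀ hIs, one_smul] at h1
  · rw [hE, map_smul, hfg.symm a.castSucc 0, if_neg, smul_zero]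
    rw [Equiv.swap_apply_left]
    exact (Fin.castSucc_lt_last a).ne
  · rw [hE, map_smul, hfg.symm (Fin.last _) 0, if_pos (Equiv.swap_apply_left _ _).symm, smul_eq_mul,
      mul_one, ← Complex.ofReal_inv, mul_comm, Complex.re_ofReal_mul, Complex.I_re, mul_zero]

/-- Every tangent vector at `g = Γ(f)` is the image of a tangent vector at `f`, and the
Maurer-Cartan forms are related by `Ω^b_a(g) = -Ω^{σ a}_{σ b}(f)`. -/
lemma exists_frameTangent [FiniteDimensional ℂ V] [FiniteDimensional ℂ V'] (hB : IsDuality B)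
    (h : IsDualPair B ι γ U O O' ρ ρ' D E) (hx : x ∈ U) (hfg : IsDualFrame B f g)
    (hf : (x, f) ∈ frameBundle ι) {η : Fin (k + 2) → V'} (hη : η ∈ frameTangent γ x g) :
    ∃ ξ ∈ frameTangent ι x f, ∀ a b, mc g b a η =
      -mc f (Equiv.swap 0 (Fin.last (k + 1)) a) (Equiv.swap 0 (Fin.last (k + 1)) b) ξ := by
  obtain ⟨s, hs, hD, hE⟩ := h.exists_scalar hB hx hfg hf
  have hsC : (s : ℂ) ≠ 0 := by exact_mod_cast hs
  have hO := h.chart.mem_of_cone x hx _ hf.1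
  rw [h.dual.mem_frameTangent_iff hB.flip hx (h.mem_frameBundle hB hx hfg hf)] at hη
  set σ := Equiv.swap 0 (Fin.last (k + 1)) with hσ
  have hσσ : ∀ a, σ (σ a) = a := fun a => swap_swap_apply _ _ _
  -- Differentiating the constant pairings `B (f a) (g b)` forces this choice, as `hpair` shows.
  set ξ : Fin (k + 2) → V := fun a => ∑ b, (-g.repr (η (σ b)) (σ a)) • f b with hξ
  have hmc : ∀ a b, f.repr (ξ a) b = -g.repr (η (σ b)) (σ a) := by
    intro a b
    simp only [hξ]
    rw [f.repr_sum_self]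
  have hpair : ∀ a b, B (ξ a) (g b) = -B (f a) (η b) := by
    intro a b
    rw [hfg.apply_eq, hmc, ← ContinuousLinearMap.flip_apply B, hfg.symm.apply_eq]
    rw [← hσ, hσσ]
  have hf0g : ∀ a, B (f 0) (g a) = if a = Fin.last _ then 1 else 0 := by
    intro a
    have := hfg.symm a 0
    rwa [Equiv.swap_apply_left] at this
  set t : ℂ := B.flip (g (Fin.last _)) (fderiv ℝ E (g 0) (η 0)) +
    B.flip (η (Fin.last _)) (E (g 0)) with ht
  have htre : t.re = 0 := hη.2
  have hX : ∀ a, B.flip (g a) (fderiv ℝ E (g 0) (η 0)) + B.flip (η a) (E (g 0)) =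
      B (fderiv ℝ E (g 0) (η 0) - (Complex.I * (s : ℂ)⁻¹) • ξ 0) (g a) := by
    intro a
    rw [hE, map_smul, map_sub, sub_apply, map_smul, smul_apply, hpair,
      ContinuousLinearMap.flip_apply, ContinuousLinearMap.flip_apply, smul_neg, sub_neg_eq_add]
  -- Tangency of `η` says that the difference from `(i / s) ξ_0` pairs to zero with every `g_a`, `a
  -- < m`, so it lies in `ℂ f_0`. Its coefficient `t` is imaginary, and applying `dD = dE⁻¹` turns
  -- this into the tangency of `ξ`.
  have hdE : fderiv ℝ E (g 0) (η 0) = (Complex.I * (s : ℂ)⁻¹) • ξ 0 + t • f 0 := by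
    rw [← sub_eq_iff_eq_add', ← sub_eq_zero]
    refine f.repr.map_eq_zero_iff.1 (Finsupp.ext fun b => ?_)
    rw [← hσσ b, ← hfg.apply_eq, map_sub, sub_apply, ← hX, map_smul, smul_apply, hf0g]
    generalize σ b = c
    induction c using Fin.lastCases with
    | last => rw [if_pos rfl, ← ht]; simp
    | cast a => rw [hη.1 a, if_neg (Fin.castSucc_lt_last a).ne]; simp
  have hlam : Complex.I * (s : ℂ)⁻¹ ≠ 0 := mul_ne_zero Complex.I_ne_zero (inv_ne_zero hsC)
  have hη0 : η 0 = (-(Complex.I * (s : ℂ)⁻¹)) • fderiv ℝ D (f 0) (ξ 0) +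
      (conj t * (Complex.I * s)) • g 0 := by
    have h1 := h.symm.fderiv_dual_grad (h.dual.mem_of_cone x hx _
      (h.mem_frameBundle hB hx hfg hf).1) (η 0)
    have h2 : (Complex.I * (s : ℂ)⁻¹) • ξ 0 + t • f 0 =
        (Complex.I * (s : ℂ)⁻¹) • (ξ 0 + ((Complex.I * (s : ℂ)⁻¹)⁻¹ * t) • f 0) := by
      rw [smul_add, smul_smul, mul_inv_cancel_left₀ hlam]
    rw [hdE, hE, h2, h.chart.fderiv_grad_smul_smul hO hlam, map_add,
      h.chart.fderiv_grad_smul_self hO, hD, smul_add, smul_smul, smul_smul, ← mul_assoc,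
      ← map_mul, mul_inv_cancel_left₀ hlam] at h1
    rw [← h1]
    congr 2
    · simp
    · ring
  have hdD : fderiv ℝ D (f 0) (ξ 0) = (Complex.I * s) • η 0 + ((s : ℂ) ^ 2 * conj t) • g 0 := by
    rw [hη0, smul_add, smul_smul, smul_smul]
    have h1 : Complex.I * (s : ℂ) * -(Complex.I * (s : ℂ)⁻¹) = 1 := by
      field_simp
      rw [Complex.I_sq]
      ring
    have h2 : Complex.I * (s : ℂ) * (conj t * (Complex.I * s)) = -((s : ℂ) ^ 2 * conj t) := by
      linear_combination (conj t * (s : ℂ) ^ 2) * Complex.I_sq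
    rw [h1, h2, one_smul, neg_smul, neg_add_cancel_right]
  have hfinal : ∀ a, B (f a) (fderiv ℝ D (f 0) (ξ 0)) + B (ξ a) (D (f 0)) =
      (s : ℂ) ^ 2 * conj t * if a = Fin.last _ then 1 else 0 := by
    intro a
    have h1 := hfg a 0
    rw [Equiv.swap_apply_left] at h1
    rw [hdD, hD, map_add, map_smul, map_smul, map_smul, hpair, h1]
    simp only [smul_eq_mul]
    ring
  refine ⟨ξ, (h.chart.mem_frameTangent_iff hB hx hf).2 ⟨fun a => ?_, ?_⟩, fun a b => ?_⟩
  · rw [hfinal, if_neg (Fin.castSucc_lt_last a).ne, mul_zero]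
  · rw [hfinal, if_pos rfl, mul_one, ← Complex.ofReal_pow, Complex.re_ofReal_mul, Complex.conj_re,
      htre, mul_zero]
  · rw [mc, mc, hmc, hσσ, hσσ, neg_neg]

/-- At `g` the forms `Ω^m_α`, `Ω^α_0`, `Ω^m_0` are `-η`, `-Ω`, `-θ` in terms of those at `f`. So the
first structure equation at `g` is `η = Q (Ω - θ p) - N conj (Ω - θ p)` with signs changed, and its
`θ` terms collect to `N p̄ - Q p`. -/
lemma secondOrderCoeffs [FiniteDimensional ℂ V] [FiniteDimensional ℂ V'] (hB : IsDuality B)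
    (h : IsDualPair B ι γ U O O' ρ ρ' D E) (hx : x ∈ U) (hfg : IsDualFrame B f g)
    {P L Q N : Matrix (Fin k) (Fin k) ℂ} {p : Fin k → ℂ} {r : ℂ}
    (hc : IsSecondOrderCoeffs ι x f P L p r) (hQ : Qᵀ = Q) (hN : Nᴴ = -N)
    (hX : block P L * block Q N = 1) :
    IsSecondOrderCoeffs γ x g Q (-N) (N *ᵥ star p - Q *ᵥ p)
      ((N *ᵥ star p - Q *ᵥ p) ⬝ᵥ p - conj ((N *ᵥ star p - Q *ᵥ p) ⬝ᵥ p) - r) := by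
  have hO := h.chart.mem_of_cone x hx _ hc.mem.1
  obtain ⟨s, hs, hsf⟩ := h.chart.exists_frame_scalar hB hx hc.mem
  have key : ∀ η ∈ frameTangent γ x g, ∃ ξ ∈ frameTangent ι x f,
      (∀ a b, mc g b a η = -mc f (Equiv.swap 0 (Fin.last (k + 1)) a)
        (Equiv.swap 0 (Fin.last (k + 1)) b) ξ) ∧
      conj (mc f (Fin.last _) 0 ξ) = mc f (Fin.last _) 0 ξ ∧
      (fun α => mc f (mid α) 0 ξ) = Q *ᵥ ((fun α => mc f (Fin.last _) (mid α) ξ) -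
          mc f (Fin.last _) 0 ξ • p) -
        N *ᵥ star ((fun α => mc f (Fin.last _) (mid α) ξ) - mc f (Fin.last _) 0 ξ • p) := by
    intro η hη
    obtain ⟨ξ, hξ, hmc⟩ := h.exists_frameTangent hB hx hfg hc.mem hη
    have hθ : (mc f (Fin.last _) 0 ξ).im = 0 := h.chart.mc_last_zero_im hs hO hsf
      ((h.chart.mem_frameTangent_iff hB hx hc.mem).1 hξ)
    refine ⟨ξ, hξ, hmc, Complex.conj_eq_iff_im.2 hθ, dual_structure_eq hc.skew hX ?_⟩
    ext α
    rw [hc.eq_alpha ξ hξ α]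
    simp only [Pi.add_apply, Matrix.mulVec, dotProduct, Pi.star_apply, Complex.star_def,
      Pi.smul_apply, smul_eq_mul]
    ring
  refine ⟨h.mem_frameBundle hB hx hfg hc.mem, hQ, ?_, ?_, ?_, ?_⟩
  · rw [Matrix.conjTranspose_neg, hN]
  · simp only [map_sub, Complex.conj_conj, hc.imag]
    ring
  · intro η hη α
    obtain ⟨ξ, hξ, hmc, hθ, heq⟩ := key η hη
    simp only [hmc, Equiv.swap_apply_left, Equiv.swap_apply_right, swap_mid, map_neg]
    rw [congrFun heq α]
    simp only [Matrix.mulVec_sub, Matrix.mulVec_smul, star_sub, star_smul, Complex.star_def, hθ,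
      Pi.sub_apply, Pi.smul_apply, smul_eq_mul, Matrix.mulVec, dotProduct, Pi.star_apply,
      Matrix.neg_apply, mul_neg, neg_mul, neg_neg, Finset.sum_neg_distrib]
    ring
  · intro η hη
    obtain ⟨ξ, hξ, hmc, hθ, heq⟩ := key η hη
    have h1 := hc.eq_m ξ hξ
    have h2 := dual_structure_dot hQ hN (p := p) heq
    have h3 : p ⬝ᵥ (fun α => mc f (mid α) 0 ξ) = ∑ α, p α * mc f (mid α) 0 ξ := rfl
    have h4 : ∑ α, conj (p α) * conj (mc f (mid α) 0 ξ) =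
        conj (∑ α, p α * mc f (mid α) 0 ξ) := by simp only [map_sum, map_mul]
    rw [h4] at h1
    set q := N *ᵥ star p - Q *ᵥ p with hq
    have h5 : q ⬝ᵥ (fun α => mc f (Fin.last _) (mid α) ξ) =
      ∑ α, q α * mc f (Fin.last _) (mid α) ξ := rfl
    have h6 : ∑ α, conj (q α) * conj (mc f (Fin.last _) (mid α) ξ) =
        conj (∑ α, q α * mc f (Fin.last _) (mid α) ξ) := by simp only [map_sum, map_mul]
    simp only [dotProduct_sub, dotProduct_smul, smul_eq_mul, map_sub, map_mul, hθ] at h2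
    rw [h3, h5] at h2
    -- Exchanging `Ω^0_0` with `Ω^m_m` and changing signs leaves the left side of the second
    -- structure equation unchanged.
    simp only [hmc, Equiv.swap_apply_left, Equiv.swap_apply_right, swap_mid, map_neg,
      mul_neg, Finset.sum_neg_distrib, neg_neg]
    rw [h6]
    linear_combination h1 - h2

end IsDualPair

end SecondOrder

/-! ### Transport along a homeomorphism and the embedded case -/

section Transfer

variable {V : Type*} [NormedAddCommGroup V] [NormedSpace ℂ V]
variable {M : Type*} [TopologicalSpace M] {M' : Type*} [TopologicalSpace M'] {k : ℕ}
variable {ι : M → ℙ ℂ V} (φ : M' ≃ₜ M) {x : M'}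

lemma IsCurveThrough.map {E : Type*} [NormedAddCommGroup E] [NormedSpace ℝ E] {X : Set (M × E)}
    {X' : Set (M' × E)} {ψ : M → M'} (hψ : Continuous ψ) (hX : ∀ m e, (m, e) ∈ X → (ψ m, e) ∈ X')
    {m : M} {v : E} {ε : ℝ} {y : ℝ → M} {c : ℝ → E} (h : IsCurveThrough X (m, v) ε y c) :
    IsCurveThrough X' (ψ m, v) ε (ψ ∘ y) c :=
  ⟨h.1, congrArg ψ h.2.1, h.2.2.1, hψ.comp_continuousOn h.2.2.2.1, h.2.2.2.2.1,
    fun t ht => hX _ _ (h.2.2.2.2.2 t ht)⟩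

/-- Curves are smooth in `E` but only continuous in the base, so a homeomorphism of the base
preserves them. -/
lemma tangentVectors_comp {E : Type*} [NormedAddCommGroup E] [NormedSpace ℝ E] {X : Set (M × E)}
    {X' : Set (M' × E)} (hX : ∀ m e, (m, e) ∈ X' ↔ (φ m, e) ∈ X) (v : E) :
    tangentVectors X' (x, v) = tangentVectors X (φ x, v) := by
  ext ξ
  constructor
  · rintro ⟨ε, y, c, hc, hξ⟩
    exact ⟨ε, _, c, hc.map φ.continuous fun m e h => (hX m e).1 h, hξ⟩
  · rintro ⟨ε, y, c, hc, hξ⟩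
    have := hc.map (X' := X') φ.symm.continuous fun m e h => (hX _ e).2 (by simpa using h)
    rw [φ.symm_apply_apply] at this
    exact ⟨ε, _, c, this, hξ⟩

lemma coneTangent_comp (v : V) : coneTangent (ι ∘ φ) x v = coneTangent ι (φ x) v :=
  tangentVectors_comp φ (fun _ _ => Iff.rfl) v

lemma coneHolTangent_comp (v : V) : coneHolTangent (ι ∘ φ) x v = coneHolTangent ι (φ x) v := by
  simp only [coneHolTangent, coneTangent_comp]

lemma mem_frameBundle_comp {f : Module.Basis (Fin (k + 2)) ℂ V} :
    (x, f) ∈ frameBundle (ι ∘ φ) ↔ (φ x, f) ∈ frameBundle ι := by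
  change _ ∧ _ = _ ↔ _ ∧ _ = _
  simp only [coneTangent_comp]
  exact Iff.rfl

lemma frameTangent_comp (f : Module.Basis (Fin (k + 2)) ℂ V) :
    frameTangent (ι ∘ φ) x f = frameTangent ι (φ x) f := by
  refine tangentVectors_comp φ (fun m e => ?_) _
  constructor
  · rintro ⟨⟨m', f'⟩, h, he⟩
    simp only [Prod.mk.injEq] at he
    obtain ⟨rfl, rfl⟩ := he
    exact ⟨(φ m', f'), (mem_frameBundle_comp φ).1 h, rfl⟩
  · rintro ⟨⟨m', f'⟩, h, he⟩
    simp only [Prod.mk.injEq] at he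
    obtain ⟨rfl, rfl⟩ := he
    exact ⟨(m, f'), (mem_frameBundle_comp φ).2 h, rfl⟩

lemma isSecondOrderCoeffs_comp {f : Module.Basis (Fin (k + 2)) ℂ V}
    {P L : Matrix (Fin k) (Fin k) ℂ} {p : Fin k → ℂ} {r : ℂ} :
    IsSecondOrderCoeffs (ι ∘ φ) x f P L p r ↔ IsSecondOrderCoeffs ι (φ x) f P L p r := by
  constructor
  · rintro ⟨h1, h2, h3, h4, h5, h6⟩
    rw [frameTangent_comp] at h5 h6
    exact ⟨(mem_frameBundle_comp φ).1 h1, h2, h3, h4, h5, h6⟩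
  · rintro ⟨h1, h2, h3, h4, h5, h6⟩
    rw [← frameTangent_comp] at h5 h6
    exact ⟨(mem_frameBundle_comp φ).2 h1, h2, h3, h4, h5, h6⟩

lemma isStronglyPseudoconvex_comp (h : IsStronglyPseudoconvex k ι) :
    IsStronglyPseudoconvex k (ι ∘ φ) := fun x f P L p r hc =>
  h (φ x) f P L p r ((isSecondOrderCoeffs_comp φ).1 hc)

lemma noContact_comp (h : NoContact ι) : NoContact (ι ∘ φ) := by
  rintro x w hw u hu hu' ⟨ε, y, c, hc, ho⟩
  rw [coneHolTangent_comp] at hu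
  exact h (φ x) w hw u hu hu' ⟨ε, _, c, hc.map φ.continuous fun _ _ h => h, ho⟩

lemma image_snd_normalizedBundle_comp :
    Prod.snd '' normalizedBundle (k := k) (ι ∘ φ) = Prod.snd '' normalizedBundle (k := k) ι := by
  ext f
  constructor
  · rintro ⟨⟨x, f⟩, ⟨P, L, hc⟩, rfl⟩
    exact ⟨(φ x, f), ⟨P, L, (isSecondOrderCoeffs_comp φ).1 hc⟩, rfl⟩
  · rintro ⟨⟨x, f⟩, ⟨P, L, hc⟩, rfl⟩
    refine ⟨(φ.symm x, f), ⟨P, L, (isSecondOrderCoeffs_comp φ).2 ?_⟩, rfl⟩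
    rwa [φ.apply_symm_apply]

lemma isImmersedHypersurface_subtypeVal {S : Set (ℙ ℂ V)} (h : IsHypersurface S) :
    IsImmersedHypersurface (Subtype.val : S → ℙ ℂ V) := by
  intro x
  refine ⟨univ, isOpen_univ, mem_univ x, ?_, ?_⟩
  · exact IsEmbedding.subtypeVal.comp IsEmbedding.subtypeVal
  · rwa [image_univ, Subtype.range_coe]

/-- A chart sees only the cone over `ι '' U`. As `ι` is an embedding, `U = ι⁻¹ N` with `N` open, and
shrinking `O` to the cone over `N` keeps every other sheet away. -/
lemma isHypersurface_range_of_charts {V' : Type*} [NormedAddCommGroup V'] [NormedSpace ℂ V']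
    {B : V →L[ℂ] V' →L[ℂ] ℂ} (hB : IsDuality B) (hι : IsEmbedding ι)
    (h : ∀ x, ∃ U O ρ D, x ∈ U ∧ IsChart B ι U O ρ D) : IsHypersurface (range ι) := by
  intro v hv
  rw [← image_univ, mem_coneOver_image] at hv
  obtain ⟨x, -, hc⟩ := hv
  obtain ⟨U, O, ρ, D, hx, h⟩ := h x
  obtain ⟨N, hN, rfl⟩ := hι.isInducing.isOpen_iff.1 h.isOpen_dom
  have hmem : ∀ y w, (y, w) ∈ cone ι → (w ∈ coneOver N ↔ ι y ∈ N) := by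
    intro y w hw
    obtain ⟨h0, h1⟩ := mem_cone_iff.1 hw
    exact ⟨fun ⟨_, h2⟩ => h1 ▸ h2, fun h2 => ⟨h0, h1.symm ▸ h2⟩⟩
  have hvO := h.mem_of_cone x hx v hc
  refine ⟨O ∩ coneOver N, ρ, h.conic.isOpen.inter (isConicOpen_of_isOpen hN).isOpen,
    ⟨hvO, (hmem x v hc).2 hx⟩, h.contDiffOn.mono inter_subset_left, ?_, fun w hw => ?_⟩
  · rw [(h.hasFDerivAt v hvO).fderiv]
    intro h0
    exact h.grad_ne_zero v hvO (hB.eq_zero_of_re_right fun u => DFunLike.congr_fun h0 u)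
  · rw [← image_univ, mem_coneOver_image, h.eq_zero_iff w hw.1]
    exact ⟨fun ⟨y, _, hy⟩ => ⟨h.conic.ne_zero w hw.1, y, (hmem y w hy).1 hw.2, hy⟩,
      fun ⟨_, y, _, hy⟩ => ⟨y, mem_univ y, hy⟩⟩

end Transfer

/-! ### Inverse coefficients, pseudoconvexity and existence of adapted frames -/

section Duality

variable {V : Type*} [NormedAddCommGroup V] [NormedSpace ℂ V] [FiniteDimensional ℂ V]
variable {V' : Type*} [NormedAddCommGroup V'] [NormedSpace ℂ V']
variable {M : Type*} [TopologicalSpace M] {k : ℕ}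
variable {B : V →L[ℂ] V' →L[ℂ] ℂ} {ι : M → ℙ ℂ V} {γ : M → ℙ ℂ V'} {U : Set M}
  {O : Set V} {O' : Set V'} {ρ : V → ℝ} {ρ' : V' → ℝ} {D : V → V'} {E : V' → V} {x : M}
  {f : Module.Basis (Fin (k + 2)) ℂ V} {g : Module.Basis (Fin (k + 2)) ℂ V'}

lemma IsDualPair.exists_inverse_coeffs [FiniteDimensional ℂ V'] (hB : IsDuality B)
    (h : IsDualPair B ι γ U O O' ρ ρ' D E) (hN : NoContact ι) (hx : x ∈ U)
    (hfg : IsDualFrame B f g) {P L : Matrix (Fin k) (Fin k) ℂ} {p : Fin k → ℂ} {r : ℂ}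
    (hc : IsSecondOrderCoeffs ι x f P L p r) :
    ∃ Q N : Matrix (Fin k) (Fin k) ℂ, block P L * block Q N = 1 ∧
      IsSecondOrderCoeffs γ x g Q (-N) (N *ᵥ star p - Q *ᵥ p)
        ((N *ᵥ star p - Q *ᵥ p) ⬝ᵥ p - conj ((N *ᵥ star p - Q *ᵥ p) ⬝ᵥ p) - r) := by
  obtain ⟨Q, N, hQ, hNs, hX⟩ := exists_block_inverse hc.symm hc.skew
    (isUnit_det_block hc.skew fun z hz => h.chart.form_ne_zero hB hN hx hc hz)
  exact ⟨Q, N, hX, h.secondOrderCoeffs hB hx hfg hc hQ hNs hX⟩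

lemma IsDualPair.mem_normalizedBundle [FiniteDimensional ℂ V'] (hB : IsDuality B)
    (h : IsDualPair B ι γ U O O' ρ ρ' D E) (hN : NoContact ι) (hx : x ∈ U)
    (hfg : IsDualFrame B f g) (hf : (x, f) ∈ normalizedBundle ι) :
    (x, g) ∈ normalizedBundle γ := by
  obtain ⟨P, L, hc⟩ := hf
  obtain ⟨Q, N, -, hc'⟩ := h.exists_inverse_coeffs hB hN hx hfg hc
  refine ⟨Q, -N, ?_⟩
  simpa using hc'

lemma isStronglyPseudoconvex_of_noContact (hB : IsDuality B) (hN : NoContact ι)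
    (h : ∀ x, ∃ U O ρ D, x ∈ U ∧ IsChart B ι U O ρ D) : IsStronglyPseudoconvex k ι := by
  intro x f P L p r hc
  obtain ⟨U, O, ρ, D, hx, h⟩ := h x
  exact isDefiniteForm_of_form_ne_zero fun z hz => h.form_ne_zero hB hN hx hc hz

lemma exists_basis_zero_eq {K : Type*} [NormedAddCommGroup K] [NormedSpace ℂ K]
    [FiniteDimensional ℂ K] {n : ℕ} (hn : Module.finrank ℂ K = n + 1) {v : K} (hv : v ≠ 0) :
    ∃ b : Module.Basis (Fin (n + 1)) ℂ K, b 0 = v := by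
  let b₀ := Module.finBasisOfFinrankEq ℂ K hn
  obtain ⟨A, hA⟩ := SeparatingDual.exists_continuousLinearEquiv_apply_eq (R := ℂ) (b₀.ne_zero 0) hv
  exact ⟨b₀.map A.toLinearEquiv, hA⟩

/-- Extend `w` to a basis of the kernel of `B(·, D w)` and append a vector with pairing `i`. It
ensures that `gaussMap` uses its first branch. -/
lemma IsChart.exists_frame (hV : Module.finrank ℂ V = k + 2) (hB : IsDuality B)
    (h : IsChart B ι U O ρ D) (hx : x ∈ U) :
    ∃ f : Module.Basis (Fin (k + 2)) ℂ V, (x, f) ∈ frameBundle ι := by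
  obtain ⟨w, hw⟩ := exists_mem_cone ι x
  have hwO := h.mem_of_cone x hx w hw
  set l : V →ₗ[ℂ] ℂ := (B.flip (D w)).toLinearMap with hl
  have hlB : ∀ v, l v = B v (D w) := fun v => rfl
  have hl0 : l ≠ 0 := fun h0 => h.grad_ne_zero w hwO
    (hB.right _ fun v => LinearMap.congr_fun h0 v)
  obtain ⟨u, hu⟩ : ∃ u, l u = Complex.I := LinearMap.surjective hl0 _
  have hwl : l w = 0 := h.apply_grad_self hx hw
  have hK : Module.finrank ℂ (LinearMap.ker l) = k + 1 := by
    have h1 := Module.Dual.finrank_ker_add_one_of_ne_zero hl0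
    omega
  obtain ⟨b, hb⟩ := exists_basis_zero_eq hK (v := (⟨w, hwl⟩ : LinearMap.ker l))
    fun h0 => hw.1 (congrArg Subtype.val h0)
  let f : Module.Basis (Fin (k + 2)) ℂ V := Module.Basis.mkFinSnoc b u
    (fun c y hy hc => by
      have h1 := congrArg l hc
      rw [map_add, map_smul, (LinearMap.mem_ker.1 hy : l y = 0), hu, map_zero] at h1
      simpa using h1)
    (fun z => ⟨l z * Complex.I, by
      rw [LinearMap.mem_ker, map_add, map_smul, hu, smul_eq_mul, mul_assoc, Complex.I_mul_I]
      ring⟩)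
  have hfc : ∀ a : Fin (k + 1), f a.castSucc = b a := fun a => by simp [f]
  have hfl : f (Fin.last _) = u := by simp [f]
  have hf0 : f 0 = w := by
    rw [← Fin.castSucc_zero, hfc, hb]
  refine ⟨f, (h.mem_frameBundle_iff hB hx).2 ⟨by rwa [hf0], fun a => ?_, ?_⟩⟩
  · rw [hf0, hfc, ← hlB]
    exact (b a).2
  · rw [hf0, hfl, ← hlB, hu, Complex.I_re]

end Duality

/-! ### The evaluation pairing and the Gauss map -/

section GaussMap

variable {W : Type*} [NormedAddCommGroup W] [NormedSpace ℂ W] [FiniteDimensional ℂ W] {k : ℕ}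
variable {M : Type*} [TopologicalSpace M] {ι : M → ℙ ℂ W}

/-- The evaluation pairing of a space and its dual. -/
noncomputable def evalPairing (W : Type*) [NormedAddCommGroup W] [NormedSpace ℂ W] :
    W →L[ℂ] StrongDual ℂ W →L[ℂ] ℂ :=
  ContinuousLinearMap.apply ℂ ℂ

lemma isDuality_evalPairing {W : Type*} [NormedAddCommGroup W] [NormedSpace ℂ W] :
    IsDuality (evalPairing W) where
  left := by
    intro v hv
    by_contra h0
    obtain ⟨e, he⟩ := SeparatingDual.exists_eq_one (R := ℂ) h0
    exact one_ne_zero (he.symm.trans (hv e))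
  right := fun l hl => ContinuousLinearMap.ext hl

lemma isDualFrame_Gam (f : Module.Basis (Fin (k + 2)) ℂ W) :
    IsDualFrame (evalPairing W) f (Gam f) := by
  intro a b
  have h1 : evalPairing W (f a) (Gam f b) =
      f.dualBasis (Equiv.swap 0 (Fin.last (k + 1)) b) (f a) := by
    rw [Gam, Module.Basis.reindex_apply, Equiv.symm_swap, Module.Basis.map_apply]
    rfl
  rw [h1, Module.Basis.dualBasis_apply_self]

/-- By reflexivity the basis dual to `g` comes from vectors of `W`; exchanging the first and last
ones gives `f`. -/
lemma exists_Gam_eq (g : Module.Basis (Fin (k + 2)) ℂ (StrongDual ℂ W)) :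
    ∃ f, Gam f = g := by
  have := (isDuality_evalPairing (W := W)).isPerfPair
  let T := (ContinuousLinearMap.toLinearMap₁₂ (evalPairing W)).toPerfPair
  let f : Module.Basis (Fin (k + 2)) ℂ W :=
    (g.dualBasis.map T.symm).reindex (Equiv.swap 0 (Fin.last (k + 1)))
  have hf : IsDualFrame (evalPairing W) f g := by
    intro a b
    have h1 : evalPairing W (f a) (g b) =
        g.dualBasis (Equiv.swap 0 (Fin.last (k + 1)) a) (g b) := by
      have h2 : T (f a) = g.dualBasis (Equiv.swap 0 (Fin.last (k + 1)) a) := by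
        simp only [f, Module.Basis.reindex_apply, Equiv.symm_swap, Module.Basis.map_apply,
          LinearEquiv.apply_symm_apply]
      exact LinearMap.congr_fun h2 (g b)
    rw [h1, Module.Basis.dualBasis_apply_self]
    congr 1
    rw [eq_iff_iff]
    constructor
    · rintro rfl
      rw [swap_swap_apply]
    · rintro rfl
      rw [swap_swap_apply]
  refine ⟨f, Module.Basis.eq_of_apply_eq fun b => ContinuousLinearMap.ext fun v => ?_⟩
  exact ((isDualFrame_Gam f).apply_eq v b).trans (hf.apply_eq v b).symm

/-- For the frame chosen in `gaussMap`, `D f_0` is a nonzero multiple of `f^m`; homogeneity of `D`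
covers every other `w` over `x`. -/
lemma mem_cone_gaussMap (hW : Module.finrank ℂ W = k + 2) {U : Set M} {O : Set W} {ρ : W → ℝ}
    {D : W → StrongDual ℂ W} (h : IsChart (evalPairing W) ι U O ρ D) {x : M} (hx : x ∈ U) {w : W}
    (hw : (x, w) ∈ cone ι) : (x, D w) ∈ cone (gaussMap hW ι) := by
  have hex := h.exists_frame hW isDuality_evalPairing hx
  obtain ⟨s, hs, hD⟩ := h.exists_grad_eq_smul isDuality_evalPairing hx
    (isDualFrame_Gam hex.choose) hex.choose_spec
  have h1 : (x, Gam hex.choose 0) ∈ cone (gaussMap hW ι) := by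
    refine mem_cone_iff.2 ⟨(Gam hex.choose).ne_zero 0, ?_⟩
    simp only [gaussMap, dif_pos hex]
  obtain ⟨c, hc, rfl⟩ := exists_smul_eq_of_mem_cone hex.choose_spec.1 hw
  rw [h.grad_smul _ (h.mem_of_cone x hx _ hex.choose_spec.1) c hc]
  simp only
  rw [hD]
  exact smul_mem_cone (smul_mem_cone h1 (mul_ne_zero Complex.I_ne_zero (by exact_mod_cast hs)))
    (by simpa using hc)

lemma exists_isDualPair_gaussMap (hW : Module.finrank ℂ W = k + 2)
    (hι : IsImmersedHypersurface ι) (hN : NoContact ι) (x : M) :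
    ∃ U O O' ρ ρ' D E, x ∈ U ∧
      IsDualPair (evalPairing W) ι (gaussMap hW ι) U O O' ρ ρ' D E := by
  obtain ⟨U, O, ρ, D, hx, h⟩ := exists_chart isDuality_evalPairing hι x
  obtain ⟨U₁, O₁, O', ρ', E, hx', hp⟩ := exists_isDualPair isDuality_evalPairing h hN hx
    fun y hy w hw => mem_cone_gaussMap hW h hy hw
  exact ⟨U₁, O₁, O', ρ, ρ', D, E, hx', hp⟩

end GaussMap

end CRHypersurface

/-! ### The duality theorem -/

theorem lemmaL {W : Type*} [NormedAddCommGroup W] [NormedSpace ℂ W] [FiniteDimensional ℂ W]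
    {k : ℕ} (hW : Module.finrank ℂ W = k + 2)
    {M : Type*} [TopologicalSpace M] (ι : M → ℙ ℂ W) (hS : IsSCLC k ι) :
    -- the dual is an (immersed) strongly ℂ-linearly convex hypersurface
    IsSCLC k (gaussMap hW ι) ∧
    -- `Γ` maps `P_S` onto `P_{S*}`
    Prod.map id Gam '' (normalizedBundle (k := k) ι) =
      normalizedBundle (k := k) (gaussMap hW ι) ∧
    -- the second fundamental form of the dual is given by `(Q, -M)`
    (∀ (x : M) (f : Module.Basis (Fin (k + 2)) ℂ W), (x, f) ∈ frameBundle ι →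
      (∃ P L p r, IsSecondOrderCoeffs ι x f P L p r) ∧
      ∀ P L p r, IsSecondOrderCoeffs ι x f P L p r →
        ∃ Q N : Matrix (Fin k) (Fin k) ℂ, block P L * block Q N = 1 ∧
          ∃ p' r', IsSecondOrderCoeffs (gaussMap hW ι) x (Gam f) Q (-N) p' r') ∧
    -- if the Gauss map is an embedding, then the image `S*` is an embedded such hypersurface
    (IsEmbedding (gaussMap hW ι) →
      IsHypersurface (range (gaussMap hW ι)) ∧
      IsSCLC k (Subtype.val : range (gaussMap hW ι) → ℙ ℂ (StrongDual ℂ W)) ∧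
      Gam '' (Prod.snd '' normalizedBundle (k := k) ι) =
        Prod.snd '' normalizedBundle (k := k)
          (Subtype.val : range (gaussMap hW ι) → ℙ ℂ (StrongDual ℂ W))) := by
  have hN : NoContact ι := hS.noContact
  have hB := isDuality_evalPairing (W := W)
  have hp := exists_isDualPair_gaussMap hW hS.hypersurface hN
  have hNγ : NoContact (gaussMap hW ι) := noContact_of_dualPairs hB hN hp
  have hcharts : ∀ x, ∃ U O ρ D, x ∈ U ∧
      IsChart (evalPairing W).flip (gaussMap hW ι) U O ρ D := fun x => by
    obtain ⟨U, O, O', ρ, ρ', D, E, hx, h⟩ := hp x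
    exact ⟨U, O', ρ', E, hx, h.dual⟩
  have hpsc : IsStronglyPseudoconvex k (gaussMap hW ι) :=
    isStronglyPseudoconvex_of_noContact hB.flip hNγ hcharts
  have hbundle : Prod.map id Gam '' (normalizedBundle (k := k) ι) =
      normalizedBundle (k := k) (gaussMap hW ι) := by
    ext ⟨x, g⟩
    obtain ⟨U, O, O', ρ, ρ', D, E, hx, h⟩ := hp x
    constructor
    · rintro ⟨⟨y, f⟩, hf, he⟩
      obtain ⟨rfl, rfl⟩ := Prod.mk.inj he
      exact h.mem_normalizedBundle hB hN hx (isDualFrame_Gam f) hf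
    · intro hg
      obtain ⟨f, rfl⟩ := exists_Gam_eq g
      -- Surjectivity is the same inclusion for the reversed dual pair, now that `S*` is known to
      -- have no contact.
      exact ⟨(x, f), h.symm.mem_normalizedBundle hB.flip hNγ hx (isDualFrame_Gam f).symm hg, rfl⟩
  refine ⟨⟨isImmersedHypersurface_of_charts hB.flip hcharts, hpsc, hNγ⟩, hbundle,
    fun x f hf => ?_, fun hemb => ?_⟩
  · obtain ⟨U, O, O', ρ, ρ', D, E, hx, h⟩ := hp x
    refine ⟨h.chart.exists_secondOrderCoeffs hB hx hf, fun P L p r hc => ?_⟩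
    obtain ⟨Q, N, hX, hc'⟩ := h.exists_inverse_coeffs hB hN hx (isDualFrame_Gam f) hc
    exact ⟨Q, N, hX, _, _, hc'⟩
  · have hyp := isHypersurface_range_of_charts hB.flip hemb hcharts
    -- The inclusion of the image is the Gauss map reparametrised by this homeomorphism, so the
    -- immersed results transfer.
    let φ := hemb.toHomeomorph.symm
    have hval : (Subtype.val : range (gaussMap hW ι) → ℙ ℂ (StrongDual ℂ W)) =
        gaussMap hW ι ∘ φ :=
      funext fun y => (congrArg Subtype.val (hemb.toHomeomorph.apply_symm_apply y)).symm
    refine ⟨hyp, ⟨isImmersedHypersurface_subtypeVal hyp, ?_, ?_⟩, ?_⟩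
    · rw [hval]
      exact isStronglyPseudoconvex_comp φ hpsc
    · have := noContact_comp φ hNγ
      rwa [← hval] at this
    · rw [hval, image_snd_normalizedBundle_comp φ, ← hbundle, image_image, image_image]
      rfl
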